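/- Let $M$ be a finite-dimensional smooth manifold (Hausdorff, second countable, without boundary), let $\mathcal D\subset TM$ be a smooth distribution of rank $k$ on $M$, let $P,Q\subset M$ be smooth embedded submanifolds, and let $a<b$ be real numbers. Let $\Omega_P([a,b],M,\mathcal D)$ be the set of horizontal curves that start in $P$, i.e. of curves $\mu:[a,b]\to M$ of class $C^1$ with $\mu'(t)\in\mathcal D$ for all $t\in[a,b]$ and $\mu(a)\in P$. It is an embedded Banach submanifold of the Banach manifold $\Omega([a,b],M)$ of all curves $[a,b]\to M$ of class $C^1$. Let $\Omega_{PQ}([a,b],M,\mathcal D)$ be the set of $\mu\in\Omega_P([a,b],M,\mathcal D)$ with $\mu(b)\in Q$. A curve $\gamma\in\Omega_{PQ}([a,b],M,\mathcal D)$ is called regular in $\Omega_{PQ}([a,b],M,\mathcal D)$ if the endpoint map $\Omega_P([a,b],M,\mathcal D)\ni\mu\mapsto\mu(b)\in M$ is transverse to $Q$ at $\gamma$, i.e. (since $M$ is finite-dimensional) if the image of the differential of the endpoint map at $\gamma$ plus $T_{\gamma(b)}Q$ equals $T_{\gamma(b)}M$; otherwise it is called singular in $\Omega_{PQ}([a,b],M,\mathcal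 D)$. Let $\pi:TM^*\to M$ be the cotangent bundle, let $\omega=-\mathrm d\vartheta$ be its canonical symplectic form, where $\vartheta_p(\zeta)=p\big(\mathrm d\pi_p(\zeta)\big)$, and let $\mathcal D^{\mathrm o}\subset TM^*$ be the annihilator of $\mathcal D$. A characteristic of $\mathcal D$ is a curve $\eta:[a,b]\to TM^*$ of class $C^1$ such that, for all $t\in[a,b]$, $\eta(t)\in\mathcal D^{\mathrm o}$ and $\eta'(t)\in T_{\eta(t)}\mathcal D^{\mathrm o}$ lies in the kernel of the restriction of $\omega_{\eta(t)}$ to $T_{\eta(t)}\mathcal D^{\mathrm o}$. Then a curve $\gamma\in\Omega_{PQ}([a,b],M,\mathcal D)$ is singular in $\Omega_{PQ}([a,b],M,\mathcal D)$ if and only if there exists a characteristic $\eta:[a,b]\to TM^*$ of $\mathcal D$ that is not identically zero and satisfies $\pi\circ\eta=\gamma$, $\eta(a)|_{T_{\gamma(a)}P}=0$ and $\eta(b)|_{T_{\gamma(b)}Q}=0$. -/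

import Mathlib

open Set Filter Topology Manifold ContDiff

noncomputable section

namespace HorizontalCurves

/-! ### Tangent vectors to subsets and exterior derivative of one-forms -/

section General

variable {F H : Type*} [NormedAddCommGroup F] [NormedSpace ℝ F] [TopologicalSpace H]
  (J : ModelWithCorners ℝ F H) {N : Type*} [TopologicalSpace N] [ChartedSpace H N]

/-- The vectors at `p` that are tangent to `S ⊆ N`: velocities at time `0` of `C^1` curves of `N`
that pass through `p` at time `0` and stay in `S`. If `S` is an embedded submanifold and `p ∈ S`,
this is the tangent space `T_p S` as a subset of `T_p N`. The equation takes place in the tangent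
bundle, so it says both `c 0 = p` and `c' 0 = v`. -/
def tangentVectors (S : Set N) (p : N) : Set (TangentSpace J p) :=
  {v | ∃ c : ℝ → N, ContMDiffAt 𝓘(ℝ, ℝ) J 1 c 0 ∧ (∀ᶠ s in 𝓝 (0 : ℝ), c s ∈ S) ∧
    tangentMap 𝓘(ℝ, ℝ) J c (⟨0, (1 : ℝ)⟩ : TangentBundle 𝓘(ℝ, ℝ) ℝ) = ⟨p, v⟩}

/-- The velocity at time `t` of a curve defined on `[a, b]` (one-sided at the endpoints). -/
def velocity (a b : ℝ) (c : ℝ → N) (t : ℝ) : TangentSpace J (c t) :=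
  mfderivWithin 𝓘(ℝ, ℝ) J c (Icc a b) t (1 : ℝ)

/-- The coordinate representation of the one-form `α` in the chart at `p`, i.e. the pull-back of
`α` by the inverse of that chart. -/
def oneFormInChart (α : ∀ q : N, TangentSpace J q →L[ℝ] ℝ) (p : N) (x : F) : F →L[ℝ] ℝ :=
  (α ((extChartAt J p).symm x)).comp (mfderiv 𝓘(ℝ, F) J (extChartAt J p).symm x)

/-- The exterior derivative of a one-form `α` on a manifold without boundary,
`dα (u, v) = D_u α (v) - D_v α (u)`, computed at `p` in the chart at `p`. -/
def extDerivOneForm (α : ∀ q : N, TangentSpace J q →L[ℝ] ℝ) (p : N)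
    (u v : TangentSpace J p) : ℝ :=
  let dφ : TangentSpace J p →L[ℝ] F := mfderiv J 𝓘(ℝ, F) (extChartAt J p) p
  let Dα : F →L[ℝ] F →L[ℝ] ℝ := fderiv ℝ (oneFormInChart J α p) (extChartAt J p p)
  Dα (dφ u) (dφ v) - Dα (dφ v) (dφ u)

end General

variable {E : Type*} [NormedAddCommGroup E] [NormedSpace ℝ E]
  {M : Type*} [TopologicalSpace M] [ChartedSpace E M]

/-! ### Submanifolds and distributions -/

/-- Smooth embedded submanifolds without boundary: around each of its points, `S` is given in some
smooth chart of `M` by a linear subspace. -/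
def IsEmbeddedSubmanifold (S : Set M) : Prop :=
  ∀ p ∈ S, ∃ φ ∈ IsManifold.maximalAtlas 𝓘(ℝ, E) ∞ M, p ∈ φ.source ∧
    ∃ V : Submodule ℝ E, ∀ x ∈ φ.source, x ∈ S ↔ φ x ∈ V

/-- `D` is a smooth distribution of rank `k` on `M`: locally it is spanned by `k` pointwise linearly
independent smooth vector fields. -/
def IsSmoothDistribution [IsManifold 𝓘(ℝ, E) ∞ M] (k : ℕ)
    (D : ∀ m : M, Submodule ℝ (TangentSpace 𝓘(ℝ, E) m)) : Prop :=
  ∀ m : M, ∃ U : Set M, IsOpen U ∧ m ∈ U ∧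
    ∃ X : Fin k → ∀ x : M, TangentSpace 𝓘(ℝ, E) x,
      (∀ i, ContMDiffOn 𝓘(ℝ, E) 𝓘(ℝ, E).tangent ∞
        (fun x => (⟨x, X i x⟩ : TangentBundle 𝓘(ℝ, E) M)) U) ∧
      ∀ x ∈ U, LinearIndependent ℝ (fun i => X i x) ∧ Submodule.span ℝ (range fun i => X i x) = D x

/-! ### The cotangent bundle and characteristics -/

variable (E M) in
/-- The cotangent bundle of `M`. -/
abbrev CotangentBundle [IsManifold 𝓘(ℝ, E) 1 M] : Type _ :=
  Bundle.TotalSpace (E →L[ℝ] ℝ) (fun x : M => TangentSpace 𝓘(ℝ, E) x →L[ℝ] ℝ)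

variable (E) in
/-- The model of the cotangent bundle as a smooth manifold. -/
abbrev cotangentModel := 𝓘(ℝ, E).prod 𝓘(ℝ, E →L[ℝ] ℝ)

/-- The canonical one-form: `ϑ_p (ζ) = p (dπ_p ζ)`. -/
def canonicalOneForm [IsManifold 𝓘(ℝ, E) ∞ M] (p : CotangentBundle E M) :
    TangentSpace (cotangentModel E) p →L[ℝ] ℝ :=
  p.2.comp (mfderiv (cotangentModel E) 𝓘(ℝ, E)
    (fun q : CotangentBundle E M => q.1) p)

/-- The canonical symplectic form `ω = -dϑ` of the cotangent bundle. -/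
def canonicalSymplecticForm [IsManifold 𝓘(ℝ, E) ∞ M] (p : CotangentBundle E M)
    (u v : TangentSpace (cotangentModel E) p) : ℝ :=
  -extDerivOneForm (cotangentModel E) (N := CotangentBundle E M) canonicalOneForm p u v

/-- The annihilator of a distribution, as a subset of the cotangent bundle. -/
def annihilator [IsManifold 𝓘(ℝ, E) ∞ M] (D : ∀ m : M, Submodule ℝ (TangentSpace 𝓘(ℝ, E) m)) :
    Set (CotangentBundle E M) :=
  {p | ∀ v ∈ D p.1, p.2 v = 0}

/-- `η : [a, b] → TM^*` is a characteristic of `D`: it is of class `C^1`, takes values in the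
annihilator `D°`, and its velocity lies in the kernel of the restriction of `ω` to `T D°`. -/
structure IsCharacteristic [IsManifold 𝓘(ℝ, E) ∞ M]
    (D : ∀ m : M, Submodule ℝ (TangentSpace 𝓘(ℝ, E) m)) (a b : ℝ)
    (η : ℝ → CotangentBundle E M) : Prop where
  contMDiffOn : ContMDiffOn 𝓘(ℝ, ℝ) (cotangentModel E) 1 η (Icc a b)
  mem_annihilator : ∀ t ∈ Icc a b, η t ∈ annihilator D
  velocity_mem : ∀ t ∈ Icc a b, velocity (cotangentModel E) a b η t ∈
    tangentVectors (cotangentModel E) (annihilator D) (η t)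
  velocity_mem_ker : ∀ t ∈ Icc a b,
    ∀ ζ ∈ tangentVectors (cotangentModel E) (annihilator D) (η t),
      canonicalSymplecticForm (η t) (velocity (cotangentModel E) a b η t) ζ = 0

/-! ### Spaces of horizontal curves

Curves `[a, b] → M` are represented by functions `ℝ → M`, of which only the values on `[a, b]`
are ever used. -/

/-- `Ω_P([a, b], M, D)`: horizontal curves of class `C^1` that start in `P`. -/
def horizontalCurvesFrom (D : ∀ m : M, Submodule ℝ (TangentSpace 𝓘(ℝ, E) m)) (a b : ℝ)
    (P : Set M) : Set (ℝ → M) :=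
  {γ | ContMDiffOn 𝓘(ℝ, ℝ) 𝓘(ℝ, E) 1 γ (Icc a b) ∧
    (∀ t ∈ Icc a b, velocity 𝓘(ℝ, E) a b γ t ∈ D (γ t)) ∧ γ a ∈ P}

/-- `Ω_{PQ}([a, b], M, D)`: horizontal curves of class `C^1` from `P` to `Q`. -/
def horizontalCurves (D : ∀ m : M, Submodule ℝ (TangentSpace 𝓘(ℝ, E) m)) (a b : ℝ)
    (P Q : Set M) : Set (ℝ → M) :=
  {γ | γ ∈ horizontalCurvesFrom D a b P ∧ γ b ∈ Q}

variable (E) in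
/-- `s ↦ σ s`, for `s` near `0`, is a curve of class `C^1` in the Banach manifold
`Ω([a, b], M)` of curves `[a, b] → M` of class `C^1`.
Locally in `t`, on intervals `[t₀, t₁]` that are mapped by the curves `σ s` into the domain of a
chart `φ` of `M`, the curve `s ↦ φ ∘ (σ s)|[t₀, t₁]` is of class `C^1` in the Banach space
`C^1([t₀, t₁], E)`. The latter is identified with the closed subspace of the pairs `(x, x')` in
`C^0([t₀, t₁], E) × C^0([t₀, t₁], E)`. -/
def IsC1CurveOfCurves (a b : ℝ) (σ : ℝ → ℝ → M) : Prop :=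
  ∀ t ∈ Icc a b, ∃ t₀ t₁ : ℝ, Icc t₀ t₁ ⊆ Icc a b ∧ Icc t₀ t₁ ∈ 𝓝[Icc a b] t ∧
    ∃ φ ∈ atlas E M, ∃ x x' : ℝ → C(Icc t₀ t₁, E),
      ContDiffAt ℝ 1 x 0 ∧ ContDiffAt ℝ 1 x' 0 ∧
      ∀ᶠ s in 𝓝 (0 : ℝ), ∀ τ : Icc t₀ t₁, σ s τ ∈ φ.source ∧ x s τ = φ (σ s τ) ∧
        HasDerivWithinAt (fun r : ℝ => φ (σ s r)) (x' s τ) (Icc t₀ t₁) τ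

/-- The tangent space at `γ` of the Banach submanifold `Ω_P([a, b], M, D)` of `Ω([a, b], M)`, as a
set of vector fields along `γ`: the velocities at `s = 0` of the `C^1` curves `s ↦ σ s` of
`Ω([a, b], M)` that stay in `Ω_P([a, b], M, D)` and pass through `γ` at `s = 0`. As a vector field
along `γ`, this velocity is `ξ t = ∂/∂s (σ s t)` at `s = 0`; the equation in the tangent bundle
includes `σ 0 t = γ t`. -/
def tangentFields (D : ∀ m : M, Submodule ℝ (TangentSpace 𝓘(ℝ, E) m)) (a b : ℝ) (P : Set M)
    (γ : ℝ → M) : Set (∀ t : ℝ, TangentSpace 𝓘(ℝ, E) (γ t)) :=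
  {ξ | ∃ σ : ℝ → ℝ → M, IsC1CurveOfCurves E a b σ ∧
    (∀ᶠ s in 𝓝 (0 : ℝ), σ s ∈ horizontalCurvesFrom D a b P) ∧
    ∀ t ∈ Icc a b, tangentMap 𝓘(ℝ, ℝ) 𝓘(ℝ, E) (fun s : ℝ => σ s t)
      (⟨0, (1 : ℝ)⟩ : TangentBundle 𝓘(ℝ, ℝ) ℝ) = ⟨γ t, ξ t⟩}

/-- The image of the differential at `γ` of the endpoint map `Ω_P([a, b], M, D) ∋ μ ↦ μ b ∈ M`.
The differential maps the velocity `ξ` of `s ↦ σ s` to the velocity `ξ b` of `s ↦ σ s b`. -/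
def endpointDifferentialImage (D : ∀ m : M, Submodule ℝ (TangentSpace 𝓘(ℝ, E) m)) (a b : ℝ)
    (P : Set M) (γ : ℝ → M) : Set (TangentSpace 𝓘(ℝ, E) (γ b)) :=
  (fun ξ : ∀ t : ℝ, TangentSpace 𝓘(ℝ, E) (γ t) => ξ b) '' tangentFields D a b P γ

/-- `γ` is regular in `Ω_{PQ}([a, b], M, D)`: the endpoint map on `Ω_P([a, b], M, D)` is transverse
to `Q` at `γ`, i.e. the image of its differential and `T_{γ(b)} Q` together span `T_{γ(b)} M`. As
`M` is finite-dimensional, the requirement that the inverse image of `T_{γ(b)} Q` under the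
differential be a complemented subspace is automatic. -/
def IsRegular (D : ∀ m : M, Submodule ℝ (TangentSpace 𝓘(ℝ, E) m)) (a b : ℝ) (P Q : Set M)
    (γ : ℝ → M) : Prop :=
  ∀ w : TangentSpace 𝓘(ℝ, E) (γ b), ∃ u ∈ endpointDifferentialImage D a b P γ,
    ∃ v ∈ tangentVectors 𝓘(ℝ, E) Q (γ b), w = u + v

/-- `γ` is singular in `Ω_{PQ}([a, b], M, D)`. -/
def IsSingular (D : ∀ m : M, Submodule ℝ (TangentSpace 𝓘(ℝ, E) m)) (a b : ℝ) (P Q : Set M)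
    (γ : ℝ → M) : Prop :=
  ¬ IsRegular D a b P Q γ

end HorizontalCurves

end

/-! Transversality to `Q` fails at `γ` when some nonzero covector `l` at `γ b` annihilates both the
image of the endpoint differential and the tangent space of `Q`. The theorem says that these
covectors are the final values of characteristics over `γ` that annihilate the tangent space of `P`
at time `a`.

In a chart, choose a `C^1` field `Pr x` of projections onto the distribution
(`exists_isLocalProjection`). Horizontal curves are then solutions of `x' = Pr(x) u` with a
continuous control `u`. The linearization along `γ` is `ξ' = A ξ + Pr(x) w`, where `A v = D_v Pr(x)
x'`. A solution of the adjoint equation `p' = -p A` satisfies `(p ξ)' = p Pr(x) w`. A computation in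
canonical coordinates (`canonicalSymplecticForm_apply`, `IsLocalProjection.mem_tangentVectors_iff`,
`IsLocalProjection.mem_ker_iff`) shows that a characteristic over `γ` is a covector field with `p
Pr(x) = 0` and `p' = -p A`; this is `IsAdjointAt`.

Given such a characteristic, its pairing with every tangent field is constant. It vanishes at `a`,
hence at `b`. Since a solution of a linear equation that vanishes once vanishes everywhere, the
final covector is nonzero and obstructs transversality.

Conversely, solve the adjoint equation backwards from `l`. If `l` annihilates the end values of the
linearized solutions, then `∫ p Pr(x) w = 0` for enough `w`, so `p Pr(x) = 0`, and `p` annihilates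
the initial directions. Tangent vectors are velocities of actual families of horizontal curves, so
solutions of the linearized equation have to be integrated to families. This is done by the implicit
function theorem for `x = y + ∫ Pr(x) u` in a space of continuous functions
(`exists_solution_operator`). On intervals with `(d - c) ‖A‖ < 1` a Neumann series gives all the
invertibility that is needed.

Short pieces are joined by induction (`IsEndpointCovered.extend`). Joined families must agree in
position and in velocity, so on each new piece the control is prescribed at the left endpoint.
Nothing is lost: controls that vanish there reach the same end values, by finite dimension and by
`eq_zero_of_primitive_eq_zero`. The induction carries only a large enough linear subspace of the
endpoint image, so neither the linearity of that image nor the Banach manifold structure is used. -/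

noncomputable section

namespace HorizontalCurves

set_option linter.unusedSectionVars false


/-! ### Calculus in spaces of continuous functions -/

section FunctionSpaces

open ContinuousMap

variable {K : Type*} [TopologicalSpace K] [CompactSpace K]
  {G : Type*} [NormedAddCommGroup G] [NormedSpace ℝ G]
  {G' : Type*} [NormedAddCommGroup G'] [NormedSpace ℝ G']

/-- Constant functions. -/
def constL : G →L[ℝ] C(K, G) :=
  LinearMap.mkContinuous
    { toFun := fun y => ContinuousMap.const K y
      map_add' := fun _ _ => rfl
      map_smul' := fun _ _ => rfl } 1
    (fun y => by
      rw [ContinuousMap.norm_le _ (by positivity)]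
      intro t; exact (one_mul ‖y‖).symm.le)

@[simp] lemma constL_apply (y : G) (t : K) : (constL y : C(K, G)) t = y := rfl

/-- Evaluation at a point. -/
def evalL (t : K) : C(K, G) →L[ℝ] G :=
  LinearMap.mkContinuous
    { toFun := fun f => f t
      map_add' := fun _ _ => rfl
      map_smul' := fun _ _ => rfl } 1
    (fun f => by simpa using f.norm_coe_le_norm t)

/-- Pointwise application of operator-valued functions. -/
def applyL : C(K, G →L[ℝ] G') →L[ℝ] C(K, G) →L[ℝ] C(K, G') :=
  LinearMap.mkContinuous₂
    (LinearMap.mk₂ ℝ (fun (A : C(K, G →L[ℝ] G')) (f : C(K, G)) =>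
        (⟨fun t => A t (f t), by fun_prop⟩ : C(K, G')))
      (fun _ _ _ => by ext; simp) (fun _ _ _ => by ext; simp)
      (fun _ _ _ => by ext; simp) (fun _ _ _ => by ext; simp)) 1
    (fun A f => by
      rw [ContinuousMap.norm_le _ (by positivity)]
      intro t
      rw [one_mul]
      exact ((A t).le_opNorm (f t)).trans (mul_le_mul (A.norm_coe_le_norm t)
        (f.norm_coe_le_norm t) (norm_nonneg (f t)) (norm_nonneg A)))

@[simp] lemma applyL_apply (A : C(K, G →L[ℝ] G')) (f : C(K, G)) (t : K) :
    applyL A f t = A t (f t) := rfl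

lemma norm_applyL_le (A : C(K, G →L[ℝ] G')) : ‖applyL A‖ ≤ ‖A‖ := by
  refine ContinuousLinearMap.opNorm_le_bound _ (norm_nonneg A) fun f => ?_
  rw [ContinuousMap.norm_le _ (by positivity)]
  intro t
  exact ((A t).le_opNorm (f t)).trans (mul_le_mul (A.norm_coe_le_norm t)
        (f.norm_coe_le_norm t) (norm_nonneg (f t)) (norm_nonneg A))

/-- Composition with a fixed continuous map. -/
def postcomp (f : G → G') (hf : Continuous f) (x : C(K, G)) : C(K, G') :=
  (⟨f, hf⟩ : C(G, G')).comp x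

@[simp] lemma postcomp_apply (f : G → G') (hf : Continuous f) (x : C(K, G)) (t : K) :
    postcomp f hf x t = f (x t) := rfl

lemma continuous_postcomp (f : G → G') (hf : Continuous f) :
    Continuous (postcomp f hf : C(K, G) → C(K, G')) :=
  ContinuousMap.continuous_postcomp _

lemma hasFDerivAt_postcomp {f : G → G'} (hf : ContDiff ℝ 1 f) (x : C(K, G)) :
    HasFDerivAt (postcomp f hf.continuous)
      (applyL (postcomp (fderiv ℝ f) (hf.continuous_fderiv one_ne_zero) x)) x := by
  rw [hasFDerivAt_iff_isLittleO, Asymptotics.isLittleO_iff]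
  intro ε hε
  have hc := (continuous_postcomp (K := K) (fderiv ℝ f)
    (hf.continuous_fderiv one_ne_zero)).continuousAt (x := x)
  obtain ⟨δ, hδ, hδε⟩ := Metric.continuousAt_iff.1 hc ε hε
  filter_upwards [Metric.ball_mem_nhds x hδ] with y hy
  rw [ContinuousMap.norm_le _ (by positivity)]
  intro t
  have key : ∀ z ∈ Metric.ball (x t) δ, ‖fderiv ℝ f z - fderiv ℝ f (x t)‖ ≤ ε := by
    intro z hz
    -- Every `z` near `x t` is the value at `t` of a function near `x`, namely `x` shifted by a
    -- constant. Sup-norm continuity of composition thus gives one `δ` for all `t`, even if `G` is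
    -- infinite-dimensional.
    have h1 : dist (x + constL (z - x t)) x < δ := by
      rw [dist_eq_norm, add_sub_cancel_left]
      refine lt_of_le_of_lt ?_ (mem_ball_iff_norm.1 hz)
      rw [ContinuousMap.norm_le _ (by positivity)]
      intro s; simp
    have h2 := (ContinuousMap.dist_apply_le_dist t).trans (hδε h1).le
    simpa [dist_eq_norm] using h2
  have hyt : y t ∈ Metric.ball (x t) δ :=
    lt_of_le_of_lt (ContinuousMap.dist_apply_le_dist t) hy
  have := (convex_ball (x t) δ).norm_image_sub_le_of_norm_hasFDerivWithin_le'
    (f := f) (f' := fderiv ℝ f) (φ := fderiv ℝ f (x t)) (C := ε)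
    (fun z _ => (hf.differentiable one_ne_zero z).hasFDerivAt.hasFDerivWithinAt) key
    (Metric.mem_ball_self hδ) hyt
  exact this.trans (mul_le_mul_of_nonneg_left ((y - x).norm_coe_le_norm t) hε.le)

lemma contDiff_postcomp {f : G → G'} (hf : ContDiff ℝ 1 f) :
    ContDiff ℝ 1 (postcomp f hf.continuous : C(K, G) → C(K, G')) := by
  rw [contDiff_one_iff_hasFDerivAt]
  refine ⟨_, ?_, hasFDerivAt_postcomp hf⟩
  exact applyL.continuous.comp (continuous_postcomp _ _)

end FunctionSpaces

/-! ### Primitives of continuous functions as a bounded operator. -/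

section Primitive

variable {G : Type*} [NormedAddCommGroup G] [NormedSpace ℝ G] [CompleteSpace G] {c d : ℝ}

/-- The primitive that vanishes at `r`. -/
def primitive (r : Icc c d) : C(Icc c d, G) →L[ℝ] C(Icc c d, G) :=
  LinearMap.mkContinuous
    { toFun := fun f => ⟨fun t => ∫ τ in (r : ℝ)..t, IccExtend (r.2.1.trans r.2.2) f τ, by
        have hc : Continuous (IccExtend (r.2.1.trans r.2.2) f) := f.continuous.Icc_extend'
        exact (intervalIntegral.continuous_primitive
          (fun _ _ => hc.intervalIntegrable _ _) _).comp continuous_subtype_val⟩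
      map_add' := fun f g => by
        have hf : Continuous (IccExtend (r.2.1.trans r.2.2) f) := f.continuous.Icc_extend'
        have hg : Continuous (IccExtend (r.2.1.trans r.2.2) g) := g.continuous.Icc_extend'
        ext t
        exact intervalIntegral.integral_add (hf.intervalIntegrable _ _) (hg.intervalIntegrable _ _)
      map_smul' := fun m f => by
        ext t
        exact intervalIntegral.integral_smul _ _ } (d - c)
    (fun f => by
      have hcd : c ≤ d := r.2.1.trans r.2.2
      rw [ContinuousMap.norm_le _ (mul_nonneg (by linarith) (norm_nonneg _))]
      intro t
      have h := intervalIntegral.norm_integral_le_of_norm_le_const (a := (r : ℝ)) (b := t)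
        (C := ‖f‖) (f := IccExtend hcd f) (fun x _ => f.norm_coe_le_norm _)
      refine h.trans ?_
      rw [mul_comm]
      gcongr
      rw [abs_le]
      constructor <;> linarith [r.2.1, r.2.2, t.2.1, t.2.2])

lemma norm_primitive_le (r : Icc c d) : ‖(primitive r : C(Icc c d, G) →L[ℝ] _)‖ ≤ d - c :=
  LinearMap.mkContinuous_norm_le _ (by linarith [r.2.1, r.2.2]) _

lemma primitive_apply (r : Icc c d) (f : C(Icc c d, G)) (t : Icc c d) :
    primitive r f t = ∫ τ in (r : ℝ)..t, IccExtend (r.2.1.trans r.2.2) f τ := rfl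

@[simp] lemma primitive_self (r : Icc c d) (f : C(Icc c d, G)) : primitive r f r = 0 := by
  rw [primitive_apply, intervalIntegral.integral_same]

lemma hasDerivWithinAt_primitive (r : Icc c d) (y : G) (f : C(Icc c d, G)) {g : ℝ → G}
    (hg : ∀ τ : Icc c d, g τ = y + primitive r f τ) (t : Icc c d) :
    HasDerivWithinAt g (f t) (Icc c d) t := by
  have hc : Continuous (IccExtend (r.2.1.trans r.2.2) f) := f.continuous.Icc_extend'
  have h := (hc.integral_hasStrictDerivAt r t).hasDerivAt.hasDerivWithinAt (s := Icc c d)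
  rw [IccExtend_val] at h
  exact (h.const_add y).congr (fun τ hτ => hg ⟨τ, hτ⟩) (hg t)

/-- The difference of `g` and the primitive has derivative zero within the interval, hence is
constant by the mean value inequality. Derivatives within the interval suffice, also at the
endpoints. -/
lemma eq_add_primitive (r : Icc c d) (f : C(Icc c d, G)) {g : ℝ → G}
    (hg : ∀ t : Icc c d, HasDerivWithinAt g (f t) (Icc c d) t) (t : Icc c d) :
    g t = g r + primitive r f t := by
  have hF : ∀ t : Icc c d, HasDerivWithinAt
      (fun s => g s - ∫ τ in (r : ℝ)..s, IccExtend (r.2.1.trans r.2.2) f τ) 0 (Icc c d) t := by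
    intro t
    have := (hg t).sub (hasDerivWithinAt_primitive r 0 f
      (g := fun s => ∫ τ in (r : ℝ)..s, IccExtend (r.2.1.trans r.2.2) f τ)
      (fun τ => (zero_add _).symm) t)
    rwa [sub_self] at this
  have := (convex_Icc c d).norm_image_sub_le_of_norm_hasDerivWithin_le (C := 0)
    (fun s hs => hF ⟨s, hs⟩) (fun s _ => by simp) r.2 t.2
  rw [zero_mul, norm_le_zero_iff, sub_eq_zero] at this
  simp only [intervalIntegral.integral_same, sub_zero] at this
  rw [primitive_apply, ← this, sub_add_cancel]

end Primitive

/-! ### Integral equations on short intervals -/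

section IntegralEquations

lemma isInvertible_id_sub {X : Type*} [NormedAddCommGroup X] [NormedSpace ℝ X] [CompleteSpace X]
    (V : X →L[ℝ] X) (hV : ‖V‖ < 1) : (ContinuousLinearMap.id ℝ X - V).IsInvertible :=
  ⟨ContinuousLinearEquiv.unitsEquiv ℝ X (Units.oneSub V hV), rfl⟩

variable {G : Type*} [NormedAddCommGroup G] [NormedSpace ℝ G] [CompleteSpace G] {c d : ℝ}

lemma norm_primitive_comp_applyL_lt_one (r : Icc c d) (B : C(Icc c d, G →L[ℝ] G))
    (hB : (d - c) * ‖B‖ < 1) : ‖(primitive r).comp (applyL B)‖ < 1 := by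
  refine lt_of_le_of_lt (ContinuousLinearMap.opNorm_comp_le _ _) (lt_of_le_of_lt ?_ hB)
  have hcd : c ≤ d := r.2.1.trans r.2.2
  exact mul_le_mul (norm_primitive_le r) (norm_applyL_le B) (norm_nonneg (applyL B)) (by linarith)

/-- The equation reads `(id - V) p = constL y`, where `V` has norm at most `(d - c) * C < 1`, so the
Neumann series inverts `id - V`. -/
lemma exists_linear_integral_equation (r : Icc c d) (B : C(Icc c d, G →L[ℝ] G)) {C : ℝ}
    (hC : 0 ≤ C) (hBC : ∀ t, ‖B t‖ ≤ C) (hsmall : (d - c) * C < 1) (y : G) :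
    ∃ p : C(Icc c d, G), p = constL y + primitive r (applyL B p) := by
  have hcd : c ≤ d := r.2.1.trans r.2.2
  have hB : (d - c) * ‖B‖ < 1 := lt_of_le_of_lt
    (mul_le_mul_of_nonneg_left ((ContinuousMap.norm_le _ hC).2 hBC) (by linarith)) hsmall
  obtain ⟨e, he⟩ := isInvertible_id_sub _ (norm_primitive_comp_applyL_lt_one r B hB)
  refine ⟨e.symm (constL y), ?_⟩
  have h : e (e.symm (constL y)) = constL y := e.apply_symm_apply _
  rw [← ContinuousLinearEquiv.coe_coe, he] at h
  simp only [sub_apply, ContinuousLinearMap.id_apply,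
    ContinuousLinearMap.comp_apply] at h
  exact sub_eq_iff_eq_add.1 h

variable {E : Type*} [NormedAddCommGroup E] [NormedSpace ℝ E] [CompleteSpace E]

/-- The linearization `v ↦ D_v Pr (x t) (u t)` of `x ↦ Pr x (u t)` along a curve. -/
def linearization (Pr : E → E →L[ℝ] E) (hPr : ContDiff ℝ 1 Pr) (x u : C(Icc c d, E)) :
    C(Icc c d, E →L[ℝ] E) :=
  ⟨fun t => (fderiv ℝ Pr (x t)).flip (u t), by
    have h : Continuous fun t => fderiv ℝ Pr (x t) :=
      (hPr.continuous_fderiv one_ne_zero).comp x.continuous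
    have h' : Continuous fun t => (fderiv ℝ Pr (x t)).flip :=
      (ContinuousLinearMap.flipₗᵢ ℝ E E E).continuous.comp h
    exact h'.clm_apply u.continuous⟩

/-- Implicit function theorem for `x - y - ∫ Pr(x) u = 0`, with the initial point `y` and the
control `u` as parameters. The partial derivative in `x` is `id - ∫ A` with `A` the linearization,
which is invertible on a short interval. -/
lemma exists_solution_operator (Pr : E → E →L[ℝ] E) (hPr : ContDiff ℝ 1 Pr) (r : Icc c d)
    (x u : C(Icc c d, E))
    (hx : x = constL (x r) + primitive r (applyL (postcomp Pr hPr.continuous x) u))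
    (hsmall : (d - c) * ‖linearization Pr hPr x u‖ < 1) :
    ∃ S : E × C(Icc c d, E) → C(Icc c d, E), ContDiffAt ℝ 1 S (x r, u) ∧ S (x r, u) = x ∧
      ∀ᶠ q in 𝓝 (x r, u), S q = constL q.1 +
        primitive r (applyL (postcomp Pr hPr.continuous (S q)) q.2) := by
  set f : (E × C(Icc c d, E)) × C(Icc c d, E) → C(Icc c d, E) := fun q =>
    q.2 - constL q.1.1 - primitive r (applyL (postcomp Pr hPr.continuous q.2) q.1.2) with hf
  have cf : ContDiff ℝ 1 f := by
    have h1 : ContDiff ℝ 1 fun q : (E × C(Icc c d, E)) × C(Icc c d, E) =>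
        applyL (postcomp Pr hPr.continuous q.2) q.1.2 := by
      have h0 : ContDiff ℝ 1 fun q : (E × C(Icc c d, E)) × C(Icc c d, E) =>
          applyL (postcomp Pr hPr.continuous q.2) :=
        ContDiff.comp (g := fun A : C(Icc c d, E →L[ℝ] E) => applyL A)
          (ContinuousLinearMap.contDiff _) ((contDiff_postcomp hPr).comp contDiff_snd)
      exact h0.clm_apply (contDiff_snd.comp contDiff_fst)
    have h2 : ContDiff ℝ 1 fun q : (E × C(Icc c d, E)) × C(Icc c d, E) =>
        (constL q.1.1 : C(Icc c d, E)) :=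
      (constL (K := Icc c d) (G := E)).contDiff.comp (contDiff_fst.comp contDiff_fst)
    exact (contDiff_snd.sub h2).sub
      ((primitive (G := E) r).contDiff.comp h1)
  have hpart : (fderiv ℝ f ((x r, u), x)).comp (.inr ℝ (E × C(Icc c d, E)) C(Icc c d, E)) =
      .id ℝ _ - (primitive r).comp (applyL (linearization Pr hPr x u)) := by
    have h1 : HasFDerivAt (fun z => f ((x r, u), z))
        ((fderiv ℝ f ((x r, u), x)).comp (.inr ℝ (E × C(Icc c d, E)) C(Icc c d, E))) x :=
      HasFDerivAt.comp x (cf.differentiable one_ne_zero _).hasFDerivAt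
        (hasFDerivAt_prodMk_right (x r, u) x)
    have h2 : HasFDerivAt (fun z => f ((x r, u), z))
        (.id ℝ _ - (primitive r).comp ((applyL.flip u).comp
          (applyL (postcomp (fderiv ℝ Pr) (hPr.continuous_fderiv one_ne_zero) x)))) x := by
      have h3 := ((applyL (K := Icc c d) (G := E) (G' := E)).flip u).hasFDerivAt.comp x
        (hasFDerivAt_postcomp hPr x)
      exact ((hasFDerivAt_id x).sub_const (constL (x r))).fun_sub
        ((primitive (G := E) r).hasFDerivAt.comp x h3)
    rw [h1.unique h2]
    rfl
  have hinv : ((fderiv ℝ f ((x r, u), x)).comp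
      (.inr ℝ (E × C(Icc c d, E)) C(Icc c d, E))).IsInvertible := by
    rw [hpart]
    exact isInvertible_id_sub _ (norm_primitive_comp_applyL_lt_one r _ hsmall)
  have h0 : f ((x r, u), x) = 0 := by
    simp only [hf]
    rw [sub_sub, sub_eq_zero]
    exact hx
  have cfa := cf.contDiffAt (x := ((x r, u), x))
  refine ⟨cfa.implicitFunction one_ne_zero hinv, cfa.contDiffAt_implicitFunction one_ne_zero hinv,
    cfa.implicitFunction_apply_self one_ne_zero hinv, ?_⟩
  filter_upwards [cfa.eventually_apply_implicitFunction one_ne_zero hinv] with q hq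
  rw [h0] at hq
  simp only [hf] at hq
  rwa [sub_sub, sub_eq_zero] at hq

/-- Differentiating the integral equation satisfied by `S` shows that the derivative of `S` solves
the linearized equation with initial value `z` and control `w`. -/
lemma fderiv_solution_operator (Pr : E → E →L[ℝ] E) (hPr : ContDiff ℝ 1 Pr) (r : Icc c d)
    (x u : C(Icc c d, E)) (S : E × C(Icc c d, E) → C(Icc c d, E))
    (hS : ContDiffAt ℝ 1 S (x r, u)) (hSx : S (x r, u) = x)
    (hSeq : ∀ᶠ q in 𝓝 (x r, u), S q = constL q.1 +
        primitive r (applyL (postcomp Pr hPr.continuous (S q)) q.2)) (z : E) (w : C(Icc c d, E)) :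
    fderiv ℝ S (x r, u) (z, w) = constL z + primitive r
      (applyL (linearization Pr hPr x u) (fderiv ℝ S (x r, u) (z, w)) +
        applyL (postcomp Pr hPr.continuous x) w) := by
  have h1 := (hS.differentiableAt one_ne_zero).hasFDerivAt
  have h2 : HasFDerivAt (fun q : E × C(Icc c d, E) => postcomp Pr hPr.continuous (S q)) _
      (x r, u) := HasFDerivAt.comp (x r, u) (by rw [hSx]; exact hasFDerivAt_postcomp hPr x) h1
  have h3 : HasFDerivAt (fun q : E × C(Icc c d, E) =>
      applyL (postcomp Pr hPr.continuous (S q))) _ (x r, u) :=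
    HasFDerivAt.comp (g := applyL (K := Icc c d) (G := E) (G' := E)) (x r, u)
      (ContinuousLinearMap.hasFDerivAt _) h2
  have h4 := HasFDerivAt.comp (g := primitive (G := E) r) (x r, u)
    (ContinuousLinearMap.hasFDerivAt _) (h3.clm_apply hasFDerivAt_snd)
  have h5 := ((constL (K := Icc c d) (G := E)).hasFDerivAt.comp (x r, u) hasFDerivAt_fst).add h4
  have h6 := h5.congr_of_eventuallyEq hSeq
  have h7 := h1.unique h6
  conv_lhs => rw [h7]
  simp only [add_apply, ContinuousLinearMap.comp_apply, hSx,
    ContinuousLinearMap.coe_fst', ContinuousLinearMap.coe_snd', ContinuousLinearMap.flip_apply]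
  rw [add_comm (applyL (linearization _ _ _ _) _)]
  rfl

/-- The adjoint of the linearized equation. -/
lemma exists_adjoint_solution (A : C(Icc c d, E →L[ℝ] E)) (hA : (d - c) * ‖A‖ < 1) (r : Icc c d)
    (l : E →L[ℝ] ℝ) :
    ∃ p p' : C(Icc c d, E →L[ℝ] ℝ), p = constL l + primitive r p' ∧
      ∀ t, p' t = -(p t).comp (A t) := by
  set B : C(Icc c d, (E →L[ℝ] ℝ) →L[ℝ] (E →L[ℝ] ℝ)) :=
    ⟨fun t => -((ContinuousLinearMap.compL ℝ E E ℝ).flip (A t)), by fun_prop⟩ with hBdef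
  have hB : ∀ t, ‖B t‖ ≤ ‖A‖ := by
    intro t
    refine ContinuousLinearMap.opNorm_le_bound _ (norm_nonneg A) fun q => ?_
    have h1 : ‖q.comp (A t)‖ ≤ ‖q‖ * ‖A t‖ := ContinuousLinearMap.opNorm_comp_le _ _
    have h2 : ‖q‖ * ‖A t‖ ≤ ‖q‖ * ‖A‖ :=
      mul_le_mul_of_nonneg_left (A.norm_coe_le_norm t) (norm_nonneg q)
    have h3 : ‖B t q‖ = ‖q.comp (A t)‖ := norm_neg _
    rw [h3]
    linarith
  obtain ⟨p, hp⟩ := exists_linear_integral_equation r B (norm_nonneg A) hB hA l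
  exact ⟨p, applyL B p, hp, fun t => rfl⟩

/-- Pointwise composition of a covector field and an operator field. -/
def compPointwise (p : C(Icc c d, E →L[ℝ] ℝ)) (A : C(Icc c d, E →L[ℝ] E)) :
    C(Icc c d, E →L[ℝ] ℝ) :=
  ⟨fun t => (p t).comp (A t), by fun_prop⟩

@[simp] lemma compPointwise_apply (p : C(Icc c d, E →L[ℝ] ℝ)) (A : C(Icc c d, E →L[ℝ] E))
    (t : Icc c d) : compPointwise p A t = (p t).comp (A t) := rfl

/-- By the product rule `(p x)' = -p A x + p (A x + B w) = p B w`. The covector is normalized at `s`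
and the vector at `r`, so that `p` can be prescribed at the end and `x` at the beginning. -/
lemma adjoint_pairing (A B : C(Icc c d, E →L[ℝ] E)) (r s : Icc c d) (l : E →L[ℝ] ℝ)
    (p p' : C(Icc c d, E →L[ℝ] ℝ)) (hp : p = constL l + primitive s p')
    (hp' : ∀ t, p' t = -(p t).comp (A t)) (z : E) (x w : C(Icc c d, E))
    (hx : x = constL z + primitive r (applyL A x + applyL B w)) (t : Icc c d) :
    p t (x t) = p r (x r) + primitive r (applyL (compPointwise p B) w) t := by
  have hcd : c ≤ d := r.2.1.trans r.2.2
  have hpd : ∀ t : Icc c d, HasDerivWithinAt (IccExtend hcd p) (p' t) (Icc c d) t := fun t =>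
    hasDerivWithinAt_primitive s l p' (fun τ => by
      rw [IccExtend_val, ← constL_apply l τ, ← ContinuousMap.add_apply, ← hp]) t
  have hxd : ∀ t : Icc c d, HasDerivWithinAt (IccExtend hcd x)
      ((applyL A x + applyL B w) t) (Icc c d) t := fun t =>
    hasDerivWithinAt_primitive r z _ (fun τ => by
      rw [IccExtend_val, ← constL_apply z τ, ← ContinuousMap.add_apply, ← hx]) t
  have := eq_add_primitive r (applyL (compPointwise p B) w)
    (g := fun t => (IccExtend hcd p t) (IccExtend hcd x t)) (fun t => by
      have h := (hpd t).clm_apply (hxd t)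
      convert h using 1
      simp [IccExtend_val, hp']) t
  simpa [IccExtend_val] using this

/-- The fundamental lemma of the calculus of variations, for test functions that vanish at the left
endpoint only. -/
lemma eq_zero_of_primitive_eq_zero (hcd : c < d) (q : C(Icc c d, E →L[ℝ] ℝ))
    (hq : ∀ w : C(Icc c d, E), w ⟨c, left_mem_Icc.2 hcd.le⟩ = 0 →
      primitive ⟨c, left_mem_Icc.2 hcd.le⟩ (applyL q w) ⟨d, right_mem_Icc.2 hcd.le⟩ = 0) :
    q = 0 := by
  ext t e
  have hcont : Continuous (IccExtend hcd.le fun t => q t e) := by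
    apply Continuous.Icc_extend'
    fun_prop
  have hIoo : EqOn (IccExtend hcd.le fun t => q t e) (fun _ => 0) (Ioo c d) := by
    intro t ht
    by_contra hne
    -- The factor `t - c` makes the test function vanish at `c`. The integrand becomes `(t - c) * (q
    -- t e) ^ 2`, which is nonnegative and positive where `q t e ≠ 0` in the interior.
    have h := hq ⟨fun t => ((t - c : ℝ) * q t e) • e, by fun_prop⟩ (by simp)
    rw [primitive_apply] at h
    refine absurd h (ne_of_gt ?_)
    have hc2 : Continuous (fun τ : ℝ => (projIcc c d hcd.le τ - c : ℝ) *
      (IccExtend hcd.le (fun t => q t e) τ) ^ 2) := by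
      refine Continuous.mul ?_ (hcont.pow 2)
      exact (continuous_subtype_val.comp continuous_projIcc).sub continuous_const
    have heq : (IccExtend hcd.le (applyL q ⟨fun t => ((t - c : ℝ) * q t e) • e, by fun_prop⟩)) =
        (fun τ : ℝ => (projIcc c d hcd.le τ - c : ℝ) *
          (IccExtend hcd.le (fun t => q t e) τ) ^ 2) := by
      ext τ
      simp only [IccExtend, Function.comp_apply, applyL_apply, ContinuousMap.coe_mk, map_smul,
        smul_eq_mul]
      ring
    rw [heq]
    refine intervalIntegral.integral_pos hcd hc2.continuousOn (fun τ hτ => ?_) ⟨t, ⟨ht.1.le, ht.2.le⟩, ?_⟩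
    · have := (projIcc c d hcd.le τ).2.1
      exact mul_nonneg (by linarith) (sq_nonneg _)
    · have h1 : (projIcc c d hcd.le t : ℝ) = t := by
        rw [projIcc_of_mem hcd.le ⟨ht.1.le, ht.2.le⟩]
      rw [h1]
      exact mul_pos (by linarith [ht.1]) (by positivity)
  have hcl := hIoo.closure hcont continuous_const
  rw [closure_Ioo hcd.ne] at hcl
  simpa [IccExtend_val] using hcl t.2

end IntegralEquations

/-! ### Variations of a horizontal curve on a short interval -/

section ShortIntervals

variable {E : Type*} [NormedAddCommGroup E] [NormedSpace ℝ E] [FiniteDimensional ℝ E] {c d : ℝ}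

lemma exists_dual_ne_zero_of_notMem (W : Submodule ℝ E) {z : E} (hz : z ∉ W) :
    ∃ l : E →L[ℝ] ℝ, l z ≠ 0 ∧ ∀ w ∈ W, l w = 0 := by
  obtain ⟨f, hf, hW⟩ := W.exists_le_ker_of_notMem hz
  exact ⟨LinearMap.toContinuousLinearMap f, hf, fun w hw => hW hw⟩

/-- The induction step in coordinates: `W` consists of directions available at time `c`, and `W'` of
directions reached from them at time `d`. Covectors annihilating `W'` propagate backwards to
covectors annihilating `W`, and vectors of `W'` are realized by families whose initial positions `y`
and initial velocities `v` are given by the preceding piece. Only `z₀` may be chosen; the derivative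
of `v` at `0` is not controlled. The velocities are returned as `Pr (X s t) (U t)` because `Pr` is
not assumed idempotent here. -/
theorem exists_variations_of_short (hcd : c < d) (Pr : E → E →L[ℝ] E) (hPr : ContDiff ℝ 1 Pr)
    (x u : C(Icc c d, E)) (c₀ d₀ : Icc c d) (hc₀ : (c₀ : ℝ) = c) (hd₀ : (d₀ : ℝ) = d)
    (hx : x = constL (x c₀) + primitive c₀ u) (hxu : ∀ t, Pr (x t) (u t) = u t)
    (hsmall : (d - c) * ‖linearization Pr hPr x u‖ < 1) (W : Submodule ℝ E) :
    ∃ W' : Submodule ℝ E,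
      (∀ l : E →L[ℝ] ℝ, (∀ z ∈ W', l z = 0) → ∃ p p' : C(Icc c d, E →L[ℝ] ℝ),
        p = constL l + primitive d₀ p' ∧
        (∀ t, p' t = -(p t).comp (linearization Pr hPr x u t)) ∧
        (∀ t, (p t).comp (Pr (x t)) = 0) ∧ ∀ z ∈ W, p c₀ z = 0) ∧
      ∀ z ∈ W', ∃ z₀ ∈ W, ∀ y v : ℝ → E, ContDiffAt ℝ 1 y 0 → ContDiffAt ℝ 1 v 0 →
        y 0 = x c₀ → v 0 = u c₀ → deriv y 0 = z₀ → (∀ᶠ s in 𝓝 (0 : ℝ), Pr (y s) (v s) = v s) →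
        ∃ X X' : ℝ → C(Icc c d, E), ContDiffAt ℝ 1 X 0 ∧ ContDiffAt ℝ 1 X' 0 ∧ X 0 = x ∧
          deriv X 0 d₀ = z ∧ ∀ᶠ s in 𝓝 (0 : ℝ), X s = constL (y s) + primitive c₀ (X' s) ∧
            X' s c₀ = v s ∧ ∃ U : C(Icc c d, E), ∀ t, X' s t = Pr (X s t) (U t) := by
  have hPu : applyL (postcomp Pr hPr.continuous x) u = u := by
    ext t; exact hxu t
  obtain ⟨S, hS, hSx, hSeq⟩ := exists_solution_operator Pr hPr c₀ x u (by rwa [hPu]) hsmall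
  have hL := fderiv_solution_operator Pr hPr c₀ x u S hS hSx hSeq
  set L := fderiv ℝ S (x c₀, u)
  set A := linearization Pr hPr x u
  set B := postcomp Pr hPr.continuous x
  have hc₀' : c₀ = ⟨c, left_mem_Icc.2 hcd.le⟩ := Subtype.ext hc₀
  have hd₀' : d₀ = ⟨d, right_mem_Icc.2 hcd.le⟩ := Subtype.ext hd₀
  let N : Submodule ℝ C(Icc c d, E) := LinearMap.ker (evalL (G := E) c₀).toLinearMap
  have hN : ∀ w, w ∈ N ↔ w c₀ = 0 := fun w => Iff.rfl
  let T : E × C(Icc c d, E) →ₗ[ℝ] E := ((evalL d₀).comp L).toLinearMap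
  have hT : ∀ q, T q = L q d₀ := fun q => rfl
  have hLc : ∀ z w, L (z, w) c₀ = z := by
    intro z w
    rw [hL, ContinuousMap.add_apply, primitive_self, add_zero, constL_apply]
  have hpair : ∀ (l : E →L[ℝ] ℝ) (p p' : C(Icc c d, E →L[ℝ] ℝ)),
      p = constL l + primitive d₀ p' → (∀ t, p' t = -(p t).comp (A t)) → ∀ z w,
      l (T (z, w)) = p c₀ z + primitive c₀ (applyL (compPointwise p B) w) d₀ := by
    intro l p p' hp hp' z w
    have h := adjoint_pairing A B c₀ d₀ l p p' hp hp' z (L (z, w)) w (hL z w) d₀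
    rw [hLc] at h
    have hpd : p d₀ = l := by
      conv_lhs => rw [hp]
      rw [ContinuousMap.add_apply, primitive_self, add_zero, constL_apply]
    rw [← h, hpd, hT]
  have hzero : ∀ (l : E →L[ℝ] ℝ) (p p' : C(Icc c d, E →L[ℝ] ℝ)),
      p = constL l + primitive d₀ p' → (∀ t, p' t = -(p t).comp (A t)) →
      (∀ w ∈ N, l (T (0, w)) = 0) → compPointwise p B = 0 := by
    intro l p p' hp hp' h
    refine eq_zero_of_primitive_eq_zero hcd _ fun w hw => ?_
    rw [← hc₀'] at hw
    rw [← hc₀', ← hd₀']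
    have := hpair l p p' hp hp' 0 w
    rwa [h w hw, map_zero, zero_add, eq_comm] at this
  -- Otherwise some `l` annihilates the end values of all controls in `N` but not that of `w`. Its
  -- adjoint solution then satisfies `p B = 0` by `hzero`, so the pairing formula gives `l (T (0,
  -- w)) = 0` after all.
  have hreach : ∀ w, ∃ w' ∈ N, T (0, w') = T (0, w) := by
    intro w
    by_contra hcon
    have hz : T (0, w) ∉ (N.map (LinearMap.inr ℝ E C(Icc c d, E))).map T := by
      rintro ⟨_, ⟨w', hw', rfl⟩, h⟩
      exact hcon ⟨w', hw', h⟩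
    obtain ⟨l, hl, hlN⟩ := exists_dual_ne_zero_of_notMem _ hz
    obtain ⟨p, p', hp, hp'⟩ := exists_adjoint_solution A hsmall d₀ l
    have h0 := hzero l p p' hp hp' fun w' hw' =>
      hlN _ (Submodule.mem_map_of_mem (Submodule.mem_map_of_mem hw'))
    apply hl
    rw [hpair l p p' hp hp', h0, map_zero, map_zero]
    simp
  refine ⟨(W.prod N).map T, ?_, ?_⟩
  · intro l hl
    obtain ⟨p, p', hp, hp'⟩ := exists_adjoint_solution A hsmall d₀ l
    have hl' : ∀ z ∈ W, ∀ w ∈ N, l (T (z, w)) = 0 := fun z hz w hw =>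
      hl _ (Submodule.mem_map_of_mem ⟨hz, hw⟩)
    have h0 := hzero l p p' hp hp' (hl' 0 W.zero_mem)
    refine ⟨p, p', hp, hp', fun t => DFunLike.congr_fun h0 t, fun z hz => ?_⟩
    have h1 := hpair l p p' hp hp' z 0
    rwa [hl' z hz 0 N.zero_mem, map_zero, map_zero, ContinuousMap.zero_apply, add_zero,
      eq_comm] at h1
  · rintro _ ⟨⟨z₀, w₀⟩, ⟨hz₀, -⟩, rfl⟩
    refine ⟨z₀, hz₀, fun y v hy hv hy0 hv0 hdy hPv => ?_⟩
    -- The control at parameter `s` will be `u + constL (v s - v 0) + s • w`. It equals `v s` at `c`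
    -- since `w` vanishes there, and `w` compensates for the uncontrolled derivative of `v`, so the
    -- end velocity is still `T (z₀, w₀)`.
    obtain ⟨w, hw, hTw⟩ := hreach (w₀ - constL (deriv v 0))
    let q : ℝ → E × C(Icc c d, E) := fun s => (y s, u + constL (v s - v 0) + s • w)
    have hq0 : q 0 = (x c₀, u) := by simp [q, hy0]
    have hdq : HasDerivAt q (z₀, constL (deriv v 0) + w) 0 := by
      have h1 : HasDerivAt y z₀ 0 := hdy ▸ (hy.differentiableAt one_ne_zero).hasDerivAt
      have h2 : HasDerivAt (fun s => (constL (v s - v 0) : C(Icc c d, E)))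
          (constL (deriv v 0)) 0 :=
        (constL (K := Icc c d) (G := E)).hasFDerivAt.comp_hasDerivAt 0
          ((hv.differentiableAt one_ne_zero).hasDerivAt.sub_const _)
      have h3 : HasDerivAt (fun s : ℝ => s • w) w 0 := by
        simpa using (hasDerivAt_id (0 : ℝ)).smul_const w
      exact h1.prodMk ((h2.const_add u).add h3)
    have hqC : ContDiffAt ℝ 1 q 0 := by
      have h2 : ContDiffAt ℝ 1 (fun s => (constL (v s - v 0) : C(Icc c d, E))) 0 :=
        (constL (K := Icc c d) (G := E)).contDiff.contDiffAt.comp (0 : ℝ)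
          (hv.sub contDiffAt_const)
      exact hy.prodMk ((contDiffAt_const.add h2).add (contDiffAt_id.smul contDiffAt_const))
    have hX : ContDiffAt ℝ 1 (S ∘ q) 0 := ContDiffAt.comp 0 (hq0.symm ▸ hS) hqC
    have hev : ∀ᶠ s in 𝓝 (0 : ℝ), S (q s) = constL (y s) +
        primitive c₀ (applyL (postcomp Pr hPr.continuous (S (q s))) (q s).2) := by
      have := hqC.continuousAt.tendsto
      rw [hq0] at this
      exact this.eventually hSeq
    refine ⟨S ∘ q, fun s => applyL (postcomp Pr hPr.continuous (S (q s))) (q s).2, hX, ?_, ?_, ?_,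
      ?_⟩
    · have h1 : ContDiffAt ℝ 1 (fun s => postcomp Pr hPr.continuous (S (q s))) 0 :=
        (contDiff_postcomp hPr).contDiffAt.comp (0 : ℝ) hX
      have h2 : ContDiffAt ℝ 1 (fun s => applyL (postcomp Pr hPr.continuous (S (q s)))) 0 :=
        ContDiffAt.comp (g := fun A : C(Icc c d, E →L[ℝ] E) => applyL A) (0 : ℝ)
          (ContinuousLinearMap.contDiff _).contDiffAt h1
      exact h2.clm_apply hqC.snd
    · rw [Function.comp_apply, hq0, hSx]
    · have h1 : HasFDerivAt S L (q 0) := hq0.symm ▸ (hS.differentiableAt one_ne_zero).hasFDerivAt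
      rw [(h1.comp_hasDerivAt 0 hdq).deriv, ← hT]
      have h2 : ((z₀, constL (deriv v 0) + w) : E × C(Icc c d, E)) =
          (z₀, constL (deriv v 0)) + (0, w) := by simp
      have h3 : ((z₀, w₀) : E × C(Icc c d, E)) =
          (z₀, constL (deriv v 0)) + (0, w₀ - constL (deriv v 0)) := by simp
      rw [h2, h3, map_add, map_add, hTw]
    · filter_upwards [hev, hPv] with s hs hPs
      refine ⟨hs, ?_, (q s).2, fun t => rfl⟩
      have h1 : S (q s) c₀ = y s := by
        rw [hs, ContinuousMap.add_apply, primitive_self, add_zero, constL_apply]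
      have h2 : (q s).2 c₀ = v s := by
        have : w c₀ = 0 := hw
        simp [q, this, hv0]
      rw [applyL_apply, postcomp_apply, h1, h2, hPs]

end ShortIntervals

/-! ### Cutting off, restricting and gluing -/

section Gluing

variable {E : Type*} [NormedAddCommGroup E] [NormedSpace ℝ E]
  {G : Type*} [NormedAddCommGroup G] [NormedSpace ℝ G]

/-- Multiply by a bump function. Globally defined maps are needed because `postcomp` acts on all
continuous functions, while charts and local frames give maps only near a point. -/
lemma exists_contDiff_eventuallyEq [FiniteDimensional ℝ E] {f : E → G} {x₀ : E} {n : ℕ}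
    (hf : ContDiffAt ℝ n f x₀) : ∃ g : E → G, ContDiff ℝ n g ∧ g =ᶠ[𝓝 x₀] f := by
  obtain ⟨r, hr, hrV⟩ := Metric.eventually_nhds_iff_ball.1 (hf.eventually (by simp))
  let b : ContDiffBump x₀ := ⟨r / 4, r / 2, by positivity, by linarith⟩
  refine ⟨fun x => b x • f x, contDiff_iff_contDiffAt.2 fun x => ?_, ?_⟩
  · by_cases hx : x ∈ Metric.ball x₀ r
    · exact b.contDiff.contDiffAt.smul (hrV x hx)
    · have hx' : x ∉ tsupport b := by
        rw [b.tsupport_eq]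
        exact fun h => hx (Metric.closedBall_subset_ball (by simp [b, hr]) h)
      refine (contDiffAt_const (c := (0 : G))).congr_of_eventuallyEq ?_
      filter_upwards [notMem_tsupport_iff_eventuallyEq.1 hx'] with y hy
      rw [hy, Pi.zero_apply, zero_smul]
  · filter_upwards [b.eventuallyEq_one] with y hy
    rw [hy, Pi.one_apply, one_smul]

/-- Precomposition with a continuous map. -/
def precompL {K K' : Type*} [TopologicalSpace K] [CompactSpace K] [TopologicalSpace K']
    [CompactSpace K'] (k : C(K', K)) : C(K, G) →L[ℝ] C(K', G) :=
  LinearMap.mkContinuous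
    { toFun := fun f => f.comp k
      map_add' := fun _ _ => rfl
      map_smul' := fun _ _ => rfl } 1
    (fun f => by
      rw [ContinuousMap.norm_le _ (by positivity), one_mul]
      exact fun t => f.norm_coe_le_norm (k t))

/-- Projection to a subinterval. -/
def projTo {a b c d : ℝ} (h : a ≤ b) : C(Icc c d, Icc a b) :=
  ⟨fun t => projIcc a b h t, continuous_projIcc.comp continuous_subtype_val⟩

/-- Gluing functions on adjacent intervals that agree at the common endpoint. -/
def glueL {a c d : ℝ} (hac : a ≤ c) (hcd : c ≤ d) :
    (C(Icc a c, G) × C(Icc c d, G)) →L[ℝ] C(Icc a d, G) :=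
  (precompL (projTo hac)).comp (.fst ℝ _ _) + (precompL (projTo hcd)).comp (.snd ℝ _ _)
    - (constL.comp (evalL ⟨c, right_mem_Icc.2 hac⟩)).comp (.fst ℝ _ _)

/-- `glueL` is `f + g - f c` with `f` and `g` extended by constants, which is linear on all pairs,
compatible or not. On the left `g` contributes `g c`, which cancels only under `h`; on the right `f`
contributes `f c`, which always cancels. -/
lemma glueL_left {a c d : ℝ} (hac : a ≤ c) (hcd : c ≤ d) (f : C(Icc a c, G)) (g : C(Icc c d, G))
    (h : f ⟨c, right_mem_Icc.2 hac⟩ = g ⟨c, left_mem_Icc.2 hcd⟩) (t : Icc a d) (ht : (t : ℝ) ≤ c) :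
    glueL hac hcd (f, g) t = f ⟨t, t.2.1, ht⟩ := by
  have h1 : projIcc a c hac t = ⟨t, t.2.1, ht⟩ := projIcc_of_mem hac ⟨t.2.1, ht⟩
  have h2 : projIcc c d hcd t = ⟨c, left_mem_Icc.2 hcd⟩ := projIcc_of_le_left hcd ht
  change f (projIcc a c hac t) + g (projIcc c d hcd t) - f _ = _
  rw [h1, h2, h, add_sub_cancel_right]

lemma glueL_right {a c d : ℝ} (hac : a ≤ c) (hcd : c ≤ d) (f : C(Icc a c, G))
    (g : C(Icc c d, G)) (t : Icc a d) (ht : c ≤ (t : ℝ)) :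
    glueL hac hcd (f, g) t = g ⟨t, ht, t.2.2⟩ := by
  have h1 : projIcc a c hac t = ⟨c, right_mem_Icc.2 hac⟩ := projIcc_of_right_le hac ht
  have h2 : projIcc c d hcd t = ⟨t, ht, t.2.2⟩ := projIcc_of_mem hcd ⟨ht, t.2.2⟩
  change f (projIcc a c hac t) + g (projIcc c d hcd t) - f _ = _
  rw [h1, h2, add_sub_cancel_left]

lemma contDiffOn_one_Icc_of_hasDerivWithinAt {c d : ℝ} (h : c < d) {f f' : ℝ → G}
    (hf : ∀ t ∈ Icc c d, HasDerivWithinAt f (f' t) (Icc c d) t) (hf' : ContinuousOn f' (Icc c d)) :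
    ContDiffOn ℝ 1 f (Icc c d) := by
  rw [show (1 : WithTop ℕ∞) = 0 + 1 from (zero_add 1).symm,
    contDiffOn_succ_iff_derivWithin (uniqueDiffOn_Icc h)]
  refine ⟨fun t ht => (hf t ht).differentiableWithinAt, by simp, ?_⟩
  rw [contDiffOn_zero]
  exact hf'.congr fun t ht => (hf t ht).derivWithin (uniqueDiffOn_Icc h t ht)

/-- The linear map `r ↦ r • v`. -/
def lineL (v : G) : ℝ →L[ℝ] G := .toSpanSingleton ℝ v

@[simp] lemma lineL_apply (v : G) (r : ℝ) : lineL v r = r • v := rfl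

lemma lineL_apply_one (L : ℝ →L[ℝ] G) : lineL (L 1) = L := by
  ext; simp

end Gluing

/-! ### Velocities of curves in manifolds. -/

section Velocity

variable {F H : Type*} [NormedAddCommGroup F] [NormedSpace ℝ F] [TopologicalSpace H]
  (J : ModelWithCorners ℝ F H) {N : Type*} [TopologicalSpace N] [ChartedSpace H N]

/-- The curve `c` has velocity `v` at time `t` within `s`. -/
def HasVelocityWithinAt (c : ℝ → N) (v : F) (s : Set ℝ) (t : ℝ) : Prop :=
  HasMFDerivWithinAt 𝓘(ℝ, ℝ) J c s t (lineL (G := F) v)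

variable {J}

lemma HasVelocityWithinAt.velocity_eq {a b : ℝ} (hab : a < b) {c : ℝ → N} {v : F} {t : ℝ}
    (h : HasVelocityWithinAt J c v (Icc a b) t) (ht : t ∈ Icc a b) : velocity J a b c t = v := by
  have h1 := HasMFDerivWithinAt.mfderivWithin h ((uniqueDiffOn_Icc hab).uniqueMDiffOn t ht)
  rw [velocity, h1]
  exact one_smul ℝ v

lemma hasVelocityWithinAt_velocity {a b : ℝ} {c : ℝ → N} {t : ℝ}
    (h : MDifferentiableWithinAt 𝓘(ℝ, ℝ) J c (Icc a b) t) :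
    HasVelocityWithinAt J c (velocity J a b c t) (Icc a b) t := by
  have h1 := h.hasMFDerivWithinAt
  have h2 : lineL (G := F) (velocity J a b c t) = (mfderivWithin 𝓘(ℝ, ℝ) J c (Icc a b) t : ℝ →L[ℝ] F) :=
    lineL_apply_one _
  unfold HasVelocityWithinAt
  rw [h2]
  exact h1

lemma tangentMap_eq_iff {c : ℝ → N} {p : N} {v : TangentSpace J p} :
    tangentMap 𝓘(ℝ, ℝ) J c (⟨0, (1 : ℝ)⟩ : TangentBundle 𝓘(ℝ, ℝ) ℝ) = ⟨p, v⟩ ↔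
      c 0 = p ∧ (mfderiv 𝓘(ℝ, ℝ) J c 0 (1 : ℝ) : F) = v := by
  constructor
  · intro h
    have h1 : c 0 = p := congrArg Bundle.TotalSpace.proj h
    subst h1
    refine ⟨rfl, ?_⟩
    have h2 := (Bundle.TotalSpace.mk.inj h).2
    exact eq_of_heq h2
  · rintro ⟨rfl, rfl⟩
    rfl

lemma tangentMap_eq_iff_hasVelocity {c : ℝ → N} (hc : MDifferentiableAt 𝓘(ℝ, ℝ) J c 0) {p : N}
    {v : TangentSpace J p} :
    tangentMap 𝓘(ℝ, ℝ) J c (⟨0, (1 : ℝ)⟩ : TangentBundle 𝓘(ℝ, ℝ) ℝ) = ⟨p, v⟩ ↔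
      c 0 = p ∧ HasVelocityWithinAt J c v univ 0 := by
  rw [tangentMap_eq_iff]
  refine and_congr_right fun _ => ?_
  have h1 := hc.hasMFDerivAt
  have h2 : lineL (G := F) (mfderiv 𝓘(ℝ, ℝ) J c 0 (1 : ℝ)) = (mfderiv 𝓘(ℝ, ℝ) J c 0 : ℝ →L[ℝ] F) :=
    lineL_apply_one _
  constructor
  · intro h
    unfold HasVelocityWithinAt
    rw [← h, h2]
    exact hasMFDerivWithinAt_univ.2 h1
  · intro h
    rw [HasMFDerivAt.mfderiv (hasMFDerivWithinAt_univ.1 h)]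
    exact one_smul ℝ _

end Velocity

/-! ### Charts of the manifold and local projections onto the distribution. -/

section Charts

variable {E : Type*} [NormedAddCommGroup E] [NormedSpace ℝ E]
  {M : Type*} [TopologicalSpace M] [ChartedSpace E M]

variable (E) in
/-- The differential at `q` of the chart at `m`. -/
def dchart (m q : M) : E →L[ℝ] E := mfderiv 𝓘(ℝ, E) 𝓘(ℝ, E) (extChartAt 𝓘(ℝ, E) m) q

/-- The differential at `x` of the inverse of the chart at `m`. -/
def dchartSymm (m : M) (x : E) : E →L[ℝ] E :=
  mfderiv 𝓘(ℝ, E) 𝓘(ℝ, E) (extChartAt 𝓘(ℝ, E) m).symm x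

variable [IsManifold 𝓘(ℝ, E) ∞ M]

lemma dchartSymm_dchart {m q : M} (hq : q ∈ (chartAt E m).source) (v : E) :
    dchartSymm m (extChartAt 𝓘(ℝ, E) m q) (dchart E m q v) = v := by
  have := mfderivWithin_extChartAt_symm_comp_mfderiv_extChartAt' (I := 𝓘(ℝ, E)) (x := m) (y := q)
    (by simpa using hq)
  rw [modelWithCornersSelf_coe, range_id, mfderivWithin_univ] at this
  exact DFunLike.congr_fun this v

lemma dchart_dchartSymm {m q : M} (hq : q ∈ (chartAt E m).source) (v : E) :
    dchart E m q (dchartSymm m (extChartAt 𝓘(ℝ, E) m q) v) = v := by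
  have := mfderiv_extChartAt_comp_mfderivWithin_extChartAt_symm' (I := 𝓘(ℝ, E)) (x := m) (y := q)
    (by simpa using hq)
  rw [modelWithCornersSelf_coe, range_id, mfderivWithin_univ] at this
  exact DFunLike.congr_fun this v

lemma dchart_self (m : M) : dchart E m m = .id ℝ E := mfderiv_extChartAt_self

lemma HasVelocityWithinAt.hasDerivWithinAt_chart {c : ℝ → M} {s : Set ℝ} {t : ℝ} {m : M}
    {v : E} (h : HasVelocityWithinAt 𝓘(ℝ, E) c v s t)
    (hm : c t ∈ (chartAt E m).source) :
    HasDerivWithinAt (fun r => extChartAt 𝓘(ℝ, E) m (c r)) (dchart E m (c t) v) s t := by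
  have h1 := (mdifferentiableAt_extChartAt (I := 𝓘(ℝ, E)) hm).hasMFDerivAt
  have h2 := h1.comp_hasMFDerivWithinAt t h
  have h3 : HasFDerivWithinAt (fun r => extChartAt 𝓘(ℝ, E) m (c r))
    ((dchart E m (c t)).comp (lineL v)) s t := h2.hasFDerivWithinAt
  simpa using h3.hasDerivWithinAt

/-- Continuity is a separate hypothesis: off its source the chart has arbitrary values, so
differentiable coordinates alone do not keep `c` near `c t`. -/
lemma hasVelocityWithinAt_of_chart {c : ℝ → M} {s : Set ℝ} {t : ℝ} {m : M} {w : E}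
    (hc : ContinuousWithinAt c s t) (hm : c t ∈ (chartAt E m).source)
    (h : HasDerivWithinAt (fun r => extChartAt 𝓘(ℝ, E) m (c r)) w s t) :
    HasVelocityWithinAt 𝓘(ℝ, E) c (dchartSymm m (extChartAt 𝓘(ℝ, E) m (c t)) w) s t := by
  have h1 := h.hasFDerivWithinAt.hasMFDerivWithinAt
  have h2 : MDifferentiableAt 𝓘(ℝ, E) 𝓘(ℝ, E) (extChartAt 𝓘(ℝ, E) m).symm
      (extChartAt 𝓘(ℝ, E) m (c t)) := by
    have := mdifferentiableWithinAt_extChartAt_symm (I := 𝓘(ℝ, E)) (x := m)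
      ((extChartAt 𝓘(ℝ, E) m).map_source (by simpa using hm))
    rwa [modelWithCornersSelf_coe, range_id, mdifferentiableWithinAt_univ] at this
  have h3 := h2.hasMFDerivAt.comp_hasMFDerivWithinAt t h1
  have hev : ∀ᶠ r in 𝓝[s] t, c r ∈ (chartAt E m).source :=
    hc ((chartAt E m).open_source.mem_nhds hm)
  have h4 := h3.congr_of_eventuallyEq (f₁ := c) (by
    filter_upwards [hev] with r hr
    exact ((extChartAt 𝓘(ℝ, E) m).left_inv (by simpa using hr)).symm)
    ((extChartAt 𝓘(ℝ, E) m).left_inv (by simpa using hm)).symm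
  have h5 : lineL (dchartSymm m (extChartAt 𝓘(ℝ, E) m (c t)) w) =
      (dchartSymm m (extChartAt 𝓘(ℝ, E) m (c t))).comp (lineL (G := E) w) := by
    ext
    simp
  unfold HasVelocityWithinAt
  rw [h5]
  exact h4

lemma contMDiffWithinAt_iff_chart {c : ℝ → M} {s : Set ℝ} {t : ℝ} {m : M}
    (hm : c t ∈ (chartAt E m).source) :
    ContMDiffWithinAt 𝓘(ℝ, ℝ) 𝓘(ℝ, E) 1 c s t ↔ ContinuousWithinAt c s t ∧
      ContDiffWithinAt ℝ 1 (fun r => extChartAt 𝓘(ℝ, E) m (c r)) s t := by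
  have : IsManifold 𝓘(ℝ, E) 1 M := .of_le (n := ∞) (by simp)
  rw [contMDiffWithinAt_iff_target_of_mem_source hm, contMDiffWithinAt_iff_contDiffWithinAt]
  rfl

/-- `Pr` is, on the open set `U`, a field of projections onto the distribution `D` in the chart
at `m`. -/
structure IsLocalProjection (D : ∀ m : M, Submodule ℝ (TangentSpace 𝓘(ℝ, E) m)) (m : M)
    (Pr : E → E →L[ℝ] E) (U : Set E) : Prop where
  contDiff : ContDiff ℝ 1 Pr
  isOpen : IsOpen U
  mem : extChartAt 𝓘(ℝ, E) m m ∈ U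
  subset : U ⊆ (extChartAt 𝓘(ℝ, E) m).target
  mem_distribution : ∀ q ∈ (chartAt E m).source, extChartAt 𝓘(ℝ, E) m q ∈ U → ∀ v : E,
    dchartSymm m (extChartAt 𝓘(ℝ, E) m q) (Pr (extChartAt 𝓘(ℝ, E) m q) v) ∈ D q
  apply_eq : ∀ q ∈ (chartAt E m).source, extChartAt 𝓘(ℝ, E) m q ∈ U →
    ∀ v : TangentSpace 𝓘(ℝ, E) q, v ∈ D q →
      Pr (extChartAt 𝓘(ℝ, E) m q) (dchart E m q v) = dchart E m q v

/-- Let `T x` send coefficients to combinations of a local frame, and let `L` be a left inverse of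
`T` at the base point. Then `T (L T)⁻¹ L` is a projection onto the range of `T`, and it is `C^1`
near the base point because inversion is smooth at the identity. A cut-off makes it global, so it is
a projection only on `U`. -/
lemma exists_isLocalProjection [FiniteDimensional ℝ E] {k : ℕ}
    {D : ∀ m : M, Submodule ℝ (TangentSpace 𝓘(ℝ, E) m)} (hD : IsSmoothDistribution k D) (m : M) :
    ∃ Pr U, IsLocalProjection D m Pr U := by
  obtain ⟨V, hVo, hmV, X, hX, hXD⟩ := hD m
  let D' : M → Submodule ℝ E := D
  let X' : Fin k → M → E := X
  have hXD' : ∀ x ∈ V, LinearIndependent ℝ (fun i => X' i x) ∧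
    Submodule.span ℝ (range fun i => X' i x) = D' x := hXD
  set φ := extChartAt 𝓘(ℝ, E) m
  have hsrc : φ.source = (chartAt E m).source := extChartAt_source _ _
  let Y : Fin k → E → E := fun i x => dchart E m (φ.symm x) (X' i (φ.symm x))
  have hY : ∀ i, ContDiffAt ℝ 1 (Y i) (φ m) := by
    intro i
    have h1 : ContMDiffAt 𝓘(ℝ, E) 𝓘(ℝ, E).tangent ∞
        (fun x => (⟨x, X i x⟩ : TangentBundle 𝓘(ℝ, E) M)) m := (hX i).contMDiffAt (hVo.mem_nhds hmV)
    rw [Bundle.contMDiffAt_section] at h1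
    have h2 : ContMDiffAt 𝓘(ℝ, E) 𝓘(ℝ, E) ∞ φ.symm (φ m) := by
      have := contMDiffOn_extChartAt_symm (I := 𝓘(ℝ, E)) (n := ∞) m
      exact this.contMDiffAt ((isOpen_extChartAt_target m).mem_nhds (mem_extChartAt_target m))
    have h3 := ContMDiffAt.comp (φ m) (g := fun x =>
      (trivializationAt E (TangentSpace 𝓘(ℝ, E)) m ⟨x, X i x⟩).2)
      (by rw [extChartAt_to_inv]; exact h1) h2
    have h4 := (contMDiffAt_iff_contDiffAt.1 h3).of_le (m := 1) (by simp)
    refine h4.congr_of_eventuallyEq ?_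
    filter_upwards [(isOpen_extChartAt_target m).mem_nhds (mem_extChartAt_target m)] with x hx
    have hx' : φ.symm x ∈ (chartAt E m).source := by
      rw [← hsrc]; exact φ.map_target hx
    have h5 := TangentBundle.continuousLinearMapAt_trivializationAt (I := 𝓘(ℝ, E)) hx'
    -- The trivialization of the tangent bundle at `m` is the differential of the chart at `m`, so
    -- smoothness of the section gives smoothness of its coordinates `Y i`.
    have h6 := DFunLike.congr_fun h5 (X i (φ.symm x))
    rw [Bundle.Trivialization.continuousLinearMapAt_apply,
      Bundle.Trivialization.coe_linearMapAt_of_mem _ (by simpa using hx')] at h6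
    exact h6.symm
  let T : E → (Fin k → ℝ) →L[ℝ] E := fun x =>
    ∑ i, (ContinuousLinearMap.proj (R := ℝ) (φ := fun _ : Fin k => ℝ) i).smulRight (Y i x)
  have hTapp : ∀ x a, T x a = ∑ i, a i • Y i x := by
    intro x a
    simp [T]
  have hT : ContDiffAt ℝ 1 T (φ m) := by
    refine ContDiffAt.sum fun i _ => ?_
    exact (ContinuousLinearMap.smulRightL ℝ (Fin k → ℝ) E
      (ContinuousLinearMap.proj i)).contDiff.contDiffAt.comp _ (hY i)
  have hker : LinearMap.ker (T (φ m)).toLinearMap = ⊥ := by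
    rw [LinearMap.ker_eq_bot']
    intro a ha
    have h1 := (hXD' m hmV).1
    rw [Fintype.linearIndependent_iff] at h1
    have h2 : ∑ i, a i • X' i m = 0 := by
      have h3 : T (φ m) a = 0 := ha
      rw [hTapp] at h3
      have h4 : ∀ i, Y i (φ m) = X' i m := by
        intro i
        simp only [Y, φ, extChartAt_to_inv]
        rw [dchart_self]
        rfl
      simp only [h4] at h3
      exact h3
    exact funext (h1 a h2)
  obtain ⟨l, hl⟩ := LinearMap.exists_leftInverse_of_injective _ hker
  let L : E →L[ℝ] (Fin k → ℝ) := LinearMap.toContinuousLinearMap l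
  have hL : L.comp (T (φ m)) = .id ℝ _ := by
    ext1 a
    exact DFunLike.congr_fun hl a
  let Pr₀ : E → E →L[ℝ] E := fun x => (T x).comp (((L.comp (T x)).inverse).comp L)
  have hLT : ContDiffAt ℝ 1 (fun x => L.comp (T x)) (φ m) := contDiffAt_const.clm_comp hT
  have hPr₀ : ContDiffAt ℝ 1 Pr₀ (φ m) := by
    refine hT.clm_comp (ContDiffAt.clm_comp ?_ contDiffAt_const)
    refine ContDiffAt.comp (g := ContinuousLinearMap.inverse) _ ?_ hLT
    rw [hL]
    exact contDiffAt_map_inverse (ContinuousLinearEquiv.refl ℝ (Fin k → ℝ))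
  obtain ⟨Pr, hPr, hPrEq⟩ := exists_contDiff_eventuallyEq (n := 1) hPr₀
  have hinv : ∀ᶠ x in 𝓝 (φ m), ∃ e : (Fin k → ℝ) ≃L[ℝ] (Fin k → ℝ),
      (e : (Fin k → ℝ) →L[ℝ] (Fin k → ℝ)) = L.comp (T x) := by
    refine hLT.continuousAt.eventually (p := fun A => ∃ e : (Fin k → ℝ) ≃L[ℝ] (Fin k → ℝ),
      (e : (Fin k → ℝ) →L[ℝ] (Fin k → ℝ)) = A) ?_
    change ∀ᶠ A in 𝓝 (L.comp (T (φ m))), _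
    rw [hL]
    exact ContinuousLinearEquiv.nhds (ContinuousLinearEquiv.refl ℝ (Fin k → ℝ))
  have hVev : ∀ᶠ x in 𝓝 (φ m), φ.symm x ∈ V :=
    (continuousAt_extChartAt_symm m).eventually
      (by rw [extChartAt_to_inv]; exact hVo.mem_nhds hmV)
  have htgt : ∀ᶠ x in 𝓝 (φ m), x ∈ φ.target :=
    (isOpen_extChartAt_target m).mem_nhds (mem_extChartAt_target m)
  obtain ⟨U, hU, hUo, hmU⟩ := mem_nhds_iff.1 (((hPrEq.and hinv).and hVev).and htgt)
  have hq' : ∀ q ∈ (chartAt E m).source, φ.symm (φ q) = q := fun q hq => by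
    rw [← hsrc] at hq
    exact φ.left_inv hq
  refine ⟨Pr, U, hPr, hUo, hmU, fun x hx => (hU hx).2, fun q hq hqU v => ?_,
    fun q hq hqU v hv => ?_⟩
  · obtain ⟨⟨⟨h1, -⟩, h3⟩, h4⟩ := hU hqU
    rw [hq' q hq] at h3
    have h5 : ∀ a, dchartSymm m (φ q) (T (φ q) a) = ∑ i, a i • X' i q := by
      intro a
      rw [hTapp, map_sum]
      refine Finset.sum_congr rfl fun i _ => ?_
      simp only [Y]
      rw [map_smul, hq' q hq, dchartSymm_dchart hq]
    have h6 : dchartSymm m (φ q) (Pr (φ q) v) ∈ D' q := by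
      rw [h1, ← (hXD' q h3).2]
      simp only [Pr₀, ContinuousLinearMap.comp_apply]
      rw [h5]
      exact Submodule.sum_mem _ fun i _ =>
        Submodule.smul_mem _ _ (Submodule.subset_span ⟨i, rfl⟩)
    exact h6
  · obtain ⟨⟨⟨h1, e, he⟩, h3⟩, h4⟩ := hU hqU
    rw [hq' q hq] at h3
    have hv' : (show E from v) ∈ D' q := hv
    rw [← (hXD' q h3).2] at hv'
    obtain ⟨a, ha⟩ := (Submodule.mem_span_range_iff_exists_fun ℝ).1 hv'
    have ha : T (φ q) a = dchart E m q v := by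
      change _ = dchart E m q (show E from v)
      rw [hTapp, ← ha, map_sum]
      refine Finset.sum_congr rfl fun i _ => ?_
      simp only [Y]
      rw [map_smul, hq' q hq]
    rw [h1, ← ha]
    simp only [Pr₀, ContinuousLinearMap.comp_apply]
    have h5 : (L.comp (T (φ q))).inverse (L (T (φ q) a)) = a := by
      rw [← he, ContinuousLinearMap.inverse_equiv]
      have : L (T (φ q) a) = e a := by
        rw [← ContinuousLinearEquiv.coe_coe, he]; rfl
      rw [this]
      exact e.symm_apply_apply a
    rw [h5]

end Charts

section Cotangent

variable {E : Type*} [NormedAddCommGroup E] [NormedSpace ℝ E]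
  {M : Type*} [TopologicalSpace M] [ChartedSpace E M] [IsManifold 𝓘(ℝ, E) ∞ M]

/-! ### Coordinates of the cotangent bundle -/

/-- The coordinates of the covector `z` in the chart of `M` at `m`. -/
def coordCovector (m : M) (z : CotangentBundle E M) : E →L[ℝ] ℝ :=
  ContinuousLinearMap.comp (show E →L[ℝ] ℝ from z.2)
    (dchartSymm m (extChartAt 𝓘(ℝ, E) m z.1))

lemma coordCovector_apply (m : M) (z : CotangentBundle E M) (v : E) :
    coordCovector m z v = z.2 (dchartSymm m (extChartAt 𝓘(ℝ, E) m z.1) v) := rfl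

lemma coordCovector_dchart {m : M} {z : CotangentBundle E M} (hz : z.1 ∈ (chartAt E m).source)
    (v : E) : coordCovector m z (dchart E m z.1 v) = z.2 v := by
  change (show E →L[ℝ] ℝ from z.2) (dchartSymm m (extChartAt 𝓘(ℝ, E) m z.1) (dchart E m z.1 v)) = _
  rw [dchartSymm_dchart hz]
  rfl

lemma mem_extChartAt_cotangent_source {z₀ z : CotangentBundle E M} :
    z ∈ (extChartAt (cotangentModel E) z₀).source ↔ z.1 ∈ (chartAt E z₀.1).source := by
  rw [FiberBundle.extChartAt]
  simp only [PartialEquiv.trans_source, mem_inter_iff, Bundle.Trivialization.mem_source, mem_preimage,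
    PartialEquiv.prod_source, PartialEquiv.refl_source, mem_prod, mem_univ, and_true,
    extChartAt_source]
  rw [hom_trivializationAt_baseSet]
  exact ⟨fun h => h.2, fun h => ⟨⟨h, mem_univ _⟩, h⟩⟩

/-- The bundle charts of the cotangent bundle are the canonical coordinates `(x, p)` and depend on
`z₀` only through its base point. -/
lemma extChartAt_cotangent_apply {z₀ z : CotangentBundle E M}
    (hz : z.1 ∈ (chartAt E z₀.1).source) : extChartAt (cotangentModel E) z₀ z =
      (extChartAt 𝓘(ℝ, E) z₀.1 z.1, coordCovector z₀.1 z) := by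
  rw [FiberBundle.extChartAt]
  have h1 := TangentBundle.symmL_trivializationAt (I := 𝓘(ℝ, E)) hz
  rw [modelWithCornersSelf_coe, range_id, mfderivWithin_univ] at h1
  refine Prod.ext rfl ?_
  change ContinuousLinearMap.inCoordinates E (TangentSpace 𝓘(ℝ, E)) ℝ (fun _ => ℝ) z₀.1 z.1 z₀.1 z.1 z.2 = _
  ext v
  simp [ContinuousLinearMap.inCoordinates]
  rw [coordCovector_apply]
  exact congrArg z.2 (DFunLike.congr_fun h1 v)

lemma mdifferentiableAt_proj (z : CotangentBundle E M) :
    MDifferentiableAt (cotangentModel E) 𝓘(ℝ, E) (fun q : CotangentBundle E M => q.1) z :=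
  (Bundle.contMDiff_proj (n := 1) (fun x : M => TangentSpace 𝓘(ℝ, E) x →L[ℝ] ℝ)).mdifferentiableAt one_ne_zero

/-- The differential of a chart of the cotangent bundle. -/
def dcot (z₀ z : CotangentBundle E M) : E × (E →L[ℝ] ℝ) →L[ℝ] E × (E →L[ℝ] ℝ) :=
  mfderiv (cotangentModel E) 𝓘(ℝ, E × (E →L[ℝ] ℝ)) (extChartAt (cotangentModel E) z₀) z

lemma mdifferentiableAt_extChartAt_cotangent {z₀ z : CotangentBundle E M}
    (hz : z.1 ∈ (chartAt E z₀.1).source) :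
    MDifferentiableAt (cotangentModel E) 𝓘(ℝ, E × (E →L[ℝ] ℝ))
      (extChartAt (cotangentModel E) z₀) z := by
  refine mdifferentiableAt_extChartAt ?_
  rw [← extChartAt_source (cotangentModel E)]
  exact mem_extChartAt_cotangent_source.2 hz

/-- In canonical coordinates `ϑ = p dx`: the first coordinate of the bundle chart is the chart of
`M` composed with the projection, so the differentials agree. -/
lemma canonicalOneForm_apply {z₀ z : CotangentBundle E M} (hz : z.1 ∈ (chartAt E z₀.1).source)
    (u : E × (E →L[ℝ] ℝ)) :
    canonicalOneForm z u = (extChartAt (cotangentModel E) z₀ z).2 (dcot z₀ z u).1 := by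
  have h1 := (mdifferentiableAt_extChartAt (I := 𝓘(ℝ, E)) hz).hasMFDerivAt.comp z
    (mdifferentiableAt_proj z).hasMFDerivAt
  have h2 : HasMFDerivAt 𝓘(ℝ, E × (E →L[ℝ] ℝ)) 𝓘(ℝ, E) Prod.fst
      (extChartAt (cotangentModel E) z₀ z) (ContinuousLinearMap.fst ℝ E (E →L[ℝ] ℝ)) :=
    hasFDerivAt_fst.hasMFDerivAt
  have h3 := h2.comp z (mdifferentiableAt_extChartAt_cotangent hz).hasMFDerivAt
  have h4 := h1.congr_of_eventuallyEq (f₁ := Prod.fst ∘ extChartAt (cotangentModel E) z₀) (by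
    have : ∀ᶠ q : CotangentBundle E M in 𝓝 z, q.1 ∈ (chartAt E z₀.1).source :=
      (mdifferentiableAt_proj z).continuousAt.eventually ((chartAt E z₀.1).open_source.mem_nhds hz)
    filter_upwards [this] with q hq
    simp only [Function.comp_apply]
    rw [extChartAt_cotangent_apply hq])
  have h5 := DFunLike.congr_fun (hasMFDerivAt_unique h3 h4) u
  have h6 : (dcot z₀ z u).1 = dchart E z₀.1 z.1 (mfderiv (cotangentModel E) 𝓘(ℝ, E)
    (fun q : CotangentBundle E M => q.1) z u) := h5
  rw [h6, extChartAt_cotangent_apply hz]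
  exact (coordCovector_dchart hz _).symm

/-- In canonical coordinates `ω = dx ∧ dp`. The definition computes `dϑ` in the chart at `z`, while
a whole curve has to be treated in one fixed chart. The proof is therefore the naturality of the
exterior derivative under the transition map `T`. -/
lemma canonicalSymplecticForm_apply {z₀ z : CotangentBundle E M}
    (hz : z.1 ∈ (chartAt E z₀.1).source) (u v : E × (E →L[ℝ] ℝ)) :
    canonicalSymplecticForm z u v =
      (dcot z₀ z v).2 (dcot z₀ z u).1 - (dcot z₀ z u).2 (dcot z₀ z v).1 := by
  set Φ := extChartAt (cotangentModel E) z₀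
  set Ψ := extChartAt (cotangentModel E) z
  let T : E × (E →L[ℝ] ℝ) → E × (E →L[ℝ] ℝ) := Φ ∘ Ψ.symm
  have hz' : z ∈ Φ.source := mem_extChartAt_cotangent_source.2 hz
  have hΨ : ContMDiffAt 𝓘(ℝ, E × (E →L[ℝ] ℝ)) (cotangentModel E) ∞ Ψ.symm (Ψ z) :=
    (contMDiffOn_extChartAt_symm (I := cotangentModel E) (n := ∞) z).contMDiffAt
      ((isOpen_extChartAt_target z).mem_nhds (mem_extChartAt_target z))
  have hΦ : ContMDiffAt (cotangentModel E) 𝓘(ℝ, E × (E →L[ℝ] ℝ)) ∞ Φ z :=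
    contMDiffAt_extChartAt' (by rw [← extChartAt_source (cotangentModel E)]; exact hz')
  have hΨz : Ψ.symm (Ψ z) = z := extChartAt_to_inv z
  have hT : ContDiffAt ℝ ∞ T (Ψ z) :=
    contMDiffAt_iff_contDiffAt.1 (ContMDiffAt.comp (Ψ z) (by rw [hΨz]; exact hΦ) hΨ)
  have hev : ∀ᶠ y in 𝓝 (Ψ z), y ∈ Ψ.target ∧ Ψ.symm y ∈ Φ.source := by
    refine Filter.Eventually.and
      ((isOpen_extChartAt_target (I := cotangentModel E) z).mem_nhds (mem_extChartAt_target z)) ?_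
    refine hΨ.continuousAt.eventually ?_
    rw [hΨz]
    exact (isOpen_extChartAt_source z₀).mem_nhds hz'
  obtain ⟨a, ha⟩ : ∃ a : E × (E →L[ℝ] ℝ) →L[ℝ] (E × (E →L[ℝ] ℝ)) →L[ℝ] ℝ,
      ∀ f g, a f g = f.2 g.1 :=
    ⟨((ContinuousLinearMap.compL ℝ (E × (E →L[ℝ] ℝ)) E ℝ).flip (.fst ℝ E (E →L[ℝ] ℝ))).comp
      (.snd ℝ E (E →L[ℝ] ℝ)), fun _ _ => rfl⟩
  have hform : oneFormInChart (cotangentModel E) (N := CotangentBundle E M) canonicalOneForm z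
      =ᶠ[𝓝 (Ψ z)] fun y => (a (T y)).comp (fderiv ℝ T y) := by
    filter_upwards [hev] with y hy
    have hy2 : (Ψ.symm y).1 ∈ (chartAt E z₀.1).source := mem_extChartAt_cotangent_source.1 hy.2
    have h1 : MDifferentiableAt 𝓘(ℝ, E × (E →L[ℝ] ℝ)) (cotangentModel E) Ψ.symm y :=
      ((contMDiffOn_extChartAt_symm (I := cotangentModel E) (n := ∞) z).contMDiffAt
        ((isOpen_extChartAt_target z).mem_nhds hy.1)).mdifferentiableAt (by simp)
    have h2 := (mdifferentiableAt_extChartAt_cotangent hy2).hasMFDerivAt.comp y h1.hasMFDerivAt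
    have h3 := h2.mfderiv
    rw [mfderiv_eq_fderiv] at h3
    refine ContinuousLinearMap.ext fun k => ?_
    have h4 := canonicalOneForm_apply hy2
      (mfderiv 𝓘(ℝ, E × (E →L[ℝ] ℝ)) (cotangentModel E) Ψ.symm y k)
    refine h4.trans ?_
    rw [ContinuousLinearMap.comp_apply, ha]
    have h5 := DFunLike.congr_fun h3 k
    exact congrArg (fun w : E × (E →L[ℝ] ℝ) => (T y).2 w.1) h5.symm
  have two_le : (2 : WithTop ℕ∞) ≤ ∞ := WithTop.coe_le_coe.2 le_top
  have hT1 : HasFDerivAt T (fderiv ℝ T (Ψ z)) (Ψ z) :=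
    (hT.differentiableAt (by simp)).hasFDerivAt
  have hT2 : HasFDerivAt (fderiv ℝ T) (fderiv ℝ (fderiv ℝ T) (Ψ z)) (Ψ z) :=
    ((hT.fderiv_right (m := 1) (by rwa [one_add_one_eq_two])).differentiableAt one_ne_zero).hasFDerivAt
  -- The form in the chart at `z` is `a (T y) ∘ DT y`. Its derivative contains a term with the
  -- second derivative of `T`, which is symmetric and cancels in the antisymmetrization.
  have hsymm := hT.isSymmSndFDerivAt (by rwa [minSmoothness_of_isRCLikeNormedField])
  have hform' : ∀ h k, fderiv ℝ (oneFormInChart (cotangentModel E) (N := CotangentBundle E M)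
      canonicalOneForm z) (Ψ z) h k = a (fderiv ℝ T (Ψ z) h) (fderiv ℝ T (Ψ z) k) +
        a (T (Ψ z)) (fderiv ℝ (fderiv ℝ T) (Ψ z) h k) := by
    intro h k
    have h0 : HasFDerivAt (fun y => a (T y)) (a.comp (fderiv ℝ T (Ψ z))) (Ψ z) :=
      HasFDerivAt.comp (g := a) (Ψ z) (ContinuousLinearMap.hasFDerivAt (E := E × (E →L[ℝ] ℝ))
        (F := (E × (E →L[ℝ] ℝ)) →L[ℝ] ℝ) a) hT1
    have h1 := h0.clm_comp hT2
    rw [hform.fderiv_eq]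
    have h2 := h1.fderiv
    have h3 := DFunLike.congr_fun (DFunLike.congr_fun h2 h) k
    refine h3.trans ?_
    simp [add_comm]
  have hTz : ∀ w, fderiv ℝ T (Ψ z) (dcot z z w) = dcot z₀ z w := by
    intro w
    have h1 : HasMFDerivAt (cotangentModel E) 𝓘(ℝ, E × (E →L[ℝ] ℝ)) Ψ z (dcot z z) :=
      (mdifferentiableAt_extChartAt_cotangent (mem_chart_source E z.1)).hasMFDerivAt
    have h2 := hT1.hasMFDerivAt.comp z h1
    have h3 := h2.congr_of_eventuallyEq (f₁ := Φ) (by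
      filter_upwards [(isOpen_extChartAt_source (I := cotangentModel E) z).mem_nhds
        (mem_extChartAt_source z)] with q hq
      simp only [T, Function.comp_apply]
      rw [Ψ.left_inv hq])
    exact (DFunLike.congr_fun h3.mfderiv w).symm
  have hu : canonicalSymplecticForm z u v =
      -(fderiv ℝ (oneFormInChart (cotangentModel E) (N := CotangentBundle E M)
        canonicalOneForm z) (Ψ z) (dcot z z u) (dcot z z v) -
      fderiv ℝ (oneFormInChart (cotangentModel E) (N := CotangentBundle E M)
        canonicalOneForm z) (Ψ z) (dcot z z v) (dcot z z u)) := rfl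
  rw [hu, hform', hform', hTz, hTz, hsymm (dcot z z u) (dcot z z v)]
  simp only [ha]
  ring

end Cotangent

section Characteristics

variable {E : Type*} [NormedAddCommGroup E] [NormedSpace ℝ E]
  {M : Type*} [TopologicalSpace M] [ChartedSpace E M] [IsManifold 𝓘(ℝ, E) ∞ M]

/-! ### Characteristics in coordinates -/

/-- The zero covector at `m`. -/
def zeroCovector (m : M) : CotangentBundle E M := ⟨m, 0⟩

/-- The chart of the cotangent bundle that is induced by the chart of `M` at `m`. -/
def cotChart (m : M) : PartialEquiv (CotangentBundle E M) (E × (E →L[ℝ] ℝ)) :=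
  extChartAt (cotangentModel E) (zeroCovector m)

lemma mem_cotChart_source {m : M} {z : CotangentBundle E M} :
    z ∈ (cotChart m).source ↔ z.1 ∈ (chartAt E m).source :=
  mem_extChartAt_cotangent_source

lemma cotChart_apply {m : M} {z : CotangentBundle E M} (hz : z.1 ∈ (chartAt E m).source) :
    cotChart m z = (extChartAt 𝓘(ℝ, E) m z.1, coordCovector m z) :=
  extChartAt_cotangent_apply hz

lemma isOpen_cotChart_target (m : M) : IsOpen (cotChart (E := E) m).target :=
  isOpen_extChartAt_target (I := cotangentModel E) _

lemma contMDiffAt_cotChart_symm {m : M} {y : E × (E →L[ℝ] ℝ)} (hy : y ∈ (cotChart m).target) :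
    ContMDiffAt 𝓘(ℝ, E × (E →L[ℝ] ℝ)) (cotangentModel E) 1 (cotChart m).symm y := by
  have := (contMDiffOn_extChartAt_symm (I := cotangentModel E) (n := ∞)
    (zeroCovector (E := E) m)).contMDiffAt ((isOpen_cotChart_target m).mem_nhds hy)
  exact this.of_le (by simp)

lemma continuous_cotangent_proj : Continuous (fun z : CotangentBundle E M => z.1) :=
  continuous_iff_continuousAt.2 fun z => (mdifferentiableAt_proj z).continuousAt

/-- The continuity of the base curve keeps `η` in the domain of the chart, where coordinates
determine it. -/
lemma continuousWithinAt_of_cotChart {X : Type*} [TopologicalSpace X] {η : X → CotangentBundle E M}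
    {s : Set X} {t : X} {m : M} (hm : (η t).1 ∈ (chartAt E m).source)
    (h1 : ContinuousWithinAt (fun r => (η r).1) s t)
    (h2 : ContinuousWithinAt (fun r => cotChart m (η r)) s t) : ContinuousWithinAt η s t := by
  have hev : ∀ᶠ r in 𝓝[s] t, (η r).1 ∈ (chartAt E m).source :=
    h1 ((chartAt E m).open_source.mem_nhds hm)
  have hmem : cotChart m (η t) ∈ (cotChart m).target :=
    (cotChart m).map_source (mem_cotChart_source.2 hm)
  have h3 := ContinuousAt.comp_continuousWithinAt (f := fun r => cotChart m (η r))
    (contMDiffAt_cotChart_symm hmem).continuousAt h2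
  refine h3.congr_of_eventuallyEq ?_ ((cotChart m).left_inv (mem_cotChart_source.2 hm)).symm
  filter_upwards [hev] with r hr
  exact ((cotChart m).left_inv (mem_cotChart_source.2 hr)).symm

lemma HasVelocityWithinAt.hasDerivWithinAt_cotChart {η : ℝ → CotangentBundle E M}
    {u : E × (E →L[ℝ] ℝ)} {s : Set ℝ} {t : ℝ}
    (h : HasVelocityWithinAt (cotangentModel E) η u s t) {m : M}
    (hm : (η t).1 ∈ (chartAt E m).source) :
    HasDerivWithinAt (fun r => cotChart m (η r)) (dcot (zeroCovector m) (η t) u) s t := by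
  have h1 : HasMFDerivAt (cotangentModel E) 𝓘(ℝ, E × (E →L[ℝ] ℝ)) (cotChart m) (η t)
      (dcot (zeroCovector m) (η t)) :=
    (mdifferentiableAt_extChartAt_cotangent (z₀ := zeroCovector m) hm).hasMFDerivAt
  have h2 := h1.comp_hasMFDerivWithinAt t h
  have h3 : HasFDerivWithinAt (fun r => cotChart m (η r))
    ((dcot (zeroCovector m) (η t)).comp (lineL u)) s t := h2.hasFDerivWithinAt
  simpa using h3.hasDerivWithinAt

lemma bijective_dcot {m : M} {z : CotangentBundle E M} (hz : z.1 ∈ (chartAt E m).source) :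
    Function.Bijective (dcot (zeroCovector m) z) := by
  have h := isInvertible_mfderiv_extChartAt (I := cotangentModel E) (x := zeroCovector m)
    (mem_extChartAt_cotangent_source.2 hz)
  exact h.bijective

lemma exists_hasVelocityWithinAt_of_cotChart {η : ℝ → CotangentBundle E M}
    {w : E × (E →L[ℝ] ℝ)} {s : Set ℝ} {t : ℝ} {m : M} (hη : ContinuousWithinAt η s t)
    (hm : (η t).1 ∈ (chartAt E m).source)
    (h : HasDerivWithinAt (fun r => cotChart m (η r)) w s t) :
    ∃ u, HasVelocityWithinAt (cotangentModel E) η u s t := by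
  have h1 := h.hasFDerivWithinAt.hasMFDerivWithinAt
  have hmem : cotChart m (η t) ∈ (cotChart m).target :=
    (cotChart m).map_source (mem_cotChart_source.2 hm)
  have h2 := ((contMDiffAt_cotChart_symm hmem).mdifferentiableAt one_ne_zero).hasMFDerivAt
  have h3 := h2.comp_hasMFDerivWithinAt t h1
  have hev : ∀ᶠ r in 𝓝[s] t, (η r).1 ∈ (chartAt E m).source :=
    (continuous_cotangent_proj.continuousAt.comp_continuousWithinAt hη)
      ((chartAt E m).open_source.mem_nhds hm)
  have h4 := h3.congr_of_eventuallyEq (f₁ := η) (by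
    filter_upwards [hev] with r hr
    exact ((cotChart m).left_inv (mem_cotChart_source.2 hr)).symm)
    ((cotChart m).left_inv (mem_cotChart_source.2 hm)).symm
  refine ⟨mfderiv 𝓘(ℝ, E × (E →L[ℝ] ℝ)) (cotangentModel E) (cotChart m).symm
    (cotChart m (η t)) w, ?_⟩
  have h5 : lineL (G := E × (E →L[ℝ] ℝ)) (mfderiv 𝓘(ℝ, E × (E →L[ℝ] ℝ)) (cotangentModel E)
      (cotChart m).symm (cotChart m (η t)) w) = (show E × (E →L[ℝ] ℝ) →L[ℝ] E × (E →L[ℝ] ℝ) from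
        mfderiv 𝓘(ℝ, E × (E →L[ℝ] ℝ)) (cotangentModel E) (cotChart m).symm
      (cotChart m (η t))).comp (lineL (G := E × (E →L[ℝ] ℝ)) w) := by
    refine ContinuousLinearMap.ext fun r => ?_
    exact (ContinuousLinearMap.map_smul (show E × (E →L[ℝ] ℝ) →L[ℝ] E × (E →L[ℝ] ℝ) from
        mfderiv 𝓘(ℝ, E × (E →L[ℝ] ℝ)) (cotangentModel E) (cotChart m).symm
      (cotChart m (η t))) r w).symm
  unfold HasVelocityWithinAt
  rw [h5]
  exact h4

variable {D : ∀ m : M, Submodule ℝ (TangentSpace 𝓘(ℝ, E) m)} {m : M} {Pr : E → E →L[ℝ] E}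
  {U : Set E}

lemma IsLocalProjection.idempotent (h : IsLocalProjection D m Pr U) {x : E} (hx : x ∈ U) :
    (Pr x).comp (Pr x) = Pr x := by
  ext v
  set φ := extChartAt 𝓘(ℝ, E) m
  have hq : φ.symm x ∈ (chartAt E m).source := by
    rw [← extChartAt_source 𝓘(ℝ, E)]; exact φ.map_target (h.subset hx)
  have hxq : φ (φ.symm x) = x := φ.right_inv (h.subset hx)
  have h1 := h.mem_distribution (φ.symm x) hq (by rwa [hxq]) v
  have h2 := h.apply_eq (φ.symm x) hq (by rwa [hxq]) _ h1
  rw [dchart_dchartSymm hq, hxq] at h2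
  exact h2

/-- Differentiate `Pr ∘ Pr = Pr`, which holds on the open set `U`. -/
lemma IsLocalProjection.fderiv_idempotent (h : IsLocalProjection D m Pr U) {x : E} (hx : x ∈ U)
    (v w : E) : fderiv ℝ Pr x v (Pr x w) + Pr x (fderiv ℝ Pr x v w) = fderiv ℝ Pr x v w := by
  have h1 := (h.contDiff.differentiable one_ne_zero x).hasFDerivAt
  have h2 := h1.clm_comp h1
  have h3 := h2.congr_of_eventuallyEq (f₁ := Pr) (by
    filter_upwards [h.isOpen.mem_nhds hx] with y hy
    exact (h.idempotent hy).symm)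
  have h4 := DFunLike.congr_fun (DFunLike.congr_fun (h1.unique h3) v) w
  conv_rhs => rw [h4]
  simp [add_comm]

lemma IsLocalProjection.mem_annihilator_iff (h : IsLocalProjection D m Pr U)
    {z : CotangentBundle E M} (hz : z.1 ∈ (chartAt E m).source)
    (hzU : extChartAt 𝓘(ℝ, E) m z.1 ∈ U) :
    z ∈ annihilator D ↔ (coordCovector m z).comp (Pr (extChartAt 𝓘(ℝ, E) m z.1)) = 0 := by
  constructor
  · intro hzD
    ext v
    exact hzD _ (h.mem_distribution z.1 hz hzU v)
  · intro h0 v hv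
    have h1 := h.apply_eq z.1 hz hzU v hv
    have h2 := coordCovector_dchart hz v
    rw [← h1] at h2
    rw [← h2]
    exact DFunLike.congr_fun h0 _

/-- In coordinates the annihilator is given by `p Pr(x) = 0`, and the right-hand side is the
linearization of this equation. Necessity follows by differentiating along a curve; sufficiency
needs a curve in the annihilator. -/
lemma IsLocalProjection.mem_tangentVectors_iff (h : IsLocalProjection D m Pr U)
    {z : CotangentBundle E M} (hz : z.1 ∈ (chartAt E m).source)
    (hzU : extChartAt 𝓘(ℝ, E) m z.1 ∈ U) (hzD : z ∈ annihilator D) (u : E × (E →L[ℝ] ℝ)) :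
    u ∈ tangentVectors (cotangentModel E) (annihilator D) z ↔
      ∀ w, (dcot (zeroCovector m) z u).2 (Pr (extChartAt 𝓘(ℝ, E) m z.1) w) +
        coordCovector m z
          (fderiv ℝ Pr (extChartAt 𝓘(ℝ, E) m z.1) (dcot (zeroCovector m) z u).1 w) = 0 := by
  set x := extChartAt 𝓘(ℝ, E) m z.1
  set p := coordCovector m z
  obtain ⟨v₁, v₂, hv⟩ : ∃ v₁ v₂, dcot (zeroCovector m) z u = (v₁, v₂) := ⟨_, _, rfl⟩
  have hpP : p.comp (Pr x) = 0 := (h.mem_annihilator_iff hz hzU).1 hzD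
  have hPr := (h.contDiff.differentiable one_ne_zero x).hasFDerivAt
  rw [hv]
  constructor
  · rintro ⟨c, hc, hcD, hcu⟩ w
    obtain ⟨rfl, hvel⟩ := (tangentMap_eq_iff_hasVelocity (hc.mdifferentiableAt one_ne_zero)).1 hcu
    have h1 := (hvel.hasDerivWithinAt_cotChart hz).hasDerivAt univ_mem
    rw [hv] at h1
    have hcont : ContinuousAt (fun s => (c s).1) 0 :=
      continuous_cotangent_proj.continuousAt.comp hc.continuousAt
    have hsrc : ∀ᶠ s in 𝓝 (0 : ℝ), (c s).1 ∈ (chartAt E m).source :=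
      hcont.eventually ((chartAt E m).open_source.mem_nhds hz)
    have hU : ∀ᶠ s in 𝓝 (0 : ℝ), extChartAt 𝓘(ℝ, E) m (c s).1 ∈ U := by
      have h2 : ContinuousAt (extChartAt 𝓘(ℝ, E) m) (c 0).1 := continuousAt_extChartAt' (by simpa using hz)
      exact (ContinuousAt.comp (f := fun s => (c s).1) h2 hcont).eventually (h.isOpen.mem_nhds hzU)
    have h00 : cotChart m (c 0) = (x, p) := cotChart_apply hz
    have h3 : HasDerivAt (fun s => (cotChart m (c s)).2 (Pr (cotChart m (c s)).1 w))
        (v₂ (Pr x w) + p (fderiv ℝ Pr x v₁ w)) 0 := by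
      have h4 : HasDerivAt (fun s => (cotChart m (c s)).1) v₁ 0 := h1.fst
      have h5 : HasDerivAt (fun s => (cotChart m (c s)).2) v₂ 0 := h1.snd
      have h6 : HasDerivAt (fun s => Pr (cotChart m (c s)).1) (fderiv ℝ Pr x v₁) 0 :=
        HasFDerivAt.comp_hasDerivAt (l := Pr) (0 : ℝ) (by rw [h00]; exact hPr) h4
      have h7 := h5.clm_apply (h6.clm_apply (hasDerivAt_const (0 : ℝ) w))
      simpa [h00] using h7
    refine h3.unique ((hasDerivAt_const (0 : ℝ) (0 : ℝ)).congr_of_eventuallyEq ?_)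
    filter_upwards [hsrc, hU, hcD] with s hs1 hs2 hs3
    rw [cotChart_apply hs1]
    exact DFunLike.congr_fun ((h.mem_annihilator_iff hs1 hs2).1 hs3) w
  · intro hw
    -- The straight line, with its covector composed with `1 - Pr`, stays in the annihilator by
    -- idempotence. Its covector velocity is `v₂ - (v₂ Pr + p DPr v₁)`, which is `v₂` by the
    -- linearized equation.
    let Y : ℝ → E × (E →L[ℝ] ℝ) := fun s =>
      (x + s • v₁, (p + s • v₂).comp (.id ℝ E - Pr (x + s • v₁)))
    have hY0 : Y 0 = cotChart m z := by
      rw [cotChart_apply hz]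
      simp only [Y, zero_smul, add_zero, ContinuousLinearMap.comp_sub, ContinuousLinearMap.comp_id]
      refine Prod.ext rfl ?_
      change p - p.comp (Pr x) = p
      rw [hpP, sub_zero]
    have hYC : ContDiffAt ℝ 1 Y 0 := by
      have h1 : ContDiffAt ℝ 1 (fun s : ℝ => x + s • v₁) 0 := by fun_prop
      have h2 : ContDiffAt ℝ 1 (fun s : ℝ => p + s • v₂) 0 := by fun_prop
      exact h1.prodMk (h2.clm_comp (contDiffAt_const.sub (h.contDiff.contDiffAt.comp (0 : ℝ) h1)))
    have hYd : HasDerivAt Y (v₁, v₂) 0 := by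
      have h1 : HasDerivAt (fun s : ℝ => x + s • v₁) v₁ 0 := by
        simpa using ((hasDerivAt_id (0 : ℝ)).smul_const v₁).const_add x
      have h2 : HasDerivAt (fun s : ℝ => p + s • v₂) v₂ 0 := by
        simpa using ((hasDerivAt_id (0 : ℝ)).smul_const v₂).const_add p
      have h3 : HasDerivAt (fun s : ℝ => Pr (x + s • v₁)) (fderiv ℝ Pr x v₁) 0 :=
        HasFDerivAt.comp_hasDerivAt (l := Pr) (0 : ℝ) (by simpa using hPr) h1
      have h4 := h1.prodMk (h2.clm_comp (h3.const_sub (.id ℝ E)))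
      convert h4 using 1
      refine Prod.ext rfl ?_
      ext w
      have h5 := hw w
      simp only [zero_smul, add_zero, add_apply, ContinuousLinearMap.comp_apply, sub_apply,
        ContinuousLinearMap.id_apply, neg_apply, map_sub, map_neg]
      linarith
    have hmem : Y 0 ∈ (cotChart m).target := by
      rw [hY0]; exact (cotChart m).map_source (mem_cotChart_source.2 hz)
    have hC : ContMDiffAt 𝓘(ℝ, ℝ) (cotangentModel E) 1 (fun s => (cotChart m).symm (Y s)) 0 :=
      (contMDiffAt_cotChart_symm hmem).comp (0 : ℝ) hYC.contMDiffAt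
    have hc0 : (cotChart m).symm (Y 0) = z := by
      rw [hY0]; exact (cotChart m).left_inv (mem_cotChart_source.2 hz)
    have htgt : ∀ᶠ s in 𝓝 (0 : ℝ), Y s ∈ (cotChart m).target :=
      hYC.continuousAt.eventually ((isOpen_cotChart_target m).mem_nhds hmem)
    refine ⟨fun s => (cotChart m).symm (Y s), hC, ?_, ?_⟩
    · have hU : ∀ᶠ s in 𝓝 (0 : ℝ), (Y s).1 ∈ U :=
        hYC.continuousAt.fst.eventually (h.isOpen.mem_nhds (by simpa [Y] using hzU))
      filter_upwards [htgt, hU] with s hs1 hs2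
      have h1 : (cotChart m).symm (Y s) ∈ (cotChart m).source := (cotChart m).map_target hs1
      have h2 := mem_cotChart_source.1 h1
      have h3 := cotChart_apply h2
      rw [(cotChart m).right_inv hs1] at h3
      have h4 := congrArg Prod.fst h3
      have h5 := congrArg Prod.snd h3
      simp only at h4 h5
      rw [h.mem_annihilator_iff h2 (by rwa [← h4]), ← h4, ← h5]
      ext w
      have h6 := DFunLike.congr_fun (h.idempotent hs2) w
      simp only [Y, ContinuousLinearMap.comp_apply, sub_apply, ContinuousLinearMap.id_apply,
        zero_apply] at h6 ⊢
      rw [h6, sub_self, map_zero]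
    · refine (tangentMap_eq_iff_hasVelocity (hC.mdifferentiableAt one_ne_zero)).2 ⟨hc0, ?_⟩
      have hsrc : ((cotChart m).symm (Y 0)).1 ∈ (chartAt E m).source := by rwa [hc0]
      have h1 : HasDerivWithinAt (fun s => cotChart m ((cotChart m).symm (Y s))) (v₁, v₂) univ 0 := by
        rw [hasDerivWithinAt_univ]
        refine hYd.congr_of_eventuallyEq ?_
        filter_upwards [htgt] with s hs
        exact (cotChart m).right_inv hs
      obtain ⟨u', hu'⟩ := exists_hasVelocityWithinAt_of_cotChart
        (hC.continuousAt.continuousWithinAt) hsrc h1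
      have h2 := hu'.hasDerivWithinAt_cotChart hsrc
      have h3 := (hasDerivWithinAt_univ.1 h2).unique (hasDerivWithinAt_univ.1 h1)
      have h4 : u' = u := by
        apply (bijective_dcot hz).1
        rw [hv, ← h3, hc0]
      rwa [h4] at hu'

/-- For a vector with base velocity in the distribution, the kernel condition is the adjoint
equation `p' = -p D_v Pr(x) x'`. In one direction enough tangent vectors of the annihilator are
tested; in the other, the tangency equation of `ζ` is evaluated on the base velocity of `u`. -/
lemma IsLocalProjection.mem_ker_iff (h : IsLocalProjection D m Pr U)
    {z : CotangentBundle E M} (hz : z.1 ∈ (chartAt E m).source)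
    (hzU : extChartAt 𝓘(ℝ, E) m z.1 ∈ U) (hzD : z ∈ annihilator D) {u : E × (E →L[ℝ] ℝ)}
    (hu : Pr (extChartAt 𝓘(ℝ, E) m z.1) (dcot (zeroCovector m) z u).1 =
      (dcot (zeroCovector m) z u).1) :
    (∀ ζ ∈ tangentVectors (cotangentModel E) (annihilator D) z,
      canonicalSymplecticForm z u ζ = 0) ↔
    ∀ v, (dcot (zeroCovector m) z u).2 v = -coordCovector m z
      (fderiv ℝ Pr (extChartAt 𝓘(ℝ, E) m z.1) v (dcot (zeroCovector m) z u).1) := by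
  set x := extChartAt 𝓘(ℝ, E) m z.1
  set p := coordCovector m z
  have hpP : p.comp (Pr x) = 0 := (h.mem_annihilator_iff hz hzU).1 hzD
  constructor
  · intro hζ v
    -- Over each `v` this vector is tangent to the annihilator, by `fderiv_idempotent` and `p Pr =
    -- 0`; pairing it with `u` isolates the covector part of `u` at `v`.
    obtain ⟨ζ, hζe⟩ := (bijective_dcot hz).2 (v, -p.comp (fderiv ℝ Pr x v))
    have h1 := hζ ζ ((h.mem_tangentVectors_iff hz hzU hzD ζ).2 fun w => by
      rw [hζe]
      have h2 := congrArg p (h.fderiv_idempotent hzU v w)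
      rw [map_add] at h2
      have h3 : p (Pr x (fderiv ℝ Pr x v w)) = 0 := DFunLike.congr_fun hpP _
      simp only [neg_apply, ContinuousLinearMap.comp_apply]
      linarith)
    rw [canonicalSymplecticForm_apply (z₀ := zeroCovector m) hz, hζe] at h1
    simp only [neg_apply, ContinuousLinearMap.comp_apply] at h1
    linarith
  · intro hp ζ hζ
    have h1 := (h.mem_tangentVectors_iff hz hzU hzD ζ).1 hζ (dcot (zeroCovector m) z u).1
    rw [hu] at h1
    refine (canonicalSymplecticForm_apply (z₀ := zeroCovector m) hz u ζ).trans ?_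
    rw [hp]
    linarith

end Characteristics

lemma exists_Icc_mem_nhdsWithin {a b t : ℝ} (hab : a < b) (ht : t ∈ Icc a b) {S : Set ℝ}
    (hS : S ∈ 𝓝[Icc a b] t) : ∃ t₀ t₁, t₀ < t₁ ∧ Icc t₀ t₁ ⊆ Icc a b ∧ Icc t₀ t₁ ⊆ S ∧
      t ∈ Icc t₀ t₁ ∧ Icc t₀ t₁ ∈ 𝓝[Icc a b] t := by
  obtain ⟨ε, hε, hεS⟩ := Metric.mem_nhdsWithin_iff.1 hS
  have hmem : Icc (t - ε / 2) (t + ε / 2) ∈ 𝓝 t := Icc_mem_nhds (by linarith) (by linarith)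
  have heq : Icc (max a (t - ε / 2)) (min b (t + ε / 2)) =
      Icc a b ∩ Icc (t - ε / 2) (t + ε / 2) := by rw [Icc_inter_Icc]
  refine ⟨max a (t - ε / 2), min b (t + ε / 2), ?_, ?_, ?_, ?_, ?_⟩
  · rcases ht with ⟨h1, h2⟩
    rw [max_lt_iff, lt_min_iff, lt_min_iff]
    refine ⟨⟨hab, by linarith⟩, by linarith, by linarith⟩
  · rw [heq]; exact inter_subset_left
  · rw [heq]
    refine fun r hr => hεS ⟨?_, hr.1⟩
    rw [Metric.mem_ball, Real.dist_eq, abs_lt]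
    constructor <;> linarith [hr.2.1, hr.2.2]
  · rw [heq]
    exact ⟨ht, by constructor <;> linarith⟩
  · rw [heq]
    exact inter_mem self_mem_nhdsWithin (mem_nhdsWithin_of_mem_nhds hmem)

/-! ### Characteristics as solutions of the adjoint linearized equation. -/

section Adjoint

variable {E : Type*} [NormedAddCommGroup E] [NormedSpace ℝ E]
  {M : Type*} [TopologicalSpace M] [ChartedSpace E M] [IsManifold 𝓘(ℝ, E) ∞ M]

/-- On `[a, b]`, `γ` is a horizontal curve of class `C^1` with velocity `g`. -/
structure IsHorizontalWith (D : ∀ m : M, Submodule ℝ (TangentSpace 𝓘(ℝ, E) m)) (a b : ℝ)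
    (γ : ℝ → M) (g : ∀ t, TangentSpace 𝓘(ℝ, E) (γ t)) : Prop where
  contMDiffOn : ContMDiffOn 𝓘(ℝ, ℝ) 𝓘(ℝ, E) 1 γ (Icc a b)
  hasVelocity : ∀ t ∈ Icc a b, HasVelocityWithinAt 𝓘(ℝ, E) γ (g t) (Icc a b) t
  mem : ∀ t ∈ Icc a b, g t ∈ D (γ t)

variable {D : ∀ m : M, Submodule ℝ (TangentSpace 𝓘(ℝ, E) m)} {m : M} {Pr : E → E →L[ℝ] E}
  {U : Set E} {a b : ℝ} {γ : ℝ → M} {g : ∀ t, TangentSpace 𝓘(ℝ, E) (γ t)}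

lemma HasVelocityWithinAt.mono {F H : Type*} [NormedAddCommGroup F] [NormedSpace ℝ F]
    [TopologicalSpace H] {J : ModelWithCorners ℝ F H} {N : Type*} [TopologicalSpace N]
    [ChartedSpace H N] {c : ℝ → N} {v : F} {s s' : Set ℝ} {t : ℝ}
    (h : HasVelocityWithinAt J c v s t) (hs : s' ⊆ s) : HasVelocityWithinAt J c v s' t :=
  HasMFDerivWithinAt.mono h hs

lemma IsHorizontalWith.mono (h : IsHorizontalWith D a b γ g) {a' b' : ℝ}
    (hs : Icc a' b' ⊆ Icc a b) : IsHorizontalWith D a' b' γ g :=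
  ⟨h.contMDiffOn.mono hs, fun t ht => (h.hasVelocity t (hs ht)).mono hs, fun t ht => h.mem t (hs ht)⟩

lemma isHorizontalWith_velocity {P : Set M} (h : γ ∈ horizontalCurvesFrom D a b P) :
    IsHorizontalWith D a b γ (velocity 𝓘(ℝ, E) a b γ) :=
  ⟨h.1, fun t ht => hasVelocityWithinAt_velocity ((h.1 t ht).mdifferentiableWithinAt one_ne_zero),
    h.2.1⟩

lemma IsHorizontalWith.hasDerivWithinAt_chart (h : IsHorizontalWith D a b γ g) {t : ℝ}
    (ht : t ∈ Icc a b) (hm : γ t ∈ (chartAt E m).source) :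
    HasDerivWithinAt (fun r => extChartAt 𝓘(ℝ, E) m (γ r)) (dchart E m (γ t) (g t)) (Icc a b) t :=
  (h.hasVelocity t ht).hasDerivWithinAt_chart hm

lemma IsHorizontalWith.continuousOn_dchart (h : IsHorizontalWith D a b γ g) (hab : a < b)
    (hm : ∀ t ∈ Icc a b, γ t ∈ (chartAt E m).source) :
    ContinuousOn (fun t => dchart E m (γ t) (g t)) (Icc a b) := by
  have h1 : ContDiffOn ℝ 1 (fun r => extChartAt 𝓘(ℝ, E) m (γ r)) (Icc a b) := fun t ht =>
    ((contMDiffWithinAt_iff_chart (hm t ht)).1 (h.contMDiffOn t ht)).2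
  refine (h1.continuousOn_derivWithin (uniqueDiffOn_Icc hab) le_rfl).congr fun t ht => ?_
  exact ((h.hasDerivWithinAt_chart ht (hm t ht)).derivWithin (uniqueDiffOn_Icc hab t ht)).symm

/-- The linear map `v ↦ D_v Pr (γ t) (γ' t)` in the chart at `m`. -/
def linearizationAt (m : M) (Pr : E → E →L[ℝ] E) (γ : ℝ → M)
    (g : ∀ t, TangentSpace 𝓘(ℝ, E) (γ t)) (t : ℝ) : E →L[ℝ] E :=
  (fderiv ℝ Pr (extChartAt 𝓘(ℝ, E) m (γ t))).flip (dchart E m (γ t) (g t))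

/-- In the coordinates given by `m`, `η` solves the adjoint linearized equation at time `t` and
annihilates the distribution. -/
def IsAdjointAt (D : ∀ m : M, Submodule ℝ (TangentSpace 𝓘(ℝ, E) m)) (m : M) (Pr : E → E →L[ℝ] E)
    (U : Set E) (γ : ℝ → M) (g : ∀ t, TangentSpace 𝓘(ℝ, E) (γ t)) (η : ℝ → CotangentBundle E M)
    (s : Set ℝ) (t : ℝ) : Prop :=
  IsLocalProjection D m Pr U ∧ γ t ∈ (chartAt E m).source ∧ extChartAt 𝓘(ℝ, E) m (γ t) ∈ U ∧
    (coordCovector m (η t)).comp (Pr (extChartAt 𝓘(ℝ, E) m (γ t))) = 0 ∧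
    HasDerivWithinAt (fun r => coordCovector m (η r))
      (-(coordCovector m (η t)).comp (linearizationAt m Pr γ g t)) s t

variable {η : ℝ → CotangentBundle E M}

lemma IsHorizontalWith.continuousWithinAt (h : IsHorizontalWith D a b γ g) {t : ℝ}
    (ht : t ∈ Icc a b) : ContinuousWithinAt γ (Icc a b) t :=
  (h.contMDiffOn t ht).continuousWithinAt

lemma cotChart_eventuallyEq (h : IsHorizontalWith D a b γ g) (hη : ∀ t ∈ Icc a b, (η t).1 = γ t)
    {t : ℝ} (ht : t ∈ Icc a b) (hm : γ t ∈ (chartAt E m).source) :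
    (fun r => cotChart m (η r)) =ᶠ[𝓝[Icc a b] t]
      fun r => (extChartAt 𝓘(ℝ, E) m (γ r), coordCovector m (η r)) := by
  filter_upwards [h.continuousWithinAt ht ((chartAt E m).open_source.mem_nhds hm),
    self_mem_nhdsWithin] with r hr hr'
  rw [cotChart_apply (by rw [hη r hr']; exact hr), hη r hr']

/-- The hypotheses on `η` do not involve a chart, and the chart and the projection are arbitrary.
The adjoint equation can therefore be transferred from one chart to another through the symplectic
condition. -/
lemma isAdjointAt_of_mem_ker (hab : a < b) (h : IsHorizontalWith D a b γ g)
    (hη : ∀ t ∈ Icc a b, (η t).1 = γ t) {t : ℝ} (ht : t ∈ Icc a b)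
    (hPr : IsLocalProjection D m Pr U) (hm : γ t ∈ (chartAt E m).source)
    (hU : extChartAt 𝓘(ℝ, E) m (γ t) ∈ U) {u : E × (E →L[ℝ] ℝ)}
    (hu : HasVelocityWithinAt (cotangentModel E) η u (Icc a b) t) (hD : η t ∈ annihilator D)
    (hker : ∀ ζ ∈ tangentVectors (cotangentModel E) (annihilator D) (η t),
      canonicalSymplecticForm (η t) u ζ = 0) :
    IsAdjointAt D m Pr U γ g η (Icc a b) t := by
  have hηt := hη t ht
  have hm' : (η t).1 ∈ (chartAt E m).source := by rwa [hηt]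
  have hU' : extChartAt 𝓘(ℝ, E) m (η t).1 ∈ U := by rwa [hηt]
  have hud := uniqueDiffOn_Icc hab t ht
  have h1 := hu.hasDerivWithinAt_cotChart hm'
  have h2 := h1.congr_of_eventuallyEq (cotChart_eventuallyEq h hη ht hm).symm
    (by rw [cotChart_apply hm', hηt])
  have h3 : (dcot (zeroCovector m) (η t) u).1 = dchart E m (γ t) (g t) :=
    hud.eq_deriv _ h2.fst (h.hasDerivWithinAt_chart ht hm)
  have h4 : Pr (extChartAt 𝓘(ℝ, E) m (η t).1) (dcot (zeroCovector m) (η t) u).1 =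
      (dcot (zeroCovector m) (η t) u).1 := by
    rw [h3, hηt]
    exact hPr.apply_eq (γ t) hm hU (g t) (h.mem t ht)
  have h5 := (hPr.mem_ker_iff hm' hU' hD h4).1 hker
  refine ⟨hPr, hm, hU, ?_, ?_⟩
  · have := (hPr.mem_annihilator_iff hm' hU').1 hD
    rwa [hηt] at this
  · have h6 : -(coordCovector m (η t)).comp (linearizationAt m Pr γ g t) =
        (dcot (zeroCovector m) (η t) u).2 := by
      ext v
      rw [h5 v, h3, hηt]
      rfl
    rw [h6]
    exact h2.snd

lemma IsCharacteristic.isAdjointAt (hab : a < b) (h : IsHorizontalWith D a b γ g)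
    (hη : ∀ t ∈ Icc a b, (η t).1 = γ t) (hc : IsCharacteristic D a b η) {t : ℝ} (ht : t ∈ Icc a b)
    (hPr : IsLocalProjection D m Pr U) (hm : γ t ∈ (chartAt E m).source)
    (hU : extChartAt 𝓘(ℝ, E) m (γ t) ∈ U) : IsAdjointAt D m Pr U γ g η (Icc a b) t :=
  isAdjointAt_of_mem_ker hab h hη ht hPr hm hU
    (hasVelocityWithinAt_velocity ((hc.contMDiffOn t ht).mdifferentiableWithinAt one_ne_zero))
    (hc.mem_annihilator t ht) (hc.velocity_mem_ker t ht)

/-- The chart may vary with `t`, which suits glued curves, but continuity of the derivative must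
then be recovered. Each velocity is first shown to satisfy the invariant kernel condition. -/
lemma isCharacteristic_of_isAdjointAt (hab : a < b) (h : IsHorizontalWith D a b γ g)
    (hη : ∀ t ∈ Icc a b, (η t).1 = γ t)
    (hadj : ∀ t ∈ Icc a b, ∃ m Pr U, IsAdjointAt D m Pr U γ g η (Icc a b) t) :
    IsCharacteristic D a b η := by
  have hann : ∀ t ∈ Icc a b, η t ∈ annihilator D := by
    intro t ht
    obtain ⟨m, Pr, U, hPr, hm, hU, h0, -⟩ := hadj t ht
    rw [← hη t ht] at hm hU h0
    exact (hPr.mem_annihilator_iff hm hU).2 h0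
  have hcont : ∀ t ∈ Icc a b, ContinuousWithinAt η (Icc a b) t := by
    intro t ht
    obtain ⟨m, Pr, U, hPr, hm, hU, -, hd⟩ := hadj t ht
    have hm' : (η t).1 ∈ (chartAt E m).source := by rwa [hη t ht]
    refine continuousWithinAt_of_cotChart hm'
      ((h.continuousWithinAt ht).congr hη (hη t ht)) ?_
    have h1 := (h.hasDerivWithinAt_chart ht hm).continuousWithinAt.prodMk hd.continuousWithinAt
    exact h1.congr_of_eventuallyEq (cotChart_eventuallyEq h hη ht hm)
      (by rw [cotChart_apply hm', hη t ht])
  have hvel : ∀ t ∈ Icc a b, ∃ u : E × (E →L[ℝ] ℝ),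
      HasVelocityWithinAt (cotangentModel E) η u (Icc a b) t ∧
      u ∈ tangentVectors (cotangentModel E) (annihilator D) (η t) ∧
      ∀ ζ ∈ tangentVectors (cotangentModel E) (annihilator D) (η t),
        canonicalSymplecticForm (η t) u ζ = 0 := by
    intro t ht
    obtain ⟨m, Pr, U, hPr, hm, hU, h0, hd⟩ := hadj t ht
    have hηt := hη t ht
    have hm' : (η t).1 ∈ (chartAt E m).source := by rwa [hηt]
    have hU' : extChartAt 𝓘(ℝ, E) m (η t).1 ∈ U := by rwa [hηt]
    have hud := uniqueDiffOn_Icc hab t ht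
    have h1 := ((h.hasDerivWithinAt_chart ht hm).prodMk hd).congr_of_eventuallyEq
      (cotChart_eventuallyEq h hη ht hm) (by rw [cotChart_apply hm', hηt])
    obtain ⟨u, hu⟩ := exists_hasVelocityWithinAt_of_cotChart (hcont t ht) hm' h1
    have hdu := hud.eq_deriv _ (hu.hasDerivWithinAt_cotChart hm') h1
    have hu4 : Pr (extChartAt 𝓘(ℝ, E) m (η t).1) (dcot (zeroCovector m) (η t) u).1 =
        (dcot (zeroCovector m) (η t) u).1 := by
      rw [hdu, hηt]
      exact hPr.apply_eq (γ t) hm hU (g t) (h.mem t ht)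
    refine ⟨u, hu, ?_, ?_⟩
    -- Tangency to the annihilator is the derivative of `p (Pr(x) w) = 0` along the curve.
    · rw [hPr.mem_tangentVectors_iff hm' hU' (hann t ht), hdu, hηt]
      intro w
      have h2 : HasDerivWithinAt (fun r => Pr (extChartAt 𝓘(ℝ, E) m (γ r)))
          (fderiv ℝ Pr (extChartAt 𝓘(ℝ, E) m (γ t)) (dchart E m (γ t) (g t))) (Icc a b) t :=
        (hPr.contDiff.differentiable one_ne_zero _).hasFDerivAt.comp_hasDerivWithinAt t
          (h.hasDerivWithinAt_chart ht hm)
      have h3 := hd.clm_apply (h2.clm_apply (hasDerivWithinAt_const t (Icc a b) w))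
      simp only [map_zero, add_zero] at h3
      refine hud.eq_deriv _ h3
        ((hasDerivWithinAt_const t (Icc a b) (0 : ℝ)).congr_of_eventuallyEq ?_ ?_)
      · have h5 : ContinuousWithinAt (fun r => extChartAt 𝓘(ℝ, E) m (γ r)) (Icc a b) t :=
          (h.hasDerivWithinAt_chart ht hm).continuousWithinAt
        filter_upwards [h5 (hPr.isOpen.mem_nhds hU), self_mem_nhdsWithin,
          h.continuousWithinAt ht ((chartAt E m).open_source.mem_nhds hm)] with r hr1 hr2 hr3
        have h6 := (hPr.mem_annihilator_iff (z := η r) (by rwa [hη r hr2])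
          (by rw [hη r hr2]; exact hr1)).1 (hann r hr2)
        rw [hη r hr2] at h6
        exact DFunLike.congr_fun h6 w
      · exact DFunLike.congr_fun h0 w
    · rw [hPr.mem_ker_iff hm' hU' (hann t ht) hu4, hdu, hηt]
      intro v
      rfl
  refine ⟨?_, hann, ?_, ?_⟩
  · intro t ht
    obtain ⟨m, Pr, U, hPr, hm, hU, -, -⟩ := hadj t ht
    have hm' : (η t).1 ∈ (chartAt E m).source := by rwa [hη t ht]
    have hc5 : ContinuousWithinAt (fun r => extChartAt 𝓘(ℝ, E) m (γ r)) (Icc a b) t :=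
      (h.hasDerivWithinAt_chart ht hm).continuousWithinAt
    obtain ⟨t₀, t₁, ht01, hsub, hS, htt, hnhds⟩ := exists_Icc_mem_nhdsWithin hab ht
      (inter_mem (hc5 (hPr.isOpen.mem_nhds hU))
        (h.continuousWithinAt ht ((chartAt E m).open_source.mem_nhds hm)))
    -- The invariant condition gives back the adjoint equation in one fixed chart near `t`. There
    -- the derivative of `p` is `-p A`, which is continuous because `p` is.
    have had : ∀ r ∈ Icc t₀ t₁, IsAdjointAt D m Pr U γ g η (Icc a b) r := by
      intro r hr
      obtain ⟨u, hu1, hu2, hu3⟩ := hvel r (hsub hr)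
      exact isAdjointAt_of_mem_ker hab h hη (hsub hr) hPr (hS hr).2 (hS hr).1 hu1
        (hann r (hsub hr)) hu3
    have hx : ∀ r ∈ Icc t₀ t₁, HasDerivWithinAt (fun r => extChartAt 𝓘(ℝ, E) m (γ r))
        (dchart E m (γ r) (g r)) (Icc t₀ t₁) r := fun r hr =>
      (h.hasDerivWithinAt_chart (hsub hr) (hS hr).2).mono hsub
    have hp : ∀ r ∈ Icc t₀ t₁, HasDerivWithinAt (fun r => coordCovector m (η r))
        (-(coordCovector m (η r)).comp (linearizationAt m Pr γ g r)) (Icc t₀ t₁) r := fun r hr =>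
      (had r hr).2.2.2.2.mono hsub
    have hgc := (h.mono hsub).continuousOn_dchart ht01 (m := m) fun r hr => (hS hr).2
    have hlin : ContinuousOn (fun r => linearizationAt m Pr γ g r) (Icc t₀ t₁) := by
      have h1 : ContinuousOn (fun r => fderiv ℝ Pr (extChartAt 𝓘(ℝ, E) m (γ r))) (Icc t₀ t₁) :=
        (hPr.contDiff.continuous_fderiv one_ne_zero).comp_continuousOn
          fun r hr => (hx r hr).continuousWithinAt
      exact ((ContinuousLinearMap.flipₗᵢ ℝ E E E).continuous.comp_continuousOn h1).clm_apply hgc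
    have hpc : ContinuousOn (fun r => coordCovector m (η r)) (Icc t₀ t₁) :=
      fun r hr => (hp r hr).continuousWithinAt
    have hC : ContDiffOn ℝ 1 (fun r => (extChartAt 𝓘(ℝ, E) m (γ r), coordCovector m (η r)))
        (Icc t₀ t₁) :=
      contDiffOn_one_Icc_of_hasDerivWithinAt ht01 (fun r hr => (hx r hr).prodMk (hp r hr))
        (hgc.prodMk (hpc.clm_comp hlin).neg)
    have hC2 : ContDiffWithinAt ℝ 1 (fun r => cotChart m (η r)) (Icc a b) t :=
      ((hC t htt).mono_of_mem_nhdsWithin hnhds).congr_of_eventuallyEq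
        (cotChart_eventuallyEq h hη ht hm) (by rw [cotChart_apply hm', hη t ht])
    have hmem : η t ∈ (chartAt (ModelProd E (E →L[ℝ] ℝ)) (zeroCovector (E := E) m)).source := by
      rw [← extChartAt_source (cotangentModel E)]
      exact mem_cotChart_source.2 hm'
    refine (contMDiffWithinAt_iff_target_of_mem_source hmem).2 ⟨hcont t ht, ?_⟩
    exact hC2.contMDiffWithinAt
  · intro t ht
    obtain ⟨u, hu1, hu2, -⟩ := hvel t ht
    rw [hu1.velocity_eq hab ht]
    exact hu2
  · intro t ht ζ hζ
    obtain ⟨u, hu1, -, hu3⟩ := hvel t ht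
    rw [hu1.velocity_eq hab ht]
    exact hu3 ζ hζ

end Adjoint

/-! ### One-parameter families of curves in a fixed chart. -/

section Families

variable {E : Type*} [NormedAddCommGroup E] [NormedSpace ℝ E]
  {M : Type*} [TopologicalSpace M] [ChartedSpace E M] [IsManifold 𝓘(ℝ, E) ∞ M]

lemma exists_contDiff_transition [FiniteDimensional ℝ E] {φ : OpenPartialHomeomorph M E}
    (hφ : φ ∈ IsManifold.maximalAtlas 𝓘(ℝ, E) ∞ M) {q m : M} (hq : q ∈ φ.source)
    (hm : q ∈ (chartAt E m).source) : ∃ g : E → E, ContDiff ℝ 2 g ∧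
      g =ᶠ[𝓝 (φ q)] fun x => extChartAt 𝓘(ℝ, E) m (φ.symm x) := by
  have h1 : ContMDiffAt 𝓘(ℝ, E) 𝓘(ℝ, E) ∞ φ.symm (φ q) :=
    contMDiffAt_symm_of_mem_maximalAtlas hφ (φ.map_source hq)
  have h2 : ContMDiffAt 𝓘(ℝ, E) 𝓘(ℝ, E) ∞ (chartAt E m) (φ.symm (φ q)) := by
    rw [φ.left_inv hq]
    exact contMDiffAt_of_mem_maximalAtlas (IsManifold.chart_mem_maximalAtlas m) hm
  have h3 : ContDiffAt ℝ ∞ (fun x => extChartAt 𝓘(ℝ, E) m (φ.symm x)) (φ q) :=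
    (h2.comp (φ q) h1).contDiffAt
  exact exists_contDiff_eventuallyEq (n := 2) (contDiffAt_infty.1 h3 2)

/-- In the chart at `m`, the family `σ s` of curves on `[t₀, t₁]` is given by `X s`, with velocities
`X' s`; both are `C^1` in `s`. -/
structure IsChartFamily (m : M) (σ : ℝ → ℝ → M) (t₀ t₁ : ℝ) (X X' : ℝ → C(Icc t₀ t₁, E)) :
    Prop where
  contDiffAt : ContDiffAt ℝ 1 X 0
  contDiffAt' : ContDiffAt ℝ 1 X' 0
  eventually : ∀ᶠ s in 𝓝 (0 : ℝ), ∀ τ : Icc t₀ t₁, σ s τ ∈ (chartAt E m).source ∧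
    X s τ = extChartAt 𝓘(ℝ, E) m (σ s τ) ∧
    HasDerivWithinAt (fun r : ℝ => extChartAt 𝓘(ℝ, E) m (σ s r)) (X' s τ) (Icc t₀ t₁) τ

/-- `IsC1CurveOfCurves` supplies some chart of the atlas; this passes to the chart at `m`. The new
coordinates are `g ∘ x` and `Dg(x) x'`, and the latter is `C^1` in the parameter since the
transition map `g` is `C^2`. -/
lemma exists_isChartFamily [FiniteDimensional ℝ E] {a b t : ℝ} (hab : a < b) {σ : ℝ → ℝ → M}
    (hσ : IsC1CurveOfCurves E a b σ) (ht : t ∈ Icc a b) {m : M}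
    (hm : σ 0 t ∈ (chartAt E m).source) {S : Set ℝ} (hS : S ∈ 𝓝[Icc a b] t) :
    ∃ t₀ t₁, t₀ < t₁ ∧ Icc t₀ t₁ ⊆ Icc a b ∧ Icc t₀ t₁ ⊆ S ∧ t ∈ Icc t₀ t₁ ∧
      Icc t₀ t₁ ∈ 𝓝[Icc a b] t ∧ ∃ X X' : ℝ → C(Icc t₀ t₁, E), IsChartFamily m σ t₀ t₁ X X' := by
  obtain ⟨r₀, r₁, hrsub, hrn, φ, hφ, x, x', hx, hx', hev⟩ := hσ t ht
  have htr : t ∈ Icc r₀ r₁ := mem_of_mem_nhdsWithin ht hrn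
  have hr : r₀ ≤ r₁ := htr.1.trans htr.2
  obtain ⟨hq, hxq, -⟩ := hev.self_of_nhds ⟨t, htr⟩
  have hφ' : φ ∈ IsManifold.maximalAtlas 𝓘(ℝ, E) ∞ M := IsManifold.subset_maximalAtlas hφ
  obtain ⟨g, hg, hgeq⟩ := exists_contDiff_transition hφ' hq hm
  have hsrc : ∀ᶠ y in 𝓝 (φ (σ 0 t)), φ.symm y ∈ (chartAt E m).source := by
    refine (φ.continuousAt_symm (φ.map_source hq)).eventually_mem ?_
    rw [φ.left_inv hq]
    exact (chartAt E m).open_source.mem_nhds hm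
  obtain ⟨ε, hε, hball⟩ := Metric.eventually_nhds_iff_ball.1 (hgeq.and hsrc)
  have hx0 : Continuous fun r : ℝ => x 0 (projIcc r₀ r₁ hr r) :=
    (x 0).continuous.comp continuous_projIcc
  have hx0t : x 0 (projIcc r₀ r₁ hr t) = φ (σ 0 t) := by
    rw [projIcc_of_mem hr htr]; exact hxq
  -- Half of `ε` is spent on moving in time along the central curve, the other half on moving in the
  -- parameter. All curves then stay in the ball where `g` is the true transition map.
  have hnear : {r | dist (x 0 (projIcc r₀ r₁ hr r)) (φ (σ 0 t)) < ε / 2} ∈ 𝓝[Icc a b] t := by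
    refine mem_nhdsWithin_of_mem_nhds
      ((hx0.dist continuous_const).continuousAt.eventually_lt continuousAt_const ?_)
    rw [hx0t, dist_self]; positivity
  obtain ⟨t₀, t₁, ht01, hsub, hsubS, htt, hn⟩ :=
    exists_Icc_mem_nhdsWithin hab ht (inter_mem (inter_mem hS hrn) hnear)
  have hsubr : Icc t₀ t₁ ⊆ Icc r₀ r₁ := fun r hr => (hsubS hr).1.2
  let k : C(Icc t₀ t₁, Icc r₀ r₁) := ⟨inclusion hsubr, continuous_inclusion hsubr⟩
  have hg1 : ContDiff ℝ 1 g := hg.of_le (by norm_num)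
  have hg' : ContDiff ℝ 1 (fderiv ℝ g) := hg.fderiv_right (by norm_num)
  have hkx : ContDiffAt ℝ 1 (fun s => precompL (G := E) k (x s)) 0 :=
    (precompL (G := E) k).contDiff.contDiffAt.comp (0 : ℝ) hx
  have hkx' : ContDiffAt ℝ 1 (fun s => precompL (G := E) k (x' s)) 0 :=
    (precompL (G := E) k).contDiff.contDiffAt.comp (0 : ℝ) hx'
  refine ⟨t₀, t₁, ht01, hsub, fun r hr => (hsubS hr).1.1, htt, hn,
    fun s => postcomp g hg.continuous (precompL k (x s)),
    fun s => applyL (postcomp (fderiv ℝ g) hg'.continuous (precompL k (x s))) (precompL k (x' s)),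
    (contDiff_postcomp hg1).contDiffAt.comp (0 : ℝ) hkx, ?_, ?_⟩
  · have h1 : ContDiffAt ℝ 1
        (fun s => postcomp (fderiv ℝ g) hg'.continuous (precompL (G := E) k (x s))) 0 :=
      (contDiff_postcomp hg').contDiffAt.comp (0 : ℝ) hkx
    exact ((applyL (K := Icc t₀ t₁) (G := E) (G' := E)).contDiff.contDiffAt.comp (0 : ℝ) h1).clm_apply
      hkx'
  · have hclose : ∀ᶠ s in 𝓝 (0 : ℝ), dist (x s) (x 0) < ε / 2 :=
      hx.continuousAt.eventually (Metric.ball_mem_nhds _ (by positivity))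
    filter_upwards [hev, hclose] with s hs hs'
    have key : ∀ r (hr' : r ∈ Icc t₀ t₁), σ s r ∈ (chartAt E m).source ∧
        g (φ (σ s r)) = extChartAt 𝓘(ℝ, E) m (σ s r) ∧
        g =ᶠ[𝓝 (φ (σ s r))] fun x => extChartAt 𝓘(ℝ, E) m (φ.symm x) := by
      intro r hr'
      obtain ⟨h1, h2, -⟩ := hs ⟨r, hsubr hr'⟩
      have h3 : dist (x 0 ⟨r, hsubr hr'⟩) (φ (σ 0 t)) < ε / 2 := by
        have := (hsubS hr').2
        rwa [mem_ofPred_eq, projIcc_of_mem hr (hsubr hr')] at this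
      have h4 : φ (σ s r) ∈ Metric.ball (φ (σ 0 t)) ε := by
        rw [← h2, Metric.mem_ball]
        have h5 := (ContinuousMap.dist_apply_le_dist (f := x s) (g := x 0) ⟨r, hsubr hr'⟩)
        have h6 := dist_triangle (x s ⟨r, hsubr hr'⟩) (x 0 ⟨r, hsubr hr'⟩) (φ (σ 0 t))
        linarith
      have h7 := hball _ h4
      simp only [φ.left_inv h1] at h7
      refine ⟨h7.2, h7.1, ?_⟩
      filter_upwards [Metric.isOpen_ball.mem_nhds h4] with y hy
      exact (hball y hy).1
    rintro ⟨τ, hτ⟩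
    obtain ⟨h1, h2, h3⟩ := hs ⟨τ, hsubr hτ⟩
    obtain ⟨k1, k2, -⟩ := key τ hτ
    refine ⟨k1, ?_, ?_⟩
    · change g (x s ⟨τ, hsubr hτ⟩) = _
      rw [h2]
      exact k2
    · change HasDerivWithinAt _ (fderiv ℝ g (x s ⟨τ, hsubr hτ⟩) (x' s ⟨τ, hsubr hτ⟩)) _ _
      have h4 : HasDerivWithinAt (fun r => g (φ (σ s r)))
          (fderiv ℝ g (x s ⟨τ, hsubr hτ⟩) (x' s ⟨τ, hsubr hτ⟩)) (Icc t₀ t₁) τ := by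
        have h5 := (hg1.differentiable one_ne_zero (φ (σ s τ))).hasFDerivAt
        rw [h2]
        exact h5.comp_hasDerivWithinAt τ (h3.mono hsubr)
      exact h4.congr (fun r hr' => (key r hr').2.1.symm) k2.symm

variable {m : M} {σ : ℝ → ℝ → M} {t₀ t₁ : ℝ} {X X' : ℝ → C(Icc t₀ t₁, E)}

lemma IsChartFamily.isC1CurveOfCurves_at (h : IsChartFamily m σ t₀ t₁ X X') {a b t : ℝ}
    (hsub : Icc t₀ t₁ ⊆ Icc a b) (hn : Icc t₀ t₁ ∈ 𝓝[Icc a b] t) :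
    ∃ t₀ t₁ : ℝ, Icc t₀ t₁ ⊆ Icc a b ∧ Icc t₀ t₁ ∈ 𝓝[Icc a b] t ∧
    ∃ φ ∈ atlas E M, ∃ x x' : ℝ → C(Icc t₀ t₁, E),
      ContDiffAt ℝ 1 x 0 ∧ ContDiffAt ℝ 1 x' 0 ∧
      ∀ᶠ s in 𝓝 (0 : ℝ), ∀ τ : Icc t₀ t₁, σ s τ ∈ φ.source ∧ x s τ = φ (σ s τ) ∧
        HasDerivWithinAt (fun r : ℝ => φ (σ s r)) (x' s τ) (Icc t₀ t₁) τ :=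
  ⟨t₀, t₁, hsub, hn, chartAt E m, chart_mem_atlas E m, X, X', h.contDiffAt, h.contDiffAt',
    h.eventually⟩

lemma IsChartFamily.hasDerivAt_apply (h : IsChartFamily m σ t₀ t₁ X X') (τ : Icc t₀ t₁) :
    HasDerivAt (fun s => X s τ) (deriv X 0 τ) 0 :=
  (evalL (G := E) τ).hasFDerivAt.comp_hasDerivAt (0 : ℝ)
    (h.contDiffAt.differentiableAt one_ne_zero).hasDerivAt

lemma IsChartFamily.hasDerivAt_apply' (h : IsChartFamily m σ t₀ t₁ X X') (τ : Icc t₀ t₁) :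
    HasDerivAt (fun s => X' s τ) (deriv X' 0 τ) 0 :=
  (evalL (G := E) τ).hasFDerivAt.comp_hasDerivAt (0 : ℝ)
    (h.contDiffAt'.differentiableAt one_ne_zero).hasDerivAt

/-- The transversal curves of a family. -/
lemma IsChartFamily.hasVelocity_param (h : IsChartFamily m σ t₀ t₁ X X') (τ : Icc t₀ t₁) :
    HasVelocityWithinAt 𝓘(ℝ, E) (fun s => σ s τ) (dchartSymm m (X 0 τ) (deriv X 0 τ)) univ 0 := by
  obtain ⟨h1, h2, -⟩ := h.eventually.self_of_nhds τ
  have hd : HasDerivAt (fun s => extChartAt 𝓘(ℝ, E) m (σ s τ)) (deriv X 0 τ) 0 :=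
    (h.hasDerivAt_apply τ).congr_of_eventuallyEq (h.eventually.mono fun s hs => (hs τ).2.1.symm)
  have hc : ContinuousAt (fun s => σ s τ) 0 := by
    have h3 : ContinuousAt (fun s => (chartAt E m).symm (extChartAt 𝓘(ℝ, E) m (σ s τ))) 0 := by
      refine ContinuousAt.comp (f := fun s => extChartAt 𝓘(ℝ, E) m (σ s τ)) ?_ hd.continuousAt
      exact (chartAt E m).continuousAt_symm ((chartAt E m).map_source h1)
    refine h3.congr (h.eventually.mono fun s hs => ?_)
    exact (chartAt E m).left_inv (hs τ).1
  rw [h2]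
  exact hasVelocityWithinAt_of_chart hc.continuousWithinAt h1 hd.hasDerivWithinAt

lemma IsChartFamily.deriv_eq_dchart (h : IsChartFamily m σ t₀ t₁ X X') (τ : Icc t₀ t₁) {q : M}
    {v : TangentSpace 𝓘(ℝ, E) q} (hv : tangentMap 𝓘(ℝ, ℝ) 𝓘(ℝ, E) (fun s : ℝ => σ s τ)
      (⟨0, (1 : ℝ)⟩ : TangentBundle 𝓘(ℝ, ℝ) ℝ) = ⟨q, v⟩) :
    σ 0 τ = q ∧ deriv X 0 τ = dchart E m q v := by
  have h0 := h.hasVelocity_param τ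
  have hmd : MDifferentiableAt 𝓘(ℝ, ℝ) 𝓘(ℝ, E) (fun s : ℝ => σ s τ) 0 :=
    (hasMFDerivWithinAt_univ.1 h0).mdifferentiableAt
  obtain ⟨h1, h2⟩ := (tangentMap_eq_iff_hasVelocity hmd).1 hv
  refine ⟨h1, ?_⟩
  obtain ⟨h3, -, -⟩ := h.eventually.self_of_nhds τ
  have h4 := (hasDerivWithinAt_univ.1 (h2.hasDerivWithinAt_chart h3)).congr_of_eventuallyEq
    (h.eventually.mono fun s hs => (hs τ).2.1)
  rw [(h.hasDerivAt_apply τ).unique h4]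
  subst h1
  rfl

lemma IsChartFamily.eventually_eq_add_primitive [CompleteSpace E] (h : IsChartFamily m σ t₀ t₁ X X')
    (r : Icc t₀ t₁) : ∀ᶠ s in 𝓝 (0 : ℝ), X s = constL (X s r) + primitive r (X' s) := by
  filter_upwards [h.eventually] with s hs
  ext τ
  have h1 := eq_add_primitive r (X' s) (fun t => (hs t).2.2) τ
  rw [← (hs τ).2.1, ← (hs r).2.1] at h1
  exact h1

/-- The parameter and time derivatives commute: differentiate `X s = X s r + ∫ X' s` in `s`, where
the primitive is a bounded linear operator. -/
lemma IsChartFamily.deriv_eq_add_primitive [CompleteSpace E] (h : IsChartFamily m σ t₀ t₁ X X')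
    (r : Icc t₀ t₁) : deriv X 0 = constL (deriv X 0 r) + primitive r (deriv X' 0) := by
  have hX := (h.contDiffAt.differentiableAt one_ne_zero).hasDerivAt
  have hX' := (h.contDiffAt'.differentiableAt one_ne_zero).hasDerivAt
  have h1 : HasDerivAt (fun s => constL (K := Icc t₀ t₁) (X s r) + primitive r (X' s))
      (constL (deriv X 0 r) + primitive r (deriv X' 0)) 0 :=
    ((constL (K := Icc t₀ t₁) (G := E)).hasFDerivAt.comp_hasDerivAt (0 : ℝ)
      (h.hasDerivAt_apply r)).add
    ((primitive (G := E) r).hasFDerivAt.comp_hasDerivAt (0 : ℝ) hX')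
  exact hX.unique (h1.congr_of_eventuallyEq (h.eventually_eq_add_primitive r))

lemma IsChartFamily.hasDerivWithinAt_deriv [CompleteSpace E] (h : IsChartFamily m σ t₀ t₁ X X') {f : ℝ → E}
    (hf : ∀ τ : Icc t₀ t₁, f τ = deriv X 0 τ) (τ : Icc t₀ t₁) :
    HasDerivWithinAt f (deriv X' 0 τ) (Icc t₀ t₁) τ := by
  refine hasDerivWithinAt_primitive τ (deriv X 0 τ) (deriv X' 0) (fun t => ?_) τ
  rw [hf t]
  exact DFunLike.congr_fun (h.deriv_eq_add_primitive τ) t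

/-- The longitudinal curves of a family. -/
lemma IsChartFamily.eventually_contMDiffOn (h : IsChartFamily m σ t₀ t₁ X X') (ht : t₀ < t₁) :
    ∀ᶠ s in 𝓝 (0 : ℝ), ContMDiffOn 𝓘(ℝ, ℝ) 𝓘(ℝ, E) 1 (σ s) (Icc t₀ t₁) ∧
      ∀ τ : Icc t₀ t₁, HasVelocityWithinAt 𝓘(ℝ, E) (σ s)
        (dchartSymm m (X s τ) (X' s τ)) (Icc t₀ t₁) τ := by
  filter_upwards [h.eventually] with s hs
  have hc : ∀ τ : Icc t₀ t₁, ContinuousWithinAt (σ s) (Icc t₀ t₁) τ := by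
    intro τ
    have h3 : ContinuousWithinAt
        (fun r => (chartAt E m).symm (extChartAt 𝓘(ℝ, E) m (σ s r))) (Icc t₀ t₁) τ := by
      refine ContinuousAt.comp_continuousWithinAt (f := fun r => extChartAt 𝓘(ℝ, E) m (σ s r)) ?_
        (hs τ).2.2.continuousWithinAt
      exact (chartAt E m).continuousAt_symm ((chartAt E m).map_source (hs τ).1)
    refine h3.congr (fun r hr => ?_) ?_
    · exact ((chartAt E m).left_inv (hs ⟨r, hr⟩).1).symm
    · exact ((chartAt E m).left_inv (hs τ).1).symm
  refine ⟨fun t ht' => (contMDiffWithinAt_iff_chart (hs ⟨t, ht'⟩).1).2 ⟨hc ⟨t, ht'⟩, ?_⟩,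
    fun τ => ?_⟩
  · refine contDiffOn_one_Icc_of_hasDerivWithinAt ht
      (f' := fun r => X' s (projIcc t₀ t₁ ht.le r)) (fun r hr => ?_) ?_ t ht'
    · rw [projIcc_of_mem ht.le hr]
      exact (hs ⟨r, hr⟩).2.2
    · exact ((X' s).continuous.comp continuous_projIcc).continuousOn
  · rw [(hs τ).2.1]
    exact hasVelocityWithinAt_of_chart (hc τ) (hs τ).1 (hs τ).2.2

end Families

/-- At a maximum point of `‖f‖` the mean value inequality bounds the maximum by `(d - c) * C < 1`
times itself. The zero `r` may lie anywhere, so uniqueness holds in both time directions. -/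
lemma eq_zero_of_norm_deriv_le_of_short {G : Type*} [NormedAddCommGroup G] [NormedSpace ℝ G]
    {c d C : ℝ} {f f' : ℝ → G} (hf : ∀ t ∈ Icc c d, HasDerivWithinAt f (f' t) (Icc c d) t)
    (hC : 0 ≤ C) (hbound : ∀ t ∈ Icc c d, ‖f' t‖ ≤ C * ‖f t‖) (hshort : (d - c) * C < 1) {r : ℝ}
    (hr : r ∈ Icc c d) (h0 : f r = 0) {t : ℝ} (ht : t ∈ Icc c d) : f t = 0 := by
  obtain ⟨τ, hτ, hmax⟩ := isCompact_Icc.exists_isMaxOn ⟨r, hr⟩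
    (fun t ht => (hf t ht).continuousWithinAt.norm : ContinuousOn (fun t => ‖f t‖) (Icc c d))
  have h1 := Convex.norm_image_sub_le_of_norm_hasDerivWithin_le (C := C * ‖f τ‖) hf
    (fun t ht => (hbound t ht).trans (mul_le_mul_of_nonneg_left (hmax ht) hC)) (convex_Icc c d)
    hr hτ
  rw [h0, sub_zero] at h1
  have h2 : ‖τ - r‖ ≤ d - c := by
    rw [Real.norm_eq_abs, abs_le]
    constructor <;> linarith [hr.1, hr.2, hτ.1, hτ.2]
  have h3 : ‖f τ‖ = 0 := by
    by_contra hne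
    have hpos : 0 < ‖f τ‖ := (norm_nonneg _).lt_of_ne' hne
    have h4 : C * ‖f τ‖ * ‖τ - r‖ ≤ C * ‖f τ‖ * (d - c) :=
      mul_le_mul_of_nonneg_left h2 (by positivity)
    nlinarith
  have h5 : ‖f t‖ ≤ ‖f τ‖ := hmax ht
  rw [h3] at h5
  exact norm_le_zero_iff.1 h5

/-! ### Short intervals, and the obstruction given by a nonzero characteristic. -/

section ShortPieces

variable {E : Type*} [NormedAddCommGroup E] [NormedSpace ℝ E]
  {M : Type*} [TopologicalSpace M] [ChartedSpace E M] [IsManifold 𝓘(ℝ, E) ∞ M]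
  {D : ∀ m : M, Submodule ℝ (TangentSpace 𝓘(ℝ, E) m)} {m : M} {Pr : E → E →L[ℝ] E}
  {U : Set E} {a b c d : ℝ} {γ : ℝ → M} {g : ∀ t, TangentSpace 𝓘(ℝ, E) (γ t)}
  {η : ℝ → CotangentBundle E M}

lemma IsHorizontalWith.continuousOn_chart (h : IsHorizontalWith D c d γ g)
    (hm : ∀ t ∈ Icc c d, γ t ∈ (chartAt E m).source) :
    ContinuousOn (fun t => extChartAt 𝓘(ℝ, E) m (γ t)) (Icc c d) :=
  fun t ht => (h.hasDerivWithinAt_chart ht (hm t ht)).continuousWithinAt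

lemma IsHorizontalWith.continuousOn_linearizationAt (h : IsHorizontalWith D c d γ g) (hcd : c < d)
    (hPr : ContDiff ℝ 1 Pr) (hm : ∀ t ∈ Icc c d, γ t ∈ (chartAt E m).source) :
    ContinuousOn (fun t => linearizationAt m Pr γ g t) (Icc c d) :=
  ((ContinuousLinearMap.flipₗᵢ ℝ E E E).continuous.comp_continuousOn
    ((hPr.continuous_fderiv one_ne_zero).comp_continuousOn (h.continuousOn_chart hm))).clm_apply
    (h.continuousOn_dchart hcd hm)

/-- On `[c, d]`, the curve `γ` stays in the domain of a local projection onto `D`, and `[c, d]` is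
short for the linearized equation along `γ`. -/
structure IsShortPiece (D : ∀ m : M, Submodule ℝ (TangentSpace 𝓘(ℝ, E) m)) (m : M)
    (Pr : E → E →L[ℝ] E) (U : Set E) (c d : ℝ) (γ : ℝ → M)
    (g : ∀ t, TangentSpace 𝓘(ℝ, E) (γ t)) : Prop where
  isLocalProjection : IsLocalProjection D m Pr U
  mem_source : ∀ t ∈ Icc c d, γ t ∈ (chartAt E m).source
  mem : ∀ t ∈ Icc c d, extChartAt 𝓘(ℝ, E) m (γ t) ∈ U
  short : ∃ C, 0 ≤ C ∧ (d - c) * C < 1 ∧ ∀ t ∈ Icc c d, ‖linearizationAt m Pr γ g t‖ ≤ C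

lemma IsShortPiece.mono (h : IsShortPiece D m Pr U a b γ g) (hac : a ≤ c) (hdb : d ≤ b) :
    IsShortPiece D m Pr U c d γ g := by
  have hsub : Icc c d ⊆ Icc a b := Icc_subset_Icc hac hdb
  obtain ⟨C, hC, hlt, hle⟩ := h.short
  exact ⟨h.isLocalProjection, fun t ht => h.mem_source t (hsub ht), fun t ht => h.mem t (hsub ht),
    C, hC, (mul_le_mul_of_nonneg_right (by linarith) hC).trans_lt hlt, fun t ht => hle t (hsub ht)⟩

lemma IsHorizontalWith.exists_isShortPiece [FiniteDimensional ℝ E] {k : ℕ}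
    (hD : IsSmoothDistribution k D) (h : IsHorizontalWith D a b γ g) (hab : a < b) {t : ℝ}
    (ht : t ∈ Icc a b) : ∃ t₀ t₁ m Pr U, t₀ < t₁ ∧ Icc t₀ t₁ ⊆ Icc a b ∧ t ∈ Icc t₀ t₁ ∧
      Icc t₀ t₁ ∈ 𝓝[Icc a b] t ∧ IsShortPiece D m Pr U t₀ t₁ γ g := by
  obtain ⟨Pr, U, hPr⟩ := exists_isLocalProjection hD (γ t)
  have hsrc := mem_chart_source E (γ t)
  obtain ⟨r₀, r₁, hr, hrsub, hrS, htr, hrn⟩ := exists_Icc_mem_nhdsWithin hab ht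
    (inter_mem (h.continuousWithinAt ht ((chartAt E (γ t)).open_source.mem_nhds hsrc))
      ((h.hasDerivWithinAt_chart ht hsrc).continuousWithinAt (hPr.isOpen.mem_nhds hPr.mem)))
  obtain ⟨C, hC⟩ := isCompact_Icc.exists_bound_of_continuousOn
    ((h.mono hrsub).continuousOn_linearizationAt hr hPr.contDiff fun r hr' => (hrS hr').1)
  have hC0 : 0 ≤ C := (norm_nonneg _).trans (hC t htr)
  -- The bound `C` is fixed on a first interval. Shrinking to length at most `1 / (2 * (C + 1))`
  -- keeps it valid and makes length times `C` less than one; `C + 1` covers the case `C = 0`.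
  have hball : Metric.ball t (1 / (4 * (C + 1))) ∈ 𝓝[Icc a b] t :=
    mem_nhdsWithin_of_mem_nhds (Metric.ball_mem_nhds _ (by positivity))
  obtain ⟨t₀, t₁, ht01, hsub, hS, htt, hn⟩ :=
    exists_Icc_mem_nhdsWithin hab ht (inter_mem hrn hball)
  refine ⟨t₀, t₁, γ t, Pr, U, ht01, hsub, htt, hn, hPr, fun r hr' => (hrS (hS hr').1).1,
    fun r hr' => (hrS (hS hr').1).2, C, hC0, ?_, fun r hr' => hC r (hS hr').1⟩
  have h0 := (hS (left_mem_Icc.2 ht01.le)).2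
  have h1 := (hS (right_mem_Icc.2 ht01.le)).2
  rw [Metric.mem_ball, Real.dist_eq, abs_lt] at h0 h1
  have h2 : t₁ - t₀ ≤ 1 / (2 * (C + 1)) := by
    have : 1 / (2 * (C + 1)) = 1 / (4 * (C + 1)) + 1 / (4 * (C + 1)) := by field_simp; norm_num
    linarith
  have h3 : (t₁ - t₀) * C ≤ 1 / (2 * (C + 1)) * C := mul_le_mul_of_nonneg_right h2 hC0
  have h4 : 1 / (2 * (C + 1)) * C < 1 := by
    rw [div_mul_eq_mul_div, div_lt_one (by positivity)]
    linarith
  linarith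

lemma coordCovector_eq_zero_iff {z : CotangentBundle E M} (hz : z.1 ∈ (chartAt E m).source) :
    coordCovector m z = 0 ↔ z.2 = 0 := by
  constructor
  · intro h
    ext v
    have := coordCovector_dchart hz v
    rw [h] at this
    exact this.symm
  · intro h
    ext v
    rw [coordCovector_apply, h]
    rfl

/-- A characteristic that vanishes at one point vanishes everywhere. -/
lemma IsCharacteristic.eq_zero_iff [FiniteDimensional ℝ E] {k : ℕ} (hD : IsSmoothDistribution k D)
    (hab : a < b) (h : IsHorizontalWith D a b γ g) (hη : ∀ t ∈ Icc a b, (η t).1 = γ t)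
    (hc : IsCharacteristic D a b η) {t t' : ℝ} (ht : t ∈ Icc a b) (ht' : t' ∈ Icc a b) :
    (η t).2 = 0 ↔ (η t').2 = 0 := by
  -- By connectedness it suffices to compare nearby times, where one chart and the short-interval
  -- uniqueness apply.
  refine isPreconnected_Icc.induction₂ (fun t t' => (η t).2 = 0 ↔ (η t').2 = 0) ?_
    (fun _ _ _ _ _ _ h1 h2 => h1.trans h2) (fun _ _ _ _ h1 => h1.symm) ht ht'
  intro r hr
  obtain ⟨t₀, t₁, m, Pr, U, ht01, hsub, hrt, hn, hsp⟩ := h.exists_isShortPiece hD hab hr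
  obtain ⟨C, hC, hlt, hle⟩ := hsp.short
  have hd : ∀ t ∈ Icc t₀ t₁, HasDerivWithinAt (fun r => coordCovector m (η r))
      (-(coordCovector m (η t)).comp (linearizationAt m Pr γ g t)) (Icc t₀ t₁) t := fun t ht =>
    (hc.isAdjointAt hab h hη (hsub ht) hsp.isLocalProjection (hsp.mem_source t ht)
      (hsp.mem t ht)).2.2.2.2.mono hsub
  have hz : ∀ t ∈ Icc t₀ t₁, (coordCovector m (η t) = 0 ↔ (η t).2 = 0) := fun t ht =>
    coordCovector_eq_zero_iff (by rw [hη t (hsub ht)]; exact hsp.mem_source t ht)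
  have key : ∀ t ∈ Icc t₀ t₁, ∀ t' ∈ Icc t₀ t₁, (η t).2 = 0 → (η t').2 = 0 := by
    intro t ht t' ht' h0
    refine (hz t' ht').1 (eq_zero_of_norm_deriv_le_of_short hd hC (fun τ hτ => ?_) hlt ht
      ((hz t ht).2 h0) ht')
    rw [norm_neg, mul_comm]
    exact (ContinuousLinearMap.opNorm_comp_le _ _).trans
      (mul_le_mul_of_nonneg_left (hle τ hτ) (norm_nonneg _))
  filter_upwards [hn] with t ht
  exact ⟨key r hrt t ht, key t ht r hrt⟩

variable {P : Set M} {σ : ℝ → ℝ → M} {t₀ t₁ : ℝ} {X X' : ℝ → C(Icc t₀ t₁, E)}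

lemma IsLocalProjection.mem_iff (h : IsLocalProjection D m Pr U) {q : M}
    (hq : q ∈ (chartAt E m).source) (hU : extChartAt 𝓘(ℝ, E) m q ∈ U) (v : E) :
    dchartSymm m (extChartAt 𝓘(ℝ, E) m q) v ∈ D q ↔ Pr (extChartAt 𝓘(ℝ, E) m q) v = v := by
  constructor
  · intro hv
    have h1 := h.apply_eq q hq hU _ hv
    have h2 := dchart_dchartSymm hq v
    exact (congrArg _ h2.symm).trans (h1.trans h2)
  · intro hv
    have h1 := h.mem_distribution q hq hU v
    rw [hv] at h1
    exact h1

lemma IsChartFamily.eventually_apply_eq (h : IsChartFamily m σ t₀ t₁ X X') (ht : t₀ < t₁)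
    (hsub : Icc t₀ t₁ ⊆ Icc a b) (hσ : ∀ᶠ s in 𝓝 (0 : ℝ), σ s ∈ horizontalCurvesFrom D a b P)
    (hPr : IsLocalProjection D m Pr U) (τ : Icc t₀ t₁) (hU : X 0 τ ∈ U) :
    ∀ᶠ s in 𝓝 (0 : ℝ), Pr (X s τ) (X' s τ) = X' s τ := by
  have hXU : ∀ᶠ s in 𝓝 (0 : ℝ), X s τ ∈ U :=
    (h.hasDerivAt_apply τ).continuousAt (hPr.isOpen.mem_nhds hU)
  filter_upwards [h.eventually, hσ, hXU] with s hs hs' hsU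
  obtain ⟨h1, h2, h3⟩ := hs τ
  have h4 := isHorizontalWith_velocity hs'
  have h5 := ((h4.hasDerivWithinAt_chart (hsub τ.2) h1)).mono hsub
  have h6 := (uniqueDiffOn_Icc ht τ τ.2).eq_deriv _ h3 h5
  rw [h2] at hsU ⊢
  rw [h6]
  exact hPr.apply_eq _ h1 hsU _ (h4.mem τ (hsub τ.2))

/-- The linearized equation for a family of horizontal curves. -/
lemma IsChartFamily.linearized (h : IsChartFamily m σ t₀ t₁ X X') (ht : t₀ < t₁)
    (hsub : Icc t₀ t₁ ⊆ Icc a b) (hσ : ∀ᶠ s in 𝓝 (0 : ℝ), σ s ∈ horizontalCurvesFrom D a b P)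
    (hPr : IsLocalProjection D m Pr U) (τ : Icc t₀ t₁) (hU : X 0 τ ∈ U) :
    fderiv ℝ Pr (X 0 τ) (deriv X 0 τ) (X' 0 τ) + Pr (X 0 τ) (deriv X' 0 τ) = deriv X' 0 τ := by
  have h1 := (hPr.contDiff.differentiable one_ne_zero (X 0 τ)).hasFDerivAt.comp_hasDerivAt (0 : ℝ)
    (h.hasDerivAt_apply τ)
  have h2 := h1.clm_apply (h.hasDerivAt_apply' τ)
  exact h2.unique ((h.hasDerivAt_apply' τ).congr_of_eventuallyEq
    (h.eventually_apply_eq ht hsub hσ hPr τ hU))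

/-- The pairing of a characteristic with a tangent field is constant. -/
lemma IsCharacteristic.hasDerivWithinAt_pairing [FiniteDimensional ℝ E] {k : ℕ}
    (hD : IsSmoothDistribution k D) (hab : a < b) (h : IsHorizontalWith D a b γ g)
    (hη : ∀ t ∈ Icc a b, (η t).1 = γ t) (hc : IsCharacteristic D a b η)
    {ξ : ∀ t : ℝ, TangentSpace 𝓘(ℝ, E) (γ t)} (hξ : ξ ∈ tangentFields D a b P γ) {t : ℝ}
    (ht : t ∈ Icc a b) :
    HasDerivWithinAt (fun r => (show E →L[ℝ] ℝ from (η r).2) (ξ r)) 0 (Icc a b) t := by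
  obtain ⟨σ, hσC, hσ, hσξ⟩ := hξ
  have hσ0 : ∀ r ∈ Icc a b, σ 0 r = γ r := fun r hr =>
    congrArg Bundle.TotalSpace.proj (hσξ r hr)
  obtain ⟨Pr, U, hPr⟩ := exists_isLocalProjection hD (γ t)
  have hsrc := mem_chart_source E (γ t)
  obtain ⟨t₀, t₁, ht01, hsub, -, htt, hn, X, X', hX⟩ := exists_isChartFamily hab hσC ht
    (m := γ t) (by rw [hσ0 t ht]; exact hsrc) univ_mem
  have hX0 : ∀ r (hr : r ∈ Icc t₀ t₁), γ r ∈ (chartAt E (γ t)).source ∧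
      X 0 ⟨r, hr⟩ = extChartAt 𝓘(ℝ, E) (γ t) (γ r) ∧
      deriv X 0 ⟨r, hr⟩ = dchart E (γ t) (γ r) (ξ r) := by
    intro r hr
    obtain ⟨h1, h2, -⟩ := hX.eventually.self_of_nhds ⟨r, hr⟩
    rw [hσ0 r (hsub hr)] at h1 h2
    exact ⟨h1, h2, (hX.deriv_eq_dchart ⟨r, hr⟩ (hσξ r (hsub hr))).2⟩
  have hX'0 : X' 0 ⟨t, htt⟩ = dchart E (γ t) (γ t) (g t) := by
    obtain ⟨-, -, h3⟩ := hX.eventually.self_of_nhds ⟨t, htt⟩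
    refine (uniqueDiffOn_Icc ht01 t htt).eq_deriv _ h3 ?_
    refine ((h.hasDerivWithinAt_chart ht hsrc).mono hsub).congr (fun r hr => ?_) ?_
    · rw [hσ0 r (hsub hr)]
    · rw [hσ0 t ht]
  obtain ⟨-, -, -, hpP, hpd⟩ := hc.isAdjointAt hab h hη ht hPr hsrc hPr.mem
  have hlin := hX.linearized ht01 hsub hσ hPr ⟨t, htt⟩ (by rw [(hX0 t htt).2.1]; exact hPr.mem)
  have hξd := hX.hasDerivWithinAt_deriv (f := fun r => dchart E (γ t) (γ r) (ξ r))
    (fun τ => (hX0 τ τ.2).2.2.symm) ⟨t, htt⟩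
  have hprod := (hpd.mono hsub).clm_apply hξd
  -- The linearized equation is `ξ' = A ξ + Pr ξ'`, and `p Pr = 0`, so `p ξ'` cancels the term `-p A
  -- ξ`.
  have hzero : (-(coordCovector (γ t) (η t)).comp (linearizationAt (γ t) Pr γ g t))
      (dchart E (γ t) (γ t) (ξ t)) + coordCovector (γ t) (η t) (deriv X' 0 ⟨t, htt⟩) = 0 := by
    rw [(hX0 t htt).2.1, (hX0 t htt).2.2, hX'0] at hlin
    have h1 := congrArg (coordCovector (γ t) (η t)) hlin
    rw [map_add] at h1
    have h2 : coordCovector (γ t) (η t) (Pr (extChartAt 𝓘(ℝ, E) (γ t) (γ t))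
      (deriv X' 0 ⟨t, htt⟩)) = 0 := DFunLike.congr_fun hpP _
    rw [h2, add_zero] at h1
    rw [← h1]
    exact neg_add_cancel _
  rw [hzero] at hprod
  have heq : ∀ r ∈ Icc t₀ t₁, (show E →L[ℝ] ℝ from (η r).2) (ξ r) =
      coordCovector (γ t) (η r) (dchart E (γ t) (γ r) (ξ r)) := by
    intro r hr
    have h1 := coordCovector_dchart (m := γ t) (z := η r)
      (by rw [hη r (hsub hr)]; exact (hX0 r hr).1) (ξ r)
    rw [hη r (hsub hr)] at h1
    exact h1.symm
  exact (hprod.congr heq (heq t htt)).mono_of_mem_nhdsWithin hn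

lemma mem_tangentVectors_of_mem_tangentFields [FiniteDimensional ℝ E] (hab : a < b)
    {ξ : ∀ t : ℝ, TangentSpace 𝓘(ℝ, E) (γ t)} (hξ : ξ ∈ tangentFields D a b P γ) :
    ξ a ∈ tangentVectors 𝓘(ℝ, E) P (γ a) := by
  obtain ⟨σ, hσC, hσ, hσξ⟩ := hξ
  have ha : a ∈ Icc a b := left_mem_Icc.2 hab.le
  obtain ⟨t₀, t₁, ht01, hsub, -, htt, hn, X, X', hX⟩ := exists_isChartFamily hab hσC ha
    (mem_chart_source E (σ 0 a)) univ_mem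
  refine ⟨fun s => σ s a, ?_, hσ.mono fun s hs => hs.2.2, hσξ a ha⟩
  have h1 : ContinuousWithinAt (fun s => σ s a) univ 0 :=
    HasMFDerivWithinAt.continuousWithinAt (hX.hasVelocity_param ⟨a, htt⟩)
  refine (contMDiffWithinAt_iff_chart (c := fun s => σ s a) (s := univ) (t := 0)
    (m := σ 0 a) (mem_chart_source E (σ 0 a))).2 ⟨h1, ?_⟩
  have h2 : ContDiffAt ℝ 1 (fun s => X s ⟨a, htt⟩) 0 :=
    (evalL (K := Icc t₀ t₁) (G := E) ⟨a, htt⟩).contDiff.contDiffAt.comp (0 : ℝ) hX.contDiffAt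
  exact (h2.congr_of_eventuallyEq
    (hX.eventually.mono fun s hs => (hs ⟨a, htt⟩).2.1.symm)).contDiffWithinAt

/-- Transports the annihilation condition from the base point of the covector to the point of `γ`,
to which it is only propositionally equal. -/
lemma eq_zero_of_tangentVectors {S : Set M} {z : CotangentBundle E M} {q : M} (hz : z.1 = q) :
    (∀ v ∈ tangentVectors 𝓘(ℝ, E) S z.1, z.2 v = 0) ↔
      ∀ v : E, v ∈ tangentVectors 𝓘(ℝ, E) S q → (show E →L[ℝ] ℝ from z.2) v = 0 := by
  subst hz
  exact Iff.rfl

/-- A nonzero characteristic that annihilates the tangent spaces of `P` and `Q` at the endpoints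
prevents the endpoint map from being transverse to `Q`. -/
lemma isSingular_of_isCharacteristic [FiniteDimensional ℝ E] {k : ℕ}
    (hD : IsSmoothDistribution k D) (hab : a < b) (h : IsHorizontalWith D a b γ g)
    (hη : ∀ t ∈ Icc a b, (η t).1 = γ t) (hc : IsCharacteristic D a b η)
    (hne : ∃ t ∈ Icc a b, (η t).2 ≠ 0) {Q : Set M}
    (hP : ∀ v ∈ tangentVectors 𝓘(ℝ, E) P (η a).1, (η a).2 v = 0)
    (hQ : ∀ v ∈ tangentVectors 𝓘(ℝ, E) Q (η b).1, (η b).2 v = 0) :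
    IsSingular D a b P Q γ := by
  have ha : a ∈ Icc a b := left_mem_Icc.2 hab.le
  have hb : b ∈ Icc a b := right_mem_Icc.2 hab.le
  rw [eq_zero_of_tangentVectors (hη a ha)] at hP
  rw [eq_zero_of_tangentVectors (hη b hb)] at hQ
  intro hreg
  obtain ⟨t, ht, hne⟩ := hne
  refine hne ((hc.eq_zero_iff hD hab h hη ht hb).2 ?_)
  -- The pairing at `b` equals the pairing at `a`, where the tangent field is tangent to `P`.
  have himg : ∀ u : E, u ∈ endpointDifferentialImage D a b P γ →
      (show E →L[ℝ] ℝ from (η b).2) u = 0 := by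
    rintro u ⟨ξ, hξ, rfl⟩
    have h1 := fun t ht => hc.hasDerivWithinAt_pairing hD hab h hη hξ (t := t) ht
    have h2 := constant_of_derivWithin_zero (fun t ht => (h1 t ht).differentiableWithinAt)
      (fun t ht => (h1 t (Ico_subset_Icc_self ht)).derivWithin
        (uniqueDiffOn_Icc hab t (Ico_subset_Icc_self ht))) b hb
    exact h2.trans (hP _ (mem_tangentVectors_of_mem_tangentFields hab hξ))
  have hz : (show E →L[ℝ] ℝ from (η b).2) = 0 := by
    ext w
    obtain ⟨u, hu, v, hv, hw⟩ := hreg w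
    have hw' : w = (show E from u) + (show E from v) := hw
    rw [hw', map_add, himg u hu, hQ v hv, add_zero, zero_apply]
  exact hz

end ShortPieces

lemma Icc_left_mem_nhdsWithin {a c d t : ℝ} (h : t < c) : Icc a c ∈ 𝓝[Icc a d] t := by
  filter_upwards [self_mem_nhdsWithin, mem_nhdsWithin_of_mem_nhds (Iio_mem_nhds h)] with r h1 h2
  exact ⟨h1.1, le_of_lt h2⟩

lemma Icc_right_mem_nhdsWithin {a c d t : ℝ} (h : c < t) : Icc c d ∈ 𝓝[Icc a d] t := by
  filter_upwards [self_mem_nhdsWithin, mem_nhdsWithin_of_mem_nhds (Ioi_mem_nhds h)] with r h1 h2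
  exact ⟨le_of_lt h2, h1.2⟩

lemma hasDerivWithinAt_Icc_of_adjacent {G : Type*} [NormedAddCommGroup G] [NormedSpace ℝ G]
    {a c d : ℝ} (hac : a ≤ c) (hcd : c ≤ d) {f : ℝ → G} {f' : G} {t : ℝ}
    (h1 : t ≤ c → HasDerivWithinAt f f' (Icc a c) t)
    (h2 : c ≤ t → HasDerivWithinAt f f' (Icc c d) t) : HasDerivWithinAt f f' (Icc a d) t := by
  rcases lt_trichotomy t c with h | h | h
  · exact (h1 h.le).mono_of_mem_nhdsWithin (Icc_left_mem_nhdsWithin h)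
  · rw [← Icc_union_Icc_eq_Icc hac hcd]
    exact (h1 h.le).union (h2 h.ge)
  · exact (h2 h.le).mono_of_mem_nhdsWithin (Icc_right_mem_nhdsWithin h)

section Pieces

variable {E : Type*} [NormedAddCommGroup E] [NormedSpace ℝ E]
  {M : Type*} [TopologicalSpace M] [ChartedSpace E M] [IsManifold 𝓘(ℝ, E) ∞ M]
  {D : ∀ m : M, Submodule ℝ (TangentSpace 𝓘(ℝ, E) m)} {m : M} {Pr : E → E →L[ℝ] E}
  {U : Set E} {a b c d : ℝ} {γ : ℝ → M} {g : ∀ t, TangentSpace 𝓘(ℝ, E) (γ t)}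
  {η : ℝ → CotangentBundle E M} {P : Set M} {σ : ℝ → ℝ → M} {t₀ t₁ : ℝ}
  {X X' : ℝ → C(Icc t₀ t₁, E)}

/-! ### Horizontality at a point -/

/-- At time `t`, the curve `μ` is of class `C^1` within `s`, with velocity in `D`. -/
def IsHorizontalAt (D : ∀ m : M, Submodule ℝ (TangentSpace 𝓘(ℝ, E) m)) (μ : ℝ → M) (s : Set ℝ)
    (t : ℝ) : Prop :=
  ContMDiffWithinAt 𝓘(ℝ, ℝ) 𝓘(ℝ, E) 1 μ s t ∧
    ∃ v : TangentSpace 𝓘(ℝ, E) (μ t), HasVelocityWithinAt 𝓘(ℝ, E) μ v s t ∧ v ∈ D (μ t)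

lemma IsHorizontalAt.mono_of_mem_nhdsWithin {μ : ℝ → M} {s s' : Set ℝ} {t : ℝ}
    (h : IsHorizontalAt D μ s t) (hs : s ∈ 𝓝[s'] t) : IsHorizontalAt D μ s' t := by
  obtain ⟨h1, v, h2, h3⟩ := h
  exact ⟨h1.mono_of_mem_nhdsWithin hs, v, HasMFDerivWithinAt.mono_of_mem_nhdsWithin h2 hs, h3⟩

lemma IsHorizontalAt.congr {μ μ' : ℝ → M} {s : Set ℝ} {t : ℝ} (h : IsHorizontalAt D μ s t)
    (heq : ∀ r ∈ s, μ' r = μ r) (ht : μ' t = μ t) : IsHorizontalAt D μ' s t := by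
  obtain ⟨h1, v, h2, h3⟩ := h
  let D' : M → Submodule ℝ E := D
  have h4 : (show E from v) ∈ D' (μ' t) := by rw [ht]; exact h3
  exact ⟨h1.congr heq ht, v, HasMFDerivWithinAt.congr_of_eventuallyEq h2
    (eventually_of_mem self_mem_nhdsWithin heq) ht, h4⟩

lemma mem_horizontalCurvesFrom_iff (hab : a < b) {μ : ℝ → M} :
    μ ∈ horizontalCurvesFrom D a b P ↔
      (∀ t ∈ Icc a b, IsHorizontalAt D μ (Icc a b) t) ∧ μ a ∈ P := by
  constructor
  · intro h
    have h1 := isHorizontalWith_velocity h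
    exact ⟨fun t ht => ⟨h.1 t ht, _, h1.hasVelocity t ht, h1.mem t ht⟩, h.2.2⟩
  · rintro ⟨h1, h2⟩
    refine ⟨fun t ht => (h1 t ht).1, fun t ht => ?_, h2⟩
    obtain ⟨-, v, h3, h4⟩ := h1 t ht
    rw [h3.velocity_eq hab ht]
    exact h4

lemma IsChartFamily.eventually_isHorizontalAt (h : IsChartFamily m σ t₀ t₁ X X') (ht : t₀ < t₁)
    (hPr : IsLocalProjection D m Pr U) (hX : ∀ᶠ s in 𝓝 (0 : ℝ), ∀ τ, X s τ ∈ U ∧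
      Pr (X s τ) (X' s τ) = X' s τ) :
    ∀ᶠ s in 𝓝 (0 : ℝ), ∀ t ∈ Icc t₀ t₁, IsHorizontalAt D (σ s) (Icc t₀ t₁) t := by
  filter_upwards [h.eventually_contMDiffOn ht, hX, h.eventually] with s hs hs' hs'' t ht
  obtain ⟨h1, h2, -⟩ := hs'' ⟨t, ht⟩
  obtain ⟨h3, h4⟩ := hs' ⟨t, ht⟩
  refine ⟨hs.1 t ht, _, hs.2 ⟨t, ht⟩, ?_⟩
  rw [h2] at h3 h4 ⊢
  exact (hPr.mem_iff h1 h3 _).2 h4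

/-! ### Gluing families -/

/-- Agreement of the velocities at `c` is what makes the joined curves `C^1` in time. Positions
agree in `M` because the chart is injective on its source. -/
lemma IsChartFamily.glue {σ₁ σ₂ : ℝ → ℝ → M} (hac : a ≤ c) (hcd : c ≤ d)
    {X₁ X₁' : ℝ → C(Icc a c, E)} {X₂ X₂' : ℝ → C(Icc c d, E)}
    (h₁ : IsChartFamily m σ₁ a c X₁ X₁') (h₂ : IsChartFamily m σ₂ c d X₂ X₂')
    (h : ∀ᶠ s in 𝓝 (0 : ℝ), X₂ s ⟨c, left_mem_Icc.2 hcd⟩ = X₁ s ⟨c, right_mem_Icc.2 hac⟩ ∧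
      X₂' s ⟨c, left_mem_Icc.2 hcd⟩ = X₁' s ⟨c, right_mem_Icc.2 hac⟩) :
    IsChartFamily m (fun s t => if t ≤ c then σ₁ s t else σ₂ s t) a d
      (fun s => glueL hac hcd (X₁ s, X₂ s)) (fun s => glueL hac hcd (X₁' s, X₂' s)) where
  contDiffAt := (glueL (G := E) hac hcd).contDiff.contDiffAt.comp (0 : ℝ)
    (h₁.contDiffAt.prodMk h₂.contDiffAt)
  contDiffAt' := (glueL (G := E) hac hcd).contDiff.contDiffAt.comp (0 : ℝ)
    (h₁.contDiffAt'.prodMk h₂.contDiffAt')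
  eventually := by
    filter_upwards [h, h₁.eventually, h₂.eventually] with s hs hs₁ hs₂
    have hc : σ₁ s c = σ₂ s c := by
      obtain ⟨k1, k2, -⟩ := hs₁ ⟨c, right_mem_Icc.2 hac⟩
      obtain ⟨k3, k4, -⟩ := hs₂ ⟨c, left_mem_Icc.2 hcd⟩
      refine (chartAt E m).injOn k1 k3 ?_
      exact k2.symm.trans (hs.1.symm.trans k4)
    have hl : ∀ r ∈ Icc a c, (if r ≤ c then σ₁ s r else σ₂ s r) = σ₁ s r := fun r hr =>
      if_pos hr.2
    have hr : ∀ r ∈ Icc c d, (if r ≤ c then σ₁ s r else σ₂ s r) = σ₂ s r := by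
      intro r hr
      rcases hr.1.eq_or_lt with h | h
      · rw [← h, if_pos le_rfl, hc]
      · exact if_neg h.not_ge
    rintro ⟨t, ht⟩
    refine ⟨?_, ?_, hasDerivWithinAt_Icc_of_adjacent hac hcd (fun htc => ?_) (fun htc => ?_)⟩
    · rcases le_total t c with htc | htc
      · rw [hl t ⟨ht.1, htc⟩]
        exact (hs₁ ⟨t, ht.1, htc⟩).1
      · rw [hr t ⟨htc, ht.2⟩]
        exact (hs₂ ⟨t, htc, ht.2⟩).1
    · rcases le_total t c with htc | htc
      · rw [hl t ⟨ht.1, htc⟩, glueL_left hac hcd _ _ hs.1.symm ⟨t, ht⟩ htc]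
        exact (hs₁ ⟨t, ht.1, htc⟩).2.1
      · rw [hr t ⟨htc, ht.2⟩, glueL_right hac hcd _ _ ⟨t, ht⟩ htc]
        exact (hs₂ ⟨t, htc, ht.2⟩).2.1
    · rw [glueL_left hac hcd _ _ hs.2.symm ⟨t, ht⟩ htc]
      exact (hs₁ ⟨t, ht.1, htc⟩).2.2.congr (fun r hr' => by rw [hl r hr'])
        (by rw [hl t ⟨ht.1, htc⟩])
    · rw [glueL_right hac hcd _ _ ⟨t, ht⟩ htc]
      exact (hs₂ ⟨t, htc, ht.2⟩).2.2.congr (fun r hr' => by rw [hr r hr'])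
        (by rw [hr t ⟨htc, ht.2⟩])

/-! ### Variations on short pieces -/

/-- `exists_variations_of_short` carried to the manifold: subspaces are moved by the differentials
of the chart at `γ c` and `γ d`, and families by its inverse. -/
lemma IsShortPiece.exists_variations [FiniteDimensional ℝ E] (hcd : c < d)
    (hsp : IsShortPiece D m Pr U c d γ g) (h : IsHorizontalWith D c d γ g) (W : Submodule ℝ E) :
    ∃ W' : Submodule ℝ E,
      (∀ l : E →L[ℝ] ℝ, (∀ z ∈ W', l z = 0) → ∃ η : ℝ → CotangentBundle E M,
        (∀ t, (η t).1 = γ t) ∧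
        (∀ t ∈ Icc c d, IsAdjointAt D m Pr U γ g η (Icc c d) t) ∧
        (show E →L[ℝ] ℝ from (η d).2) = l ∧ ∀ z ∈ W, (show E →L[ℝ] ℝ from (η c).2) z = 0) ∧
      ∀ z ∈ W', ∃ z₀ ∈ W, ∀ y v : ℝ → E, ContDiffAt ℝ 1 y 0 → ContDiffAt ℝ 1 v 0 →
        y 0 = extChartAt 𝓘(ℝ, E) m (γ c) → v 0 = dchart E m (γ c) (g c) →
        deriv y 0 = dchart E m (γ c) z₀ → (∀ᶠ s in 𝓝 (0 : ℝ), Pr (y s) (v s) = v s) →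
        ∃ (σ : ℝ → ℝ → M) (X X' : ℝ → C(Icc c d, E)), IsChartFamily m σ c d X X' ∧
          (∀ t ∈ Icc c d, σ 0 t = γ t) ∧
          deriv X 0 ⟨d, right_mem_Icc.2 hcd.le⟩ = dchart E m (γ d) z ∧
          ∀ᶠ s in 𝓝 (0 : ℝ), X s ⟨c, left_mem_Icc.2 hcd.le⟩ = y s ∧
            X' s ⟨c, left_mem_Icc.2 hcd.le⟩ = v s ∧
            ∀ τ, X s τ ∈ U ∧ Pr (X s τ) (X' s τ) = X' s τ := by
  have hPr := hsp.isLocalProjection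
  have hc : c ∈ Icc c d := left_mem_Icc.2 hcd.le
  have hd : d ∈ Icc c d := right_mem_Icc.2 hcd.le
  let x : C(Icc c d, E) := ⟨fun t => extChartAt 𝓘(ℝ, E) m (γ t),
    (h.continuousOn_chart hsp.mem_source).domRestrict⟩
  let u : C(Icc c d, E) := ⟨fun t => dchart E m (γ t) (g t),
    (h.continuousOn_dchart hcd hsp.mem_source).domRestrict⟩
  have hx : x = constL (x ⟨c, hc⟩) + primitive ⟨c, hc⟩ u := by
    ext t
    exact eq_add_primitive (⟨c, hc⟩ : Icc c d) u (g := fun t => extChartAt 𝓘(ℝ, E) m (γ t))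
      (fun t => h.hasDerivWithinAt_chart t.2 (hsp.mem_source t t.2)) t
  have hxu : ∀ t, Pr (x t) (u t) = u t := fun t =>
    hPr.apply_eq (γ t) (hsp.mem_source t t.2) (hsp.mem t t.2) (g t) (h.mem t t.2)
  obtain ⟨C, hC, hlt, hle⟩ := hsp.short
  have hsmall : (d - c) * ‖linearization Pr hPr.contDiff x u‖ < 1 := by
    refine (mul_le_mul_of_nonneg_left ?_ (by linarith)).trans_lt hlt
    exact (ContinuousMap.norm_le _ hC).2 fun t => hle t t.2
  obtain ⟨W', hW1, hW2⟩ := exists_variations_of_short hcd Pr hPr.contDiff x u ⟨c, hc⟩ ⟨d, hd⟩ rfl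
    rfl hx hxu hsmall (W.map (dchart E m (γ c)).toLinearMap)
  refine ⟨W'.comap (dchart E m (γ d)).toLinearMap, ?_, ?_⟩
  · intro l hl
    obtain ⟨p, p', hp, hp', hpP, hpW⟩ :=
      hW1 (l.comp (dchartSymm m (extChartAt 𝓘(ℝ, E) m (γ d)))) (fun z hz => by
        refine hl _ ?_
        change dchart E m (γ d) (dchartSymm m _ z) ∈ W'
        rw [dchart_dchartSymm (hsp.mem_source d hd)]
        exact hz)
    let η : ℝ → CotangentBundle E M := fun t =>
      ⟨γ t, ContinuousLinearMap.comp (p (projIcc c d hcd.le t)) (dchart E m (γ t))⟩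
    have hη : ∀ t (ht : t ∈ Icc c d), (show E →L[ℝ] ℝ from (η t).2) =
        (p ⟨t, ht⟩).comp (dchart E m (γ t)) := by
      intro t ht
      change (p (projIcc c d hcd.le t)).comp (dchart E m (γ t)) = _
      rw [projIcc_of_mem hcd.le ht]
    have hco : ∀ t (ht : t ∈ Icc c d), coordCovector m (η t) = p ⟨t, ht⟩ := by
      intro t ht
      ext v
      change (show E →L[ℝ] ℝ from (η t).2) (dchartSymm m (extChartAt 𝓘(ℝ, E) m (γ t)) v) = _
      rw [hη t ht, ContinuousLinearMap.comp_apply, dchart_dchartSymm (hsp.mem_source t ht)]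
    refine ⟨η, fun _ => rfl, fun t ht => ⟨hPr, hsp.mem_source t ht, hsp.mem t ht, ?_, ?_⟩, ?_, ?_⟩
    · rw [hco t ht]
      exact hpP ⟨t, ht⟩
    · have h1 := hasDerivWithinAt_primitive (⟨d, hd⟩ : Icc c d)
        (l.comp (dchartSymm m (extChartAt 𝓘(ℝ, E) m (γ d)))) p'
        (g := fun r => coordCovector m (η r)) (fun τ => by
          rw [hco τ τ.2]
          exact DFunLike.congr_fun hp τ) ⟨t, ht⟩
      rw [hp'] at h1
      rw [hco t ht]
      exact h1
    · rw [hη d hd]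
      have h1 : p ⟨d, hd⟩ = l.comp (dchartSymm m (extChartAt 𝓘(ℝ, E) m (γ d))) := by
        rw [hp, ContinuousMap.add_apply, primitive_self, add_zero, constL_apply]
      rw [h1]
      ext v
      exact congrArg l (dchartSymm_dchart (hsp.mem_source d hd) v)
    · intro z hz
      rw [hη c hc]
      exact hpW _ (Submodule.mem_map_of_mem hz)
  · intro z hz
    obtain ⟨_, ⟨z₀, hz₀, rfl⟩, hfam⟩ := hW2 _ hz
    refine ⟨z₀, hz₀, fun y v hy hv hy0 hv0 hdy hyv => ?_⟩
    obtain ⟨X, X', hX, hX', hX0, hdX, hev⟩ := hfam y v hy hv hy0 hv0 hdy hyv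
    -- Maps of a compact interval into an open set form an open set, so one neighbourhood of `0`
    -- serves all times.
    have hU : ∀ᶠ s in 𝓝 (0 : ℝ), ∀ τ, X s τ ∈ U := by
      have h0 : MapsTo (X 0) univ U := by
        rw [hX0]
        exact fun t _ => hsp.mem t t.2
      have h1 : ∀ᶠ f : C(Icc c d, E) in 𝓝 (X 0), MapsTo f univ U :=
        (ContinuousMap.isOpen_setOfPred_mapsTo isCompact_univ hPr.isOpen).mem_nhds h0
      filter_upwards [hX.continuousAt.eventually h1] with s hs τ
      exact hs (mem_univ τ)
    refine ⟨fun s t => (extChartAt 𝓘(ℝ, E) m).symm (X s (projIcc c d hcd.le t)), X, X',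
      ⟨hX, hX', ?_⟩, ?_, hdX, ?_⟩
    · filter_upwards [hev, hU] with s hs hsU
      have hsrc : ∀ τ, (extChartAt 𝓘(ℝ, E) m).symm (X s τ) ∈ (chartAt E m).source := by
        intro τ
        rw [← extChartAt_source 𝓘(ℝ, E)]
        exact (extChartAt 𝓘(ℝ, E) m).map_target (hPr.subset (hsU τ))
      have hinv : ∀ τ, extChartAt 𝓘(ℝ, E) m ((extChartAt 𝓘(ℝ, E) m).symm (X s τ)) = X s τ :=
        fun τ => (extChartAt 𝓘(ℝ, E) m).right_inv (hPr.subset (hsU τ))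
      intro τ
      rw [projIcc_val]
      refine ⟨hsrc τ, (hinv τ).symm, ?_⟩
      refine hasDerivWithinAt_primitive (⟨c, hc⟩ : Icc c d) (y s) (X' s) (fun t => ?_) τ
      rw [projIcc_val, hinv]
      exact DFunLike.congr_fun hs.1 t
    · intro t ht
      change (extChartAt 𝓘(ℝ, E) m).symm (X 0 (projIcc c d hcd.le t)) = γ t
      rw [hX0, projIcc_of_mem hcd.le ht]
      exact (chartAt E m).left_inv (hsp.mem_source t ht)
    · filter_upwards [hev, hU] with s hs hsU
      obtain ⟨h1, h2, V, hV⟩ := hs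
      -- Inside `U` the field `Pr` is idempotent, so velocities of the form `Pr (X s τ) (V τ)` are
      -- fixed by it, hence horizontal.
      refine ⟨?_, h2, fun τ => ⟨hsU τ, ?_⟩⟩
      · rw [h1, ContinuousMap.add_apply, primitive_self, add_zero, constL_apply]
      · rw [hV τ]
        exact DFunLike.congr_fun (hPr.idempotent (hsU τ)) (V τ)

lemma mem_endpointDifferentialImage (hab : a < b) (hσ : IsC1CurveOfCurves E a b σ)
    (hσh : ∀ᶠ s in 𝓝 (0 : ℝ), σ s ∈ horizontalCurvesFrom D a b P)
    (hσ0 : ∀ t ∈ Icc a b, σ 0 t = γ t) {X X' : ℝ → C(Icc t₀ b, E)} (ht₀ : t₀ ≤ b)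
    (hX : IsChartFamily m σ t₀ b X X') {z : E}
    (hz : deriv X 0 ⟨b, right_mem_Icc.2 ht₀⟩ = dchart E m (γ b) z) :
    z ∈ endpointDifferentialImage D a b P γ := by
  have hb : b ∈ Icc a b := right_mem_Icc.2 hab.le
  let ξ : ∀ t : ℝ, TangentSpace 𝓘(ℝ, E) (γ t) := fun t =>
    (show E from mfderiv 𝓘(ℝ, ℝ) 𝓘(ℝ, E) (fun s => σ s t) 0 (1 : ℝ))
  have hξ : ∀ t ∈ Icc a b, tangentMap 𝓘(ℝ, ℝ) 𝓘(ℝ, E) (fun s : ℝ => σ s t)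
      (⟨0, (1 : ℝ)⟩ : TangentBundle 𝓘(ℝ, ℝ) ℝ) = ⟨γ t, ξ t⟩ := fun t ht =>
    tangentMap_eq_iff.2 ⟨hσ0 t ht, rfl⟩
  refine ⟨ξ, ⟨σ, hσ, hσh, hξ⟩, ?_⟩
  have h1 := (hX.deriv_eq_dchart ⟨b, right_mem_Icc.2 ht₀⟩ (hξ b hb)).2
  rw [hz] at h1
  have hsrc : γ b ∈ (chartAt E m).source := by
    have := (hX.eventually.self_of_nhds ⟨b, right_mem_Icc.2 ht₀⟩).1
    rwa [hσ0 b hb] at this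
  have h2 := congrArg (dchartSymm m (extChartAt 𝓘(ℝ, E) m (γ b))) h1
  rw [dchartSymm_dchart hsrc] at h2
  exact (h2.trans (dchartSymm_dchart hsrc (ξ b))).symm

end Pieces

section Endpoint

variable {E : Type*} [NormedAddCommGroup E] [NormedSpace ℝ E] [FiniteDimensional ℝ E]
  {M : Type*} [TopologicalSpace M] [ChartedSpace E M] [IsManifold 𝓘(ℝ, E) ∞ M]
  {D : ∀ m : M, Submodule ℝ (TangentSpace 𝓘(ℝ, E) m)} {m : M} {Pr : E → E →L[ℝ] E}
  {U : Set E} {a b c d : ℝ} {γ : ℝ → M} {g : ∀ t, TangentSpace 𝓘(ℝ, E) (γ t)}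
  {P : Set M}

/-! ### Tangent spaces of embedded submanifolds -/

lemma mem_of_hasDerivAt {V : Submodule ℝ E} {f : ℝ → E} {f' : E} {t : ℝ} (hf : HasDerivAt f f' t)
    (hV : ∀ᶠ s in 𝓝 t, f s ∈ V) : f' ∈ V := by
  by_contra hne
  obtain ⟨l, hl, hlV⟩ := exists_dual_ne_zero_of_notMem V hne
  have h1 := l.hasFDerivAt.comp_hasDerivAt t hf
  have h2 : HasDerivAt (l ∘ f) 0 t := (hasDerivAt_const t (0 : ℝ)).congr_of_eventuallyEq
    (hV.mono fun s hs => hlV _ hs)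
  exact hl (h1.unique h2)

/-- The tangent space is the preimage of `V` under the differential of the slice chart. Straight
lines in `V` give the curves for one inclusion, and closedness of `V` gives the other. -/
lemma IsEmbeddedSubmanifold.exists_submodule (hP : IsEmbeddedSubmanifold (E := E) P) {p : M}
    (hp : p ∈ P) : ∃ W : Submodule ℝ E, ∀ v : E, v ∈ W ↔ v ∈ tangentVectors 𝓘(ℝ, E) P p := by
  obtain ⟨φ, hφ, hpφ, V, hV⟩ := hP p hp
  have hmd : φ.MDifferentiable 𝓘(ℝ, E) 𝓘(ℝ, E) :=
    ⟨(contMDiffOn_of_mem_maximalAtlas hφ).mdifferentiableOn (by simp),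
      (contMDiffOn_symm_of_mem_maximalAtlas hφ).mdifferentiableOn (by simp)⟩
  let dφ : E →L[ℝ] E := mfderiv 𝓘(ℝ, E) 𝓘(ℝ, E) φ p
  refine ⟨V.comap dφ.toLinearMap, fun v => ⟨fun hv => ?_, ?_⟩⟩
  · have hv' : dφ v ∈ V := hv
    let ℓ : ℝ → E := fun s => φ p + s • dφ v
    have hℓ0 : ℓ 0 = φ p := by simp [ℓ]
    have hℓ : ContDiff ℝ ∞ ℓ := by fun_prop
    have hℓd : HasDerivAt ℓ (dφ v) 0 := by
      simpa [ℓ] using ((hasDerivAt_id (0 : ℝ)).smul_const (dφ v)).const_add (φ p)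
    have hℓt : ∀ᶠ s in 𝓝 (0 : ℝ), ℓ s ∈ φ.target := by
      refine hℓ.continuous.continuousAt.eventually_mem (φ.open_target.mem_nhds ?_)
      rw [hℓ0]
      exact φ.map_source hpφ
    have hφp : φ p ∈ φ.target := φ.map_source hpφ
    have hsm : ContMDiffAt 𝓘(ℝ, E) 𝓘(ℝ, E) ∞ φ.symm (ℓ 0) := by
      rw [hℓ0]
      exact contMDiffAt_symm_of_mem_maximalAtlas hφ hφp
    have hC : ContMDiffAt 𝓘(ℝ, ℝ) 𝓘(ℝ, E) 1 (fun s => φ.symm (ℓ s)) 0 :=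
      (hsm.comp (0 : ℝ) hℓ.contMDiff.contMDiffAt).of_le (by simp)
    refine ⟨fun s => φ.symm (ℓ s), hC, ?_, ?_⟩
    · filter_upwards [hℓt] with s hs
      rw [hV _ (φ.map_target hs), φ.right_inv hs]
      exact V.add_mem ((hV p hpφ).1 hp) (V.smul_mem s hv')
    · refine (tangentMap_eq_iff_hasVelocity (hC.mdifferentiableAt one_ne_zero)).2 ⟨?_, ?_⟩
      · rw [hℓ0]
        exact φ.left_inv hpφ
      · have h1 := (hsm.mdifferentiableAt (by simp)).hasMFDerivAt
        have h2 : HasMFDerivWithinAt 𝓘(ℝ, ℝ) 𝓘(ℝ, E) ℓ univ 0 (lineL (G := E) (dφ v)) :=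
          hℓd.hasDerivWithinAt.hasFDerivWithinAt.hasMFDerivWithinAt
        have h3 := h1.comp_hasMFDerivWithinAt (0 : ℝ) h2
        have h4 : (show E →L[ℝ] E from mfderiv 𝓘(ℝ, E) 𝓘(ℝ, E) φ.symm (ℓ 0)).comp
            (lineL (G := E) (dφ v)) = lineL (G := E) v := by
          rw [hℓ0]
          have h5 := DFunLike.congr_fun (hmd.symm_comp_deriv hpφ) v
          ext
          change (show E →L[ℝ] E from mfderiv 𝓘(ℝ, E) 𝓘(ℝ, E) φ.symm (φ p))
            ((1 : ℝ) • dφ v) = (1 : ℝ) • v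
          rw [one_smul, one_smul]
          exact h5
        unfold HasVelocityWithinAt
        rw [← h4]
        exact h3
  · rintro ⟨c, hc, hcP, hcv⟩
    obtain ⟨hc0, hvel⟩ := (tangentMap_eq_iff_hasVelocity (hc.mdifferentiableAt one_ne_zero)).1 hcv
    subst hc0
    have h1 := (hmd.mdifferentiableAt hpφ).hasMFDerivAt
    have h2 := h1.comp_hasMFDerivWithinAt (0 : ℝ) hvel
    have h3 : HasFDerivWithinAt (φ ∘ c) (dφ.comp (lineL (G := E) v)) univ 0 := h2.hasFDerivWithinAt
    have h4 : HasDerivAt (φ ∘ c) (dφ v) 0 := by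
      simpa using h3.hasDerivWithinAt
    change dφ v ∈ V
    refine mem_of_hasDerivAt h4 ?_
    filter_upwards [hcP, hc.continuousAt.eventually_mem (φ.open_source.mem_nhds hpφ)] with s hs hs'
    exact (hV _ hs').1 hs

/-! ### Covectors annihilating the image of the endpoint differential -/

/-- Some subspace `W` of the image of the endpoint differential on `[a, τ]` is large enough for every
covector annihilating `W` to be the final value of a characteristic over `γ` that annihilates the
tangent space of `P` at time `a`. -/
def IsEndpointCovered (D : ∀ m : M, Submodule ℝ (TangentSpace 𝓘(ℝ, E) m)) (P : Set M) (γ : ℝ → M)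
    (a τ : ℝ) : Prop :=
  ∃ W : Submodule ℝ E, (∀ z ∈ W, z ∈ endpointDifferentialImage D a τ P γ) ∧
    ∀ l : E →L[ℝ] ℝ, (∀ z ∈ W, l z = 0) → ∃ η : ℝ → CotangentBundle E M,
      IsCharacteristic D a τ η ∧ (∀ t ∈ Icc a τ, (η t).1 = γ t) ∧
      (show E →L[ℝ] ℝ from (η τ).2) = l ∧
      ∀ v : E, v ∈ tangentVectors 𝓘(ℝ, E) P (γ a) → (show E →L[ℝ] ℝ from (η a).2) v = 0

/-- The start of the induction: the directions available at time `a` are those tangent to `P`. -/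
lemma IsShortPiece.isEndpointCovered (had : a < d) (hsp : IsShortPiece D m Pr U a d γ g)
    (h : IsHorizontalWith D a d γ g) (hP : IsEmbeddedSubmanifold (E := E) P) (hγ : γ a ∈ P) :
    IsEndpointCovered D P γ a d := by
  have ha : a ∈ Icc a d := left_mem_Icc.2 had.le
  have hPr := hsp.isLocalProjection
  have hsrc := hsp.mem_source a ha
  obtain ⟨W, hW⟩ := hP.exists_submodule hγ
  obtain ⟨W', hW1, hW2⟩ := hsp.exists_variations had h W
  refine ⟨W', fun z hz => ?_, fun l hl => ?_⟩
  · obtain ⟨z₀, hz₀, hfam⟩ := hW2 z hz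
    obtain ⟨c, hc, hcP, hcv⟩ := (hW z₀).1 hz₀
    obtain ⟨hc0, hvel⟩ := (tangentMap_eq_iff_hasVelocity (hc.mdifferentiableAt one_ne_zero)).1 hcv
    have hc0src : c 0 ∈ (chartAt E m).source := by rw [hc0]; exact hsrc
    let y : ℝ → E := fun s => extChartAt 𝓘(ℝ, E) m (c s)
    have hy : ContDiffAt ℝ 1 y 0 :=
      ((contMDiffWithinAt_iff_chart (s := univ) hc0src).1 hc).2
    have hy0 : y 0 = extChartAt 𝓘(ℝ, E) m (γ a) := congrArg _ hc0
    have hyd : deriv y 0 = dchart E m (γ a) z₀ := by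
      have h1 := (hasDerivWithinAt_univ.1 (hvel.hasDerivWithinAt_chart hc0src)).deriv
      rw [← hc0]
      exact h1
    -- No earlier piece prescribes the initial velocities, so the velocity of `γ` is projected onto
    -- the distribution at the moving initial point.
    let v : ℝ → E := fun s => Pr (y s) (dchart E m (γ a) (g a))
    have hv : ContDiffAt ℝ 1 v 0 :=
      ((hPr.contDiff.contDiffAt).comp (0 : ℝ) hy).clm_apply contDiffAt_const
    have hv0 : v 0 = dchart E m (γ a) (g a) := by
      change Pr (y 0) (dchart E m (γ a) (g a)) = _
      rw [hy0]
      exact hPr.apply_eq (γ a) hsrc (hsp.mem a ha) (g a) (h.mem a ha)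
    have hyU : ∀ᶠ s in 𝓝 (0 : ℝ), y s ∈ U := by
      refine hy.continuousAt.eventually_mem (hPr.isOpen.mem_nhds ?_)
      rw [hy0]
      exact hsp.mem a ha
    obtain ⟨σ, X, X', hX, hσ0, hXz, hev⟩ := hfam y v hy hv hy0 hv0 hyd (by
      filter_upwards [hyU] with s hs
      exact DFunLike.congr_fun (hPr.idempotent hs) _)
    refine mem_endpointDifferentialImage had (fun t ht => hX.isC1CurveOfCurves_at subset_rfl
      self_mem_nhdsWithin) ?_ hσ0 had.le hX hXz
    filter_upwards [hX.eventually_isHorizontalAt had hPr (hev.mono fun s hs => hs.2.2), hev, hcP,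
      hX.eventually, hc.continuousAt.eventually_mem ((chartAt E m).open_source.mem_nhds hc0src)]
      with s h1 h2 h3 h4 h5
    refine (mem_horizontalCurvesFrom_iff had).2 ⟨h1, ?_⟩
    obtain ⟨k1, k2, -⟩ := h4 ⟨a, ha⟩
    have h6 : σ s a = c s := (chartAt E m).injOn k1 h5 (k2.symm.trans h2.1)
    rw [h6]
    exact h3
  · obtain ⟨η, hη, hadj, hηd, hηa⟩ := hW1 l hl
    exact ⟨η, isCharacteristic_of_isAdjointAt had h (fun t _ => hη t)
      (fun t ht => ⟨m, Pr, U, hadj t ht⟩), fun t _ => hη t, hηd, fun v hv => hηa v ((hW v).2 hv)⟩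

lemma IsAdjointAt.congr {η η' : ℝ → CotangentBundle E M} {s : Set ℝ} {t : ℝ}
    (h : IsAdjointAt D m Pr U γ g η s t) (heq : ∀ r ∈ s, η' r = η r) (ht : η' t = η t) :
    IsAdjointAt D m Pr U γ g η' s t := by
  obtain ⟨h1, h2, h3, h4, h5⟩ := h
  refine ⟨h1, h2, h3, by rwa [ht], ?_⟩
  rw [ht]
  exact h5.congr (fun r hr => by rw [heq r hr]) (by rw [ht])

lemma IsAdjointAt.mono_of_mem_nhdsWithin {η : ℝ → CotangentBundle E M} {s s' : Set ℝ} {t : ℝ}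
    (h : IsAdjointAt D m Pr U γ g η s t) (hs : s ∈ 𝓝[s'] t) :
    IsAdjointAt D m Pr U γ g η s' t :=
  ⟨h.1, h.2.1, h.2.2.1, h.2.2.2.1, h.2.2.2.2.mono_of_mem_nhdsWithin hs⟩

/-- At `c` both one-sided derivatives are given by the same adjoint equation in the same chart with
the same covector, so they agree. -/
lemma IsCharacteristic.glue {k : ℕ} (hD : IsSmoothDistribution k D) (hac : a < c) (hcd : c < d)
    (h : IsHorizontalWith D a d γ g) (hsp : IsShortPiece D m Pr U c d γ g)
    {η₁ η₂ : ℝ → CotangentBundle E M} (h₁ : IsCharacteristic D a c η₁)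
    (hη₁ : ∀ t ∈ Icc a c, (η₁ t).1 = γ t) (hη₂ : ∀ t, (η₂ t).1 = γ t)
    (h₂ : ∀ t ∈ Icc c d, IsAdjointAt D m Pr U γ g η₂ (Icc c d) t) (hc : η₁ c = η₂ c) :
    IsCharacteristic D a d (fun t => if t ≤ c then η₁ t else η₂ t) := by
  have hl : ∀ r ∈ Icc a c, (if r ≤ c then η₁ r else η₂ r) = η₁ r := fun r hr => if_pos hr.2
  have hr : ∀ r ∈ Icc c d, (if r ≤ c then η₁ r else η₂ r) = η₂ r := by
    intro r hr
    rcases hr.1.eq_or_lt with h | h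
    · rw [← h, if_pos le_rfl, hc]
    · exact if_neg h.not_ge
  have hsub : Icc a c ⊆ Icc a d := Icc_subset_Icc_right hcd.le
  refine isCharacteristic_of_isAdjointAt (hac.trans hcd) h (fun t ht => ?_) fun t ht => ?_
  · rcases le_total t c with htc | htc
    · rw [hl t ⟨ht.1, htc⟩]
      exact hη₁ t ⟨ht.1, htc⟩
    · rw [hr t ⟨htc, ht.2⟩]
      exact hη₂ t
  · rcases lt_trichotomy t c with htc | htc | htc
    · obtain ⟨Pr', U', hPr'⟩ := exists_isLocalProjection hD (γ t)
      have ht' : t ∈ Icc a c := ⟨ht.1, htc.le⟩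
      exact ⟨γ t, Pr', U', ((h₁.isAdjointAt hac (h.mono hsub) hη₁ ht' hPr' (mem_chart_source E _)
        hPr'.mem).congr hl (hl t ht')).mono_of_mem_nhdsWithin (Icc_left_mem_nhdsWithin htc)⟩
    · subst htc
      have ht1 : t ∈ Icc a t := right_mem_Icc.2 hac.le
      have ht2 : t ∈ Icc t d := left_mem_Icc.2 hcd.le
      have k1 := (h₁.isAdjointAt hac (h.mono hsub) hη₁ ht1 hsp.isLocalProjection
        (hsp.mem_source t ht2) (hsp.mem t ht2)).congr hl (hl t ht1)
      have k2 := (h₂ t ht2).congr hr (hr t ht2)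
      exact ⟨m, Pr, U, k1.1, k1.2.1, k1.2.2.1, k1.2.2.2.1,
        hasDerivWithinAt_Icc_of_adjacent hac.le hcd.le (fun _ => k1.2.2.2.2)
          fun _ => k2.2.2.2.2⟩
    · have ht' : t ∈ Icc c d := ⟨htc.le, ht.2⟩
      exact ⟨m, Pr, U, ((h₂ t ht').congr hr (hr t ht')).mono_of_mem_nhdsWithin
        (Icc_right_mem_nhdsWithin htc)⟩

/-- The chart family starts at some `t₀ < c`, so its interval is a neighbourhood of the junction `c`
in `[a, d]`. -/
lemma IsC1CurveOfCurves.glue {σ₁ σ : ℝ → ℝ → M} {t₀ : ℝ} {X X' : ℝ → C(Icc t₀ d, E)}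
    (h₁ : IsC1CurveOfCurves E a c σ₁) (hat : a ≤ t₀) (htc : t₀ < c) (hcd : c ≤ d)
    (hX : IsChartFamily m σ t₀ d X X') (hσ : ∀ s, ∀ t ∈ Icc a c, σ s t = σ₁ s t) :
    IsC1CurveOfCurves E a d σ := by
  intro t ht
  rcases lt_or_ge t c with h | h
  · obtain ⟨r₀, r₁, hsub, hn, φ, hφ, x, x', hx, hx', hev⟩ := h₁ t ⟨ht.1, h.le⟩
    refine ⟨r₀, r₁, hsub.trans (Icc_subset_Icc_right hcd), ?_, φ, hφ, x, x', hx, hx', ?_⟩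
    · rw [← nhdsWithin_inter_of_mem' (Icc_left_mem_nhdsWithin (a := a) h),
        inter_eq_self_of_subset_right (Icc_subset_Icc_right hcd)]
      exact hn
    · filter_upwards [hev] with s hs τ
      obtain ⟨k1, k2, k3⟩ := hs τ
      rw [hσ s τ (hsub τ.2)]
      exact ⟨k1, k2, k3.congr (fun r hr => by rw [hσ s r (hsub hr)]) (by rw [hσ s τ (hsub τ.2)])⟩
  · exact hX.isC1CurveOfCurves_at (Icc_subset_Icc_left hat)
      (Icc_right_mem_nhdsWithin (htc.trans_le h))

/-- Families are continued forwards and covectors backwards. A vector of `W'` comes from some `z₀ ∈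
W`, realized by a family on `[a, c]` that prescribes the initial data on `[c, d]`. A covector
annihilating `W'` goes back to one annihilating `W`, which is the final value of a characteristic on
`[a, c]`. -/
lemma IsEndpointCovered.extend {k : ℕ} (hD : IsSmoothDistribution k D) (hac : a < c) (hcd : c < d)
    (h : IsHorizontalWith D a d γ g) (hsp : IsShortPiece D m Pr U c d γ g)
    (hT : IsEndpointCovered D P γ a c) : IsEndpointCovered D P γ a d := by
  have hcc : c ∈ Icc c d := left_mem_Icc.2 hcd.le
  have hac' : c ∈ Icc a c := right_mem_Icc.2 hac.le
  have had := hac.trans hcd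
  have hPr := hsp.isLocalProjection
  have hsrc := hsp.mem_source c hcc
  obtain ⟨W, hWim, hWη⟩ := hT
  obtain ⟨W', hW1, hW2⟩ := hsp.exists_variations hcd
    (h.mono (Icc_subset_Icc_left hac.le)) W
  refine ⟨W', fun z hz => ?_, fun l hl => ?_⟩
  · obtain ⟨z₀, hz₀, hfam⟩ := hW2 z hz
    obtain ⟨ξ, ⟨σ₁, hσ₁C, hσ₁, hσ₁ξ⟩, hξz⟩ := hWim z₀ hz₀
    have hσ₁0 : ∀ r ∈ Icc a c, σ₁ 0 r = γ r := fun r hr =>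
      congrArg Bundle.TotalSpace.proj (hσ₁ξ r hr)
    obtain ⟨t₀, t₁, ht01, hsub, -, htt, hn, X₁, X₁', hX₁⟩ := exists_isChartFamily hac hσ₁C hac'
      (m := m) (by rw [hσ₁0 c hac']; exact hsrc) univ_mem
    -- The chart interval contains `c` and lies in `[a, c]`, so it ends at `c`.
    obtain rfl : c = t₁ := le_antisymm htt.2 (hsub (right_mem_Icc.2 ht01.le)).2
    have hat : a ≤ t₀ := (hsub (left_mem_Icc.2 ht01.le)).1
    have hX₁0 : X₁ 0 ⟨c, htt⟩ = extChartAt 𝓘(ℝ, E) m (γ c) := by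
      have := (hX₁.eventually.self_of_nhds ⟨c, htt⟩).2.1
      rwa [hσ₁0 c hac'] at this
    have hX₁'0 : X₁' 0 ⟨c, htt⟩ = dchart E m (γ c) (g c) := by
      obtain ⟨-, -, h3⟩ := hX₁.eventually.self_of_nhds ⟨c, htt⟩
      refine (uniqueDiffOn_Icc ht01 c htt).eq_deriv _ h3 ?_
      refine ((h.hasDerivWithinAt_chart ⟨hac.le, hcd.le⟩ hsrc).mono
        (Icc_subset_Icc hat hcd.le)).congr (fun r hr => ?_) ?_
      · rw [hσ₁0 r (hsub hr)]
      · rw [hσ₁0 c hac']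
    have hy : ContDiffAt ℝ 1 (fun s => X₁ s ⟨c, htt⟩) 0 :=
      (evalL (K := Icc t₀ c) (G := E) ⟨c, htt⟩).contDiff.contDiffAt.comp (0 : ℝ) hX₁.contDiffAt
    have hv : ContDiffAt ℝ 1 (fun s => X₁' s ⟨c, htt⟩) 0 :=
      (evalL (K := Icc t₀ c) (G := E) ⟨c, htt⟩).contDiff.contDiffAt.comp (0 : ℝ) hX₁.contDiffAt'
    have hyd : deriv (fun s => X₁ s ⟨c, htt⟩) 0 = dchart E m (γ c) z₀ := by
      rw [(hX₁.hasDerivAt_apply ⟨c, htt⟩).deriv,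
        (hX₁.deriv_eq_dchart ⟨c, htt⟩ (hσ₁ξ c hac')).2]
      exact congrArg (dchart E m (γ c)) hξz
    obtain ⟨σ₂, X₂, X₂', hX₂, hσ₂0, hX₂z, hev⟩ := hfam _ _ hy hv hX₁0 hX₁'0 hyd
      (hX₁.eventually_apply_eq ht01 hsub hσ₁ hPr ⟨c, htt⟩ (by rw [hX₁0]; exact hsp.mem c hcc))
    have hX := hX₁.glue ht01.le hcd.le hX₂ (hev.mono fun s hs => ⟨hs.1, hs.2.1⟩)
    set σ : ℝ → ℝ → M := fun s t => if t ≤ c then σ₁ s t else σ₂ s t with hσdef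
    have hσl : ∀ s, ∀ t ∈ Icc a c, σ s t = σ₁ s t := fun s t ht => if_pos ht.2
    have hσr : ∀ᶠ s in 𝓝 (0 : ℝ), ∀ t ∈ Icc c d, σ s t = σ₂ s t := by
      filter_upwards [hev, hX₁.eventually, hX₂.eventually] with s hs hs₁ hs₂ t ht
      rcases ht.1.eq_or_lt with rfl | h
      · obtain ⟨k1, k2, -⟩ := hs₁ ⟨c, htt⟩
        obtain ⟨k3, k4, -⟩ := hs₂ ⟨c, hcc⟩
        rw [hσl s c hac']
        exact (chartAt E m).injOn k1 k3 (k2.symm.trans (hs.1.symm.trans k4))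
      · exact if_neg h.not_ge
    refine mem_endpointDifferentialImage had (hσ₁C.glue hat ht01 hcd.le hX hσl) ?_ ?_
      (ht01.le.trans hcd.le) hX (z := z) ?_
    · filter_upwards [hσ₁, hσr, hX₂.eventually_isHorizontalAt hcd hPr
        (hev.mono fun s hs => hs.2.2), hX.eventually_contMDiffOn (ht01.trans hcd), hX.eventually]
        with s h1 h2 h3 h4 h5
      obtain ⟨h6, h7⟩ := (mem_horizontalCurvesFrom_iff hac).1 h1
      refine (mem_horizontalCurvesFrom_iff had).2 ⟨fun t ht => ?_, ?_⟩
      · rcases lt_trichotomy t c with htc | htc | htc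
        · exact ((h6 t ⟨ht.1, htc.le⟩).congr (hσl s) (hσl s t ⟨ht.1, htc.le⟩)).mono_of_mem_nhdsWithin
            (Icc_left_mem_nhdsWithin htc)
        · subst htc
          -- At the junction the joined curve has a two-sided velocity by `h4`. Uniqueness of the
          -- derivative within `[c, d]` identifies it with the right-hand velocity, which lies in
          -- the distribution.
          obtain ⟨-, v, hv1, hv2⟩ := (h3 t hcc).congr h2 (h2 t hcc)
          have hmem : t ∈ Icc t₀ d := ⟨ht01.le, hcd.le⟩
          have k0 := h4.2 ⟨t, hmem⟩
          have k1 := (uniqueDiffOn_Icc hcd t hcc).eq_deriv _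
            (hv1.hasDerivWithinAt_chart (h5 ⟨t, hmem⟩).1)
            ((k0.mono (Icc_subset_Icc_left ht01.le)).hasDerivWithinAt_chart (h5 ⟨t, hmem⟩).1)
          have k2 := congrArg (dchartSymm m (extChartAt 𝓘(ℝ, E) m (σ s t))) k1
          have k3 := ((dchartSymm_dchart (h5 ⟨t, hmem⟩).1 v).symm.trans k2).trans
            (dchartSymm_dchart (h5 ⟨t, hmem⟩).1 _)
          have k4 : IsHorizontalAt D (σ s) (Icc t₀ d) t := by
            refine ⟨h4.1 t hmem, v, ?_, hv2⟩
            have k5 := k0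
            rw [← k3] at k5
            exact k5
          exact k4.mono_of_mem_nhdsWithin (Icc_right_mem_nhdsWithin ht01)
        · exact ((h3 t ⟨htc.le, ht.2⟩).congr h2 (h2 t ⟨htc.le, ht.2⟩)).mono_of_mem_nhdsWithin
            (Icc_right_mem_nhdsWithin htc)
      · rw [hσl s a (left_mem_Icc.2 hac.le)]
        exact h7
    · intro t ht
      rcases le_total t c with htc | htc
      · rw [hσl 0 t ⟨ht.1, htc⟩, hσ₁0 t ⟨ht.1, htc⟩]
      · rw [hσr.self_of_nhds t ⟨htc, ht.2⟩, hσ₂0 t ⟨htc, ht.2⟩]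
    · rw [← hX₂z]
      refine (hX.hasDerivAt_apply _).unique ((hX₂.hasDerivAt_apply _).congr_of_eventuallyEq ?_)
      exact Eventually.of_forall fun s => glueL_right ht01.le hcd.le _ _ _ hcd.le
  · obtain ⟨η₂, hη₂, hadj, hηd, hηc⟩ := hW1 l hl
    obtain ⟨η₁, hch, hη₁, hη₁c, hη₁a⟩ := hWη _ hηc
    have hc : η₁ c = η₂ c := by
      have h1 : (η₁ c).1 = (η₂ c).1 := (hη₁ c hac').trans (hη₂ c).symm
      have key : ∀ z z' : CotangentBundle E M, z.1 = z'.1 →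
          (show E →L[ℝ] ℝ from z.2) = (show E →L[ℝ] ℝ from z'.2) → z = z' := by
        rintro ⟨x, p⟩ ⟨x', p'⟩ hx hp
        obtain rfl : x = x' := hx
        obtain rfl : p = p' := hp
        rfl
      exact key _ _ h1 hη₁c
    refine ⟨_, hch.glue hD hac hcd h hsp hη₁ hη₂ hadj hc, fun t ht => ?_, ?_, fun v hv => ?_⟩
    · by_cases htc : t ≤ c
      · rw [if_pos htc]
        exact hη₁ t ⟨ht.1, htc⟩
      · rw [if_neg htc]
        exact hη₂ t
    · rw [if_neg hcd.not_ge]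
      exact hηd
    · rw [if_pos hac.le]
      exact hη₁a v hv

lemma IsHorizontalWith.isEndpointCovered {k : ℕ} (hD : IsSmoothDistribution k D) (hab : a < b)
    (h : IsHorizontalWith D a b γ g) (hP : IsEmbeddedSubmanifold (E := E) P) (hγ : γ a ∈ P) :
    IsEndpointCovered D P γ a b := by
  choose t₀ t₁ m Pr U ht01 hsub htt hn hsp using
    fun i : Icc a b => h.exists_isShortPiece hD hab i.2
  -- The subdivision is only weakly monotone, so the induction assumes `a < t n`. A step can be
  -- void, can be the first of positive length, or can extend an earlier piece.
  obtain ⟨t, h0, hmono, ⟨N, hN⟩, hcov⟩ := exists_monotone_Icc_subset_open_cover_Icc hab.le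
    (c := fun i : Icc a b => interior (Subtype.val ⁻¹' Icc (t₀ i) (t₁ i))) (fun _ => isOpen_interior)
    (fun x _ => mem_iUnion.2 ⟨x, mem_interior_iff_mem_nhds.2
      (preimage_coe_mem_nhds_subtype.2 (hn x))⟩)
  have hpiece : ∀ n, (t n : ℝ) < t (n + 1) → ∃ m Pr U, IsShortPiece D m Pr U (t n) (t (n + 1)) γ g := by
    intro n hlt
    obtain ⟨i, hi⟩ := hcov n
    have h1 := interior_subset (hi (left_mem_Icc.2 (hmono n.le_succ)))
    have h2 := interior_subset (hi (right_mem_Icc.2 (hmono n.le_succ)))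
    exact ⟨m i, Pr i, U i, (hsp i).mono h1.1 h2.2⟩
  have key : ∀ n, a < (t n : ℝ) → IsEndpointCovered D P γ a (t n) := by
    intro n
    induction n with
    | zero => rw [h0]; exact fun h => absurd h (lt_irrefl a)
    | succ n ih =>
      intro hlt
      have hsubn : Icc a (t (n + 1) : ℝ) ⊆ Icc a b := Icc_subset_Icc_right (t (n + 1)).2.2
      rcases (show (t n : ℝ) ≤ t (n + 1) from hmono n.le_succ).eq_or_lt with heq | hlt'
      · rw [← heq]
        exact ih (by rw [heq]; exact hlt)
      · obtain ⟨m, Pr, U, hp⟩ := hpiece n hlt'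
        rcases (t n).2.1.eq_or_lt with ha | ha
        · rw [← ha] at hp
          exact hp.isEndpointCovered hlt (h.mono hsubn) hP hγ
        · exact (ih ha).extend hD ha hlt' (h.mono hsubn) hp
  have h1 := key N
  rw [hN N le_rfl] at h1
  exact h1 hab

/-- If `W` and the tangent space of `Q` together spanned everything, `γ` would be regular, as `W`
lies in the endpoint image. Hence a nonzero covector annihilates both, and it is the final value of
the required characteristic. -/
lemma exists_isCharacteristic_of_isSingular {k : ℕ} (hD : IsSmoothDistribution k D) (hab : a < b)
    {Q : Set M} (hP : IsEmbeddedSubmanifold (E := E) P) (hQ : IsEmbeddedSubmanifold (E := E) Q)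
    (hγ : γ ∈ horizontalCurves D a b P Q) (hs : IsSingular D a b P Q γ) :
    ∃ η : ℝ → CotangentBundle E M, IsCharacteristic D a b η ∧ (∃ t ∈ Icc a b, (η t).2 ≠ 0) ∧
      (∀ t ∈ Icc a b, (η t).1 = γ t) ∧
      (∀ v ∈ tangentVectors 𝓘(ℝ, E) P (η a).1, (η a).2 v = 0) ∧
      (∀ v ∈ tangentVectors 𝓘(ℝ, E) Q (η b).1, (η b).2 v = 0) := by
  have ha : a ∈ Icc a b := left_mem_Icc.2 hab.le
  have hb : b ∈ Icc a b := right_mem_Icc.2 hab.le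
  obtain ⟨W, hWim, hWη⟩ :=
    (isHorizontalWith_velocity hγ.1).isEndpointCovered hD hab hP hγ.1.2.2
  obtain ⟨WQ, hWQ⟩ := hQ.exists_submodule hγ.2
  have hne : ∃ z : E, z ∉ W ⊔ WQ := by
    by_contra! hall
    refine hs fun w => ?_
    obtain ⟨u, hu, v, hv, huv⟩ := Submodule.mem_sup.1 (hall w)
    exact ⟨u, hWim u hu, v, (hWQ v).1 hv, huv.symm⟩
  obtain ⟨z, hz⟩ := hne
  obtain ⟨l, hlz, hl⟩ := exists_dual_ne_zero_of_notMem _ hz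
  obtain ⟨η, hη, hηγ, hηb, hηa⟩ := hWη l fun w hw => hl w (Submodule.mem_sup_left hw)
  refine ⟨η, hη, ⟨b, hb, fun h0 => hlz ?_⟩, hηγ, (eq_zero_of_tangentVectors (hηγ a ha)).2 hηa,
    (eq_zero_of_tangentVectors (hηγ b hb)).2 fun v hv => ?_⟩
  · rw [← hηb]
    exact DFunLike.congr_fun h0 z
  · rw [hηb]
    exact hl v (Submodule.mem_sup_right ((hWQ v).2 hv))

end Endpoint

end HorizontalCurves

end

theorem corollary3p7 {E : Type*} [NormedAddCommGroup E] [NormedSpace ℝ E] [FiniteDimensional ℝ E]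
    {M : Type*} [TopologicalSpace M] [T2Space M] [SecondCountableTopology M] [ChartedSpace E M]
    [IsManifold 𝓘(ℝ, E) ∞ M]
    (k : ℕ) (D : ∀ m : M, Submodule ℝ (TangentSpace 𝓘(ℝ, E) m))
    (hD : HorizontalCurves.IsSmoothDistribution k D)
    (P Q : Set M) (hP : HorizontalCurves.IsEmbeddedSubmanifold (E := E) P)
    (hQ : HorizontalCurves.IsEmbeddedSubmanifold (E := E) Q)
    (a b : ℝ) (hab : a < b)
    (γ : ℝ → M) (hγ : γ ∈ HorizontalCurves.horizontalCurves D a b P Q) :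
    HorizontalCurves.IsSingular D a b P Q γ ↔
      ∃ η : ℝ → HorizontalCurves.CotangentBundle E M,
        HorizontalCurves.IsCharacteristic D a b η ∧
        (∃ t ∈ Icc a b, (η t).2 ≠ 0) ∧
        (∀ t ∈ Icc a b, (η t).1 = γ t) ∧
        (∀ v ∈ HorizontalCurves.tangentVectors 𝓘(ℝ, E) P (η a).1, (η a).2 v = 0) ∧
        (∀ v ∈ HorizontalCurves.tangentVectors 𝓘(ℝ, E) Q (η b).1, (η b).2 v = 0) := by
  refine ⟨HorizontalCurves.exists_isCharacteristic_of_isSingular hD hab hP hQ hγ, ?_⟩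
  rintro ⟨η, hη, hne, hηγ, hηa, hηb⟩
  exact HorizontalCurves.isSingular_of_isCharacteristic hD hab
    (HorizontalCurves.isHorizontalWith_velocity hγ.1) hηγ hη hne hηa hηb
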